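/- **Conventions.** Let $k$ be a field of characteristic $0$ and let $X$ be a Noetherian topological space (for example a non-singular quasi-projective variety over $k$ with the Zariski topology). A *differential $P_0$-algebra* over $k$ is a unital graded commutative $k$-algebra $A=\bigoplus_{p\in\mathbb Z}A^p$ with a bilinear bracket $[\ ,\ ]\colon A^r\times A^s\to A^{r+s+1}$ and a linear differential $d\colon A^p\to A^{p+1}$, $d^2=0$, such that for homogeneous $a,b,c$ * $[a,b]=-(-1)^{(\deg a-1)(\deg b-1)}[b,a]$ and $[ab,c]=a[b,c]+(-1)^{\deg a\deg b}b[a,c]$, * $(-1)^{(\deg a-1)(\deg c-1)}[[a,b],c]+\text{cyclic permutations}=0$, * $d(ab)=(da)b+(-1)^{\deg a}a\,db$ and $d[a,b]=[da,b]+(-1)^{\deg a-1}[a,db]$. Morphisms are the unital algebra homomorphisms of degree $0$ that preserve bracket and differential. For an open set $U\subseteq X$ let $\mathfrak A(U)$ be the category of sheaves of differential $P_0$-algebras on $U$. A morphism in $\mathfrak A(U)$ is a *quasi-isomorphism* if it induces isomorphisms of the cohomology sheaves (equivalently, of the cohomology of all stalks). Two objects of $\mathfrak A(U)$ are *quasi-isomorphic*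 if they are connected by a zigzag of quasi-isomorphisms. Let $\Omega(\Delta^m)=k[t_0,\dots,t_m,dt_0,\dots,dt_m]/(\sum t_i-1,\sum dt_i)$ be the differential graded algebra of polynomial differential forms on the $m$-simplex. For a differential $P_0$-algebra $A$, the algebra $A\otimes\Omega(\Delta^m)$ is a differential $P_0$-algebra with $(a\otimes\omega)(b\otimes\eta)=(-1)^{\deg\omega\deg b}ab\otimes\omega\eta$, $[a\otimes\omega,b\otimes\eta]=(-1)^{\deg\omega(\deg b-1)}[a,b]\otimes\omega\eta$ and $d(a\otimes\omega)=da\otimes\omega+(-1)^{\deg a}a\otimes d\omega$. For $A,B\in\mathfrak A(U)$ let $\mathfrak M_U(A,B)$ be the simplicial set with $\mathfrak M_U(A,B)_m=\mathrm{Hom}(A,B\otimes\Omega(\Delta^m))$. The composition $\mathfrak M_U(A,B)\times\mathfrak M_U(B,C)\to\mathfrak M_U(A,C)$ is defined by extending $g\colon B\to C\otimes\Omega(\Delta^m)$ to an $\Omega(\Delta^m)$-linear morphism $B\otimes\Omega(\Delta^m)\to C\otimes\Omega(\Delta^m)$. For $U\subseteq V$ there is a restriction map $\mathfrak M_V(A,B)\to\mathfrak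 M_U(A|_U,B|_U)$. Let $\mathfrak U=\{U_0,\dots,U_n\}$ be a finite open cover of $X$. For $I\subseteq\{0,\dots,n\}$ with $|I|\ge2$ let $n(I)=\min I$ and $x(I)=\max I$, let $U_I=\bigcap_{i\in I}U_i$, let $P_I$ be the set of subsets of $I$ that contain $n(I)$ and $x(I)$, ordered by inclusion, and let $N(P_I)$ be its nerve. *Gluing data* $(A_0,\dots,A_n;\{K_I\})$ on $\mathfrak U$ consist of sheaves $A_i\in\mathfrak A(U_i)$, $0\le i\le n$, and, for every $I$ with $|I|\ge2$, a map of simplicial sets $$K_I\colon N(P_I)\to\mathfrak M_{U_I}(A_{n(I)}|_{U_I},A_{x(I)}|_{U_I}),$$ such that 1. if $|I|=2$, so that $N(P_I)$ is a point, the morphism $K_I\colon A_{n(I)}|_{U_I}\to A_{x(I)}|_{U_I}$ is a quasi-isomorphism; 2. for every $I$ and $i\in I$ with $n(I)<i<x(I)$, if $I_{\le i}=\{j\in I: j\le i\}$ and $I_{\ge i}=\{j\in I: j\ge i\}$, the composite of $N(P_{I_{\le i}})\times N(P_{I_{\ge i}})\to N(P_I)$, $(K,L)\mapsto K\cup L$,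 with $K_I$ sends each pair of $m$-simplices $(\sigma,\tau)$ to the composition of the restrictions to $U_I$ of $K_{I_{\le i}}(\sigma)$ and $K_{I_{\ge i}}(\tau)$; 3. for every $I$ and $i\in I$ with $n(I)<i<x(I)$, the restriction of $K_I$ along the inclusion $N(P_{I\setminus\{i\}})\to N(P_I)$ is $K_{I\setminus\{i\}}$ followed by restriction from $U_{I\setminus\{i\}}$ to $U_I$. **Theorem.** Let $\mathfrak U=\{U_0,\dots,U_n\}$ be a finite open cover of $X$ and let $(A_0,\dots,A_n;\{K_I\})$ be gluing data on $\mathfrak U$. Then there exists a sheaf of differential $P_0$-algebras $\mathbf A\in\mathfrak A(X)$ such that for all $0\le i\le n$ the restriction $\mathbf A|_{U_i}$ is quasi-isomorphic to $A_i$. -/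

import Mathlib

open CategoryTheory Opposite TopologicalSpace TensorProduct Simplicial

universe u

namespace P0Glue

noncomputable section

section Grading

variable {k : Type u} [Field k]

/-- If `M` is graded by `ℳ` and `N` by `𝒩`, the part of `M ⊗ N` spanned by the `x ⊗ y` with
`x` of degree `i`, `y` of degree `j` and `s i j = m`. -/
def tensorDeg {M N : Type u} [AddCommGroup M] [Module k M] [AddCommGroup N] [Module k N]
    {ι κ : Type} (ℳ : ι → Submodule k M) (𝒩 : κ → Submodule k N) (s : ι → κ → ℤ) (m : ℤ) :
    Submodule k (M ⊗[k] N) :=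
  Submodule.span k {z | ∃ i j, s i j = m ∧ ∃ x ∈ ℳ i, ∃ y ∈ 𝒩 j, x ⊗ₜ[k] y = z}

variable {M N : Type u} [AddCommGroup M] [Module k M] [AddCommGroup N] [Module k N]
  {ι κ : Type} (ℳ : ι → Submodule k M) (𝒩 : κ → Submodule k N) (s : ι → κ → ℤ)

theorem tmul_mem_tensorDeg {i : ι} {j : κ} {x : M} {y : N} (hx : x ∈ ℳ i) (hy : y ∈ 𝒩 j) :
    x ⊗ₜ[k] y ∈ tensorDeg ℳ 𝒩 s (s i j) :=
  Submodule.subset_span ⟨i, j, rfl, x, hx, y, hy, rfl⟩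

/-- A linear condition on the homogeneous part of degree `m` of `M ⊗ N` may be checked on
tensors of homogeneous elements. -/
theorem tensorDeg_induction {m : ℤ} {Q : M ⊗[k] N → Prop}
    (h : ∀ i j, s i j = m → ∀ x ∈ ℳ i, ∀ y ∈ 𝒩 j, Q (x ⊗ₜ[k] y))
    (h0 : Q 0) (hadd : ∀ z w, Q z → Q w → Q (z + w)) (hsmul : ∀ (c : k) z, Q z → Q (c • z))
    (z : M ⊗[k] N) (hz : z ∈ tensorDeg ℳ 𝒩 s m) : Q z := by
  refine Submodule.span_induction ?_ h0 (fun _ _ _ _ => hadd _ _) (fun c _ _ => hsmul c _) hz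
  rintro _ ⟨i, j, hij, x, hx, y, hy, rfl⟩
  exact h i j hij x hx y hy

variable [DecidableEq ι] [DecidableEq κ]

/-- The decomposition of `M ⊗ N` into homogeneous components, on homogeneous elements. -/
def tensorDecomposeAux (i : ι) (j : κ) :
    ℳ i →ₗ[k] 𝒩 j →ₗ[k] DirectSum ℤ (fun m => tensorDeg ℳ 𝒩 s m) :=
  LinearMap.mk₂ k
    (fun x y => DirectSum.lof k ℤ (fun m => tensorDeg ℳ 𝒩 s m) (s i j)
      ⟨(x : M) ⊗ₜ[k] (y : N), tmul_mem_tensorDeg ℳ 𝒩 s x.2 y.2⟩)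
    (fun x x' y => by
      rw [← map_add]; congr 1; ext; simp [TensorProduct.add_tmul])
    (fun c x y => by
      rw [← map_smul]; congr 1)
    (fun x y y' => by
      rw [← map_add]; congr 1; ext; simp [TensorProduct.tmul_add])
    (fun c x y => by
      rw [← map_smul]; congr 1; ext; simp)

variable [DirectSum.Decomposition ℳ] [DirectSum.Decomposition 𝒩]

/-- The decomposition of `M ⊗ N` into homogeneous components. -/
def tensorDecompose : M ⊗[k] N →ₗ[k] DirectSum ℤ (fun m => tensorDeg ℳ 𝒩 s m) :=
  TensorProduct.lift
    ((DirectSum.toModule k ι _ (fun i => LinearMap.flip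
      (DirectSum.toModule k κ _ (fun j => LinearMap.flip (tensorDecomposeAux ℳ 𝒩 s i j))))).compl₁₂
      (DirectSum.decomposeLinearEquiv ℳ).toLinearMap
      (DirectSum.decomposeLinearEquiv 𝒩).toLinearMap)

theorem tensorDecompose_tmul {i : ι} {j : κ} {x : M} {y : N} (hx : x ∈ ℳ i) (hy : y ∈ 𝒩 j) :
    tensorDecompose ℳ 𝒩 s (x ⊗ₜ[k] y) =
      DirectSum.lof k ℤ (fun m => tensorDeg ℳ 𝒩 s m) (s i j)
        ⟨x ⊗ₜ[k] y, tmul_mem_tensorDeg ℳ 𝒩 s hx hy⟩ := by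
  lift x to ℳ i using hx
  lift y to 𝒩 j using hy
  simp only [tensorDecompose, TensorProduct.lift.tmul, LinearMap.compl₁₂_apply,
    LinearEquiv.coe_coe, DirectSum.decomposeLinearEquiv_apply, DirectSum.decompose_coe]
  rw [← DirectSum.lof_eq_of k, ← DirectSum.lof_eq_of k, DirectSum.toModule_lof,
    LinearMap.flip_apply, DirectSum.toModule_lof]
  rfl

/-- Two linear maps on `M ⊗ N` agree if they agree on tensors of homogeneous elements. -/
theorem tensor_hom_ext {P : Type*} [AddCommGroup P] [Module k P] {f g : M ⊗[k] N →ₗ[k] P}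
    (h : ∀ i j, ∀ x ∈ ℳ i, ∀ y ∈ 𝒩 j, f (x ⊗ₜ[k] y) = g (x ⊗ₜ[k] y)) : f = g := by
  apply TensorProduct.ext
  refine DirectSum.decompose_lhom_ext ℳ fun i => ?_
  ext x : 1
  refine DirectSum.decompose_lhom_ext 𝒩 fun j => ?_
  ext y
  exact h i j x x.2 y y.2

/-- `M ⊗ N` is graded. -/
abbrev tensorDecomposition : DirectSum.Decomposition (tensorDeg ℳ 𝒩 s) :=
  DirectSum.Decomposition.ofLinearMap _ (tensorDecompose ℳ 𝒩 s)
    (by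
      apply tensor_hom_ext ℳ 𝒩
      intro i j x hx y hy
      simp [tensorDecompose_tmul ℳ 𝒩 s hx hy])
    (by
      ext m ⟨z, hz⟩ : 2
      simp only [LinearMap.comp_apply, DirectSum.coeLinearMap_lof, LinearMap.id_apply]
      have : ∀ z ∈ tensorDeg ℳ 𝒩 s m, ∀ hz', tensorDecompose ℳ 𝒩 s z =
          DirectSum.lof k ℤ (fun m => tensorDeg ℳ 𝒩 s m) m ⟨z, hz'⟩ := by
        intro z hz
        refine Submodule.span_induction ?_ ?_ ?_ ?_ hz
        · rintro _ ⟨i, j, rfl, x, hx, y, hy, rfl⟩ hz'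
          exact tensorDecompose_tmul ℳ 𝒩 s hx hy
        · intro h
          rw [map_zero]
          exact (map_zero (DirectSum.lof k ℤ (fun m => tensorDeg ℳ 𝒩 s m) m)).symm
        · intro z w hz hw h1 h2 h3
          rw [map_add, h1 hz, h2 hw, ← map_add]; rfl
        · intro c z hz h1 h2
          rw [map_smul, h1 hz, ← map_smul]; rfl
      exact this z hz hz)

end Grading

section Forms

variable (k : Type u) [Field k]

/-- The algebra of polynomial differential forms on the geometric `n`-simplex,
`k[t₀, …, tₙ, dt₀, …, dtₙ] / (∑ tᵢ - 1, ∑ dtᵢ)`, written in the coordinates `t₁, …, tₙ`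
(here indexed by `Fin n`) as the tensor product of a polynomial ring and an exterior algebra. -/
abbrev Omega (n : ℕ) : Type u :=
  MvPolynomial (Fin n) k ⊗[k] ExteriorAlgebra k (Fin n → k)

/-- The forms of degree `q`. -/
def omegaDeg (n : ℕ) : ℤ → Submodule k (Omega k n) :=
  tensorDeg (fun _ : Unit => (⊤ : Submodule k (MvPolynomial (Fin n) k)))
    (fun r : ℕ => ⋀[k]^r (Fin n → k)) (fun _ r => (r : ℤ))

instance (n : ℕ) :
    DirectSum.Decomposition (fun _ : Unit => (⊤ : Submodule k (MvPolynomial (Fin n) k))) :=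
  DirectSum.Decomposition.ofLinearMap _
    (DirectSum.lof k Unit (fun _ => (⊤ : Submodule k (MvPolynomial (Fin n) k))) () ∘ₗ
      Submodule.topEquiv.symm.toLinearMap)
    (by refine LinearMap.ext fun x => ?_; simp)
    (by
      refine DirectSum.linearMap_ext _ fun i => ?_
      ext x : 1
      simp only [LinearMap.comp_apply, DirectSum.coeLinearMap_lof]
      rfl)

variable {k}

theorem omega_induction {n : ℕ} {q : ℤ} {Q : Omega k n → Prop}
    (h : ∀ (f : MvPolynomial (Fin n) k) (r : ℕ), (r : ℤ) = q → ∀ α ∈ ⋀[k]^r (Fin n → k),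
      Q (f ⊗ₜ[k] α))
    (h0 : Q 0) (hadd : ∀ z w, Q z → Q w → Q (z + w))
    (z : Omega k n) (hz : z ∈ omegaDeg k n q) : Q z := by
  suffices ∀ c : k, Q (c • z) by simpa using this 1
  refine Submodule.span_induction (p := fun z _ => ∀ c : k, Q (c • z)) ?_ ?_ ?_ ?_ hz
  · rintro _ ⟨i, j, hij, x, hx, y, hy, rfl⟩ c
    rw [TensorProduct.smul_tmul']
    exact h _ j hij y hy
  · intro c; simpa
  · intro x y _ _ h1 h2 c
    rw [smul_add]; exact hadd _ _ (h1 c) (h2 c)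
  · intro d x _ h1 c
    rw [smul_smul]; exact h1 _

theorem tmul_mem_omegaDeg {n r : ℕ} (f : MvPolynomial (Fin n) k)
    {α : ExteriorAlgebra k (Fin n → k)} (hα : α ∈ ⋀[k]^r (Fin n → k)) :
    f ⊗ₜ[k] α ∈ omegaDeg k n r :=
  tmul_mem_tensorDeg (fun _ : Unit => (⊤ : Submodule k (MvPolynomial (Fin n) k)))
    (fun r : ℕ => ⋀[k]^r (Fin n → k)) (fun _ r => (r : ℤ)) (i := ()) trivial hα

instance (n : ℕ) : SetLike.GradedMonoid (omegaDeg k n) where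
  one_mem := by
    have := tmul_mem_omegaDeg (k := k) (n := n) (r := 0) 1
      (SetLike.GradedOne.one_mem (A := fun r : ℕ => ⋀[k]^r (Fin n → k)))
    exact this
  mul_mem := by
    intro p q x y hx hy
    refine omega_induction (Q := fun x => x * y ∈ omegaDeg k n (p + q)) ?_ (by simp) ?_ x hx
    · rintro f r rfl α hα
      refine omega_induction (Q := fun y => (f ⊗ₜ[k] α) * y ∈ omegaDeg k n (r + q)) ?_ (by simp)
        ?_ y hy
      · rintro g s rfl β hβ
        rw [Algebra.TensorProduct.tmul_mul_tmul]
        have := tmul_mem_omegaDeg (k := k) (f * g)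
          (SetLike.GradedMul.mul_mem (A := fun r : ℕ => ⋀[k]^r (Fin n → k)) hα hβ)
        simpa using this
      · intro z w h1 h2
        rw [mul_add]; exact add_mem h1 h2
    · intro z w h1 h2
      rw [add_mul]; exact add_mem h1 h2

instance (n : ℕ) : GradedAlgebra (omegaDeg k n) :=
  { (inferInstance : SetLike.GradedMonoid (omegaDeg k n)),
    tensorDecomposition (fun _ : Unit => (⊤ : Submodule k (MvPolynomial (Fin n) k)))
    (fun r : ℕ => ⋀[k]^r (Fin n → k)) (fun _ r => (r : ℤ)) with }

/-- The de Rham differential, `d (f α) = ∑ᵢ (∂f/∂tᵢ) dtᵢ ∧ α` for a polynomial `f` and a form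
`α` with constant coefficients. -/
def omegaD (n : ℕ) : Omega k n →ₗ[k] Omega k n :=
  ∑ i, TensorProduct.map (MvPolynomial.pderiv i).toLinearMap
    (LinearMap.mulLeft k (ExteriorAlgebra.ι k (Pi.single i 1 : Fin n → k)))

theorem omegaD_tmul {n : ℕ} (f : MvPolynomial (Fin n) k) (α : ExteriorAlgebra k (Fin n → k)) :
    omegaD n (f ⊗ₜ[k] α) = ∑ i, MvPolynomial.pderiv i f ⊗ₜ[k]
      (ExteriorAlgebra.ι k (Pi.single i 1 : Fin n → k) * α) := by
  simp [omegaD]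

theorem ι_mem_one {n : ℕ} (v : Fin n → k) : ExteriorAlgebra.ι k v ∈ ⋀[k]^1 (Fin n → k) := by
  simp

theorem ι_mul_comm {n r : ℕ} (v : Fin n → k) {α : ExteriorAlgebra k (Fin n → k)}
    (hα : α ∈ ⋀[k]^r (Fin n → k)) :
    ExteriorAlgebra.ι k v * α = (-1 : k) ^ (r : ℤ) • (α * ExteriorAlgebra.ι k v) := by
  induction hα using Submodule.pow_induction_on_left' with
  | algebraMap c => simp [Algebra.commutes]
  | add x y i _ _ h1 h2 => rw [mul_add, add_mul, smul_add, h1, h2]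
  | mem_mul m hm i x hx ih =>
    obtain ⟨w, rfl⟩ := hm
    have hs : ExteriorAlgebra.ι k v * ExteriorAlgebra.ι k w =
        - (ExteriorAlgebra.ι k w * ExteriorAlgebra.ι k v) :=
      eq_neg_of_add_eq_zero_left (ExteriorAlgebra.ι_add_mul_swap v w)
    rw [← mul_assoc, hs, neg_mul, mul_assoc, ih, mul_smul_comm, ← mul_assoc]
    rw [Nat.cast_succ, zpow_add_one₀ (by simp)]
    simp

theorem ext_mul_comm {n r s : ℕ} {α β : ExteriorAlgebra k (Fin n → k)}
    (hα : α ∈ ⋀[k]^r (Fin n → k)) (hβ : β ∈ ⋀[k]^s (Fin n → k)) :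
    α * β = (-1 : k) ^ ((r : ℤ) * s) • (β * α) := by
  induction hα using Submodule.pow_induction_on_left' with
  | algebraMap c => simp [Algebra.commutes]
  | add x y i _ _ h1 h2 => rw [mul_add, add_mul, smul_add, h1, h2]
  | mem_mul m hm i x hx ih =>
    obtain ⟨w, rfl⟩ := hm
    rw [mul_assoc, ih, mul_smul_comm, ← mul_assoc, ι_mul_comm w hβ, smul_mul_assoc, smul_smul,
      mul_assoc, ← zpow_add₀ (by simp)]
    congr 2
    push_cast
    ring

theorem omega_mul_comm {n : ℕ} {p q : ℤ} {x y : Omega k n} (hx : x ∈ omegaDeg k n p)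
    (hy : y ∈ omegaDeg k n q) : x * y = (-1 : k) ^ (p * q) • (y * x) := by
  refine omega_induction (Q := fun x => x * y = (-1 : k) ^ (p * q) • (y * x)) ?_ (by simp) ?_ x hx
  · rintro f r rfl α hα
    refine omega_induction (Q := fun y => (f ⊗ₜ[k] α) * y = (-1 : k) ^ (r * q) • (y * (f ⊗ₜ[k] α)))
      ?_ (by simp) ?_ y hy
    · rintro g s rfl β hβ
      rw [Algebra.TensorProduct.tmul_mul_tmul, Algebra.TensorProduct.tmul_mul_tmul,
        ext_mul_comm hα hβ, mul_comm f g, TensorProduct.tmul_smul]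
    · intro z w h1 h2
      rw [mul_add, add_mul, smul_add, h1, h2]
  · intro z w h1 h2
    rw [mul_add, add_mul, smul_add, h1, h2]

theorem omegaD_mem {n : ℕ} {p : ℤ} {x : Omega k n} (hx : x ∈ omegaDeg k n p) :
    omegaD n x ∈ omegaDeg k n (p + 1) := by
  refine omega_induction (Q := fun x => omegaD n x ∈ omegaDeg k n (p + 1)) ?_ (by simp) ?_ x hx
  · rintro f r rfl α hα
    rw [omegaD_tmul]
    refine sum_mem fun i _ => ?_
    have := tmul_mem_omegaDeg (k := k) (MvPolynomial.pderiv i f)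
          (SetLike.GradedMul.mul_mem (A := fun r : ℕ => ⋀[k]^r (Fin n → k))
            (ι_mem_one (Pi.single i 1)) hα)
    rw [add_comm]
    simpa using this
  · intro z w h1 h2
    rw [map_add]; exact add_mem h1 h2

theorem omegaD_mul {n : ℕ} {p : ℤ} {x : Omega k n} (hx : x ∈ omegaDeg k n p) (y : Omega k n) :
    omegaD n (x * y) = omegaD n x * y + (-1 : k) ^ p • (x * omegaD n y) := by
  refine omega_induction (Q := fun x => omegaD n (x * y) =
    omegaD n x * y + (-1 : k) ^ p • (x * omegaD n y)) ?_ (by simp) ?_ x hx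
  · rintro f r rfl α hα
    induction y using TensorProduct.induction_on with
    | zero => simp
    | tmul g β =>
      rw [Algebra.TensorProduct.tmul_mul_tmul]
      simp only [omegaD_tmul]
      rw [Finset.sum_mul, Finset.mul_sum, Finset.smul_sum, ← Finset.sum_add_distrib]
      refine Finset.sum_congr rfl fun i _ => ?_
      rw [Algebra.TensorProduct.tmul_mul_tmul, Algebra.TensorProduct.tmul_mul_tmul,
        Derivation.leibniz, TensorProduct.add_tmul, ← mul_assoc, ι_mul_comm _ hα, smul_mul_assoc,
        mul_assoc]
      simp only [smul_eq_mul, TensorProduct.tmul_smul]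
      rw [mul_comm g, add_comm]
    | add a b h1 h2 =>
      rw [mul_add, map_add, h1, h2, map_add, mul_add, mul_add, smul_add]
      abel
  · intro z w h1 h2
    rw [map_add, add_mul, map_add, h1, h2, add_mul, add_mul, smul_add]
    abel

theorem omegaD_omegaD {n : ℕ} (x : Omega k n) : omegaD n (omegaD n x) = 0 := by
  induction x using TensorProduct.induction_on with
  | zero => simp
  | add a b h1 h2 => rw [map_add, map_add, h1, h2, add_zero]
  | tmul f α =>
    rw [omegaD_tmul, map_sum]
    simp only [omegaD_tmul]
    have key : ∀ i j : Fin n, MvPolynomial.pderiv j (MvPolynomial.pderiv i f) ⊗ₜ[k]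
        (ExteriorAlgebra.ι k (Pi.single j 1 : Fin n → k) *
          (ExteriorAlgebra.ι k (Pi.single i 1 : Fin n → k) * α)) =
        - (MvPolynomial.pderiv i (MvPolynomial.pderiv j f) ⊗ₜ[k]
        (ExteriorAlgebra.ι k (Pi.single i 1 : Fin n → k) *
          (ExteriorAlgebra.ι k (Pi.single j 1 : Fin n → k) * α))) := by
      intro i j
      rw [← mul_assoc, ← mul_assoc, eq_neg_of_add_eq_zero_left (ExteriorAlgebra.ι_add_mul_swap
        (Pi.single j 1 : Fin n → k) (Pi.single i 1)), neg_mul, TensorProduct.tmul_neg]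
      congr 2
      have : ⁅(MvPolynomial.pderiv j : Derivation k (MvPolynomial (Fin n) k) (MvPolynomial (Fin n) k)),
          (MvPolynomial.pderiv i : Derivation k (MvPolynomial (Fin n) k) (MvPolynomial (Fin n) k))⁆ = 0 := by
        refine MvPolynomial.derivation_ext fun l => ?_
        rw [Derivation.commutator_apply, MvPolynomial.pderiv_X, MvPolynomial.pderiv_X]
        simp [Pi.single_apply, apply_ite]
      have h2 := congrArg (fun D : Derivation k (MvPolynomial (Fin n) k) (MvPolynomial (Fin n) k) => D f) this
      rw [Derivation.commutator_apply] at h2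
      exact sub_eq_zero.mp h2
    rw [← Finset.sum_product']
    refine Finset.sum_involution (fun a _ => (a.2, a.1)) ?_ ?_ (by simp) (by simp)
    · rintro ⟨i, j⟩ _
      rw [key]; simp
    · rintro ⟨i, j⟩ _ h heq
      apply h
      obtain rfl : j = i := congrArg Prod.fst heq
      simp only
      rw [← mul_assoc, ExteriorAlgebra.ι_sq_zero, zero_mul, TensorProduct.tmul_zero]

end Forms

section Pullback

variable (k : Type u) [Field k]

/-- The barycentric coordinates `t₀ = 1 - ∑ tᵢ, t₁, …, tₙ` as polynomials. -/
def bary (n : ℕ) : Fin (n + 1) → MvPolynomial (Fin n) k :=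
  Fin.cases (1 - ∑ i, MvPolynomial.X i) MvPolynomial.X

/-- The differentials `dt₀ = - ∑ dtᵢ, dt₁, …, dtₙ` of the barycentric coordinates. -/
def baryD (n : ℕ) : Fin (n + 1) → (Fin n → k) :=
  Fin.cases (- ∑ i, Pi.single i 1) (fun i => Pi.single i 1)

theorem sum_bary (n : ℕ) : ∑ j, bary k n j = 1 := by
  simp [Fin.sum_univ_succ, bary]

theorem sum_baryD (n : ℕ) : ∑ j, baryD k n j = 0 := by
  simp [Fin.sum_univ_succ, baryD]

/-- The algebra map with `tᵢ ↦ ∑_{θ j = i} tⱼ`. -/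
def polyPullback {m n : ℕ} (θ : Fin (m + 1) → Fin (n + 1)) :
    MvPolynomial (Fin n) k →ₐ[k] MvPolynomial (Fin m) k :=
  MvPolynomial.aeval fun i => ∑ j with θ j = i.succ, bary k m j

/-- The linear map with `dtᵢ ↦ ∑_{θ j = i} dtⱼ`. -/
def linPullback {m n : ℕ} (θ : Fin (m + 1) → Fin (n + 1)) :
    (Fin n → k) →ₗ[k] (Fin m → k) :=
  Fintype.linearCombination k fun i => ∑ j with θ j = i.succ, baryD k m j

/-- The pullback of forms along the affine map of simplices given by `θ` on vertices. -/
def omegaPullback {m n : ℕ} (θ : Fin (m + 1) → Fin (n + 1)) : Omega k n →ₐ[k] Omega k m :=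
  Algebra.TensorProduct.map (polyPullback k θ) (ExteriorAlgebra.map (linPullback k θ))

variable {k}

theorem sum_fiber {M : Type*} [AddCommGroup M] {m n : ℕ} (θ : Fin (m + 1) → Fin (n + 1))
    (g : Fin (m + 1) → M) :
    ∑ j with θ j = 0, g j = ∑ j, g j - ∑ i : Fin n, ∑ j with θ j = i.succ, g j := by
  rw [← Finset.sum_fiberwise_of_maps_to (s := Finset.univ) (t := Finset.univ) (g := θ)
    (fun _ _ => Finset.mem_univ _), Fin.sum_univ_succ]
  simp

theorem polyPullback_bary {m n : ℕ} (θ : Fin (m + 1) → Fin (n + 1)) (i : Fin (n + 1)) :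
    polyPullback k θ (bary k n i) = ∑ j with θ j = i, bary k m j := by
  refine Fin.cases ?_ (fun i => ?_) i
  · rw [sum_fiber, sum_bary]
    simp [bary, polyPullback]
  · simp [bary, polyPullback]

theorem linPullback_single {m n : ℕ} (θ : Fin (m + 1) → Fin (n + 1)) (i : Fin n) :
    linPullback k θ (Pi.single i 1) = ∑ j with θ j = i.succ, baryD k m j := by
  simp [linPullback]

theorem linPullback_baryD {m n : ℕ} (θ : Fin (m + 1) → Fin (n + 1)) (i : Fin (n + 1)) :
    linPullback k θ (baryD k n i) = ∑ j with θ j = i, baryD k m j := by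
  refine Fin.cases ?_ (fun i => ?_) i
  · rw [sum_fiber, sum_baryD]
    simp [baryD, linPullback_single, map_neg, map_sum]
  · simp [baryD, linPullback_single]

theorem omegaPullback_id (n : ℕ) :
    omegaPullback k (id : Fin (n + 1) → Fin (n + 1)) = AlgHom.id k _ := by
  have h1 : polyPullback k (id : Fin (n + 1) → Fin (n + 1)) = AlgHom.id k _ := by
    ext i; simp [polyPullback, bary, Finset.filter_eq']
  have h2 : linPullback k (id : Fin (n + 1) → Fin (n + 1)) = LinearMap.id := by
    refine LinearMap.pi_ext' fun i => LinearMap.ext_ring ?_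
    simp only [LinearMap.comp_apply, LinearMap.single_apply, linPullback_single]
    simp [baryD, Finset.filter_eq']
  rw [omegaPullback, h1, h2, ExteriorAlgebra.map_id, Algebra.TensorProduct.map_id]

theorem omegaPullback_comp {l m n : ℕ} (θ : Fin (m + 1) → Fin (n + 1))
    (ψ : Fin (l + 1) → Fin (m + 1)) :
    omegaPullback k (θ ∘ ψ) = (omegaPullback k ψ).comp (omegaPullback k θ) := by
  have key : ∀ {M : Type u} [AddCommGroup M] (g : Fin (l + 1) → M) (i : Fin (n + 1)),
      ∑ j with (θ ∘ ψ) j = i, g j = ∑ a with θ a = i, ∑ j with ψ j = a, g j := by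
    intro M _ g i
    rw [← Finset.sum_fiberwise_of_maps_to (s := Finset.univ.filter fun j => (θ ∘ ψ) j = i)
      (t := Finset.univ.filter fun a => θ a = i) (g := ψ) (by simp)]
    refine Finset.sum_congr rfl fun a ha => Finset.sum_congr ?_ fun _ _ => rfl
    ext j
    simp only [Finset.mem_filter, Finset.mem_univ, true_and] at ha ⊢
    constructor
    · exact fun h => h.2
    · rintro rfl; exact ⟨ha, rfl⟩
  have h1 : polyPullback k (θ ∘ ψ) = (polyPullback k ψ).comp (polyPullback k θ) := by
    ext1 i
    have := polyPullback_bary (k := k) θ i.succ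
    have h0 : (MvPolynomial.X i : MvPolynomial (Fin n) k) = bary k n i.succ := by simp [bary]
    rw [AlgHom.comp_apply, h0, polyPullback_bary, polyPullback_bary, map_sum, key]
    exact Finset.sum_congr rfl fun a _ => (polyPullback_bary ψ a).symm
  have h2 : linPullback k (θ ∘ ψ) = (linPullback k ψ).comp (linPullback k θ) := by
    refine LinearMap.pi_ext' fun i => LinearMap.ext_ring ?_
    simp only [LinearMap.comp_apply, LinearMap.single_apply, linPullback_single]
    rw [map_sum, key]
    exact Finset.sum_congr rfl fun a _ => (linPullback_baryD ψ a).symm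
  rw [omegaPullback, h1, h2, ← ExteriorAlgebra.map_comp_map]
  exact Algebra.TensorProduct.map_comp ..

theorem omegaPullback_mem {m n : ℕ} (θ : Fin (m + 1) → Fin (n + 1)) {q : ℤ} {x : Omega k n}
    (hx : x ∈ omegaDeg k n q) : omegaPullback k θ x ∈ omegaDeg k m q := by
  refine omega_induction (Q := fun x => omegaPullback k θ x ∈ omegaDeg k m q) ?_ (by simp) ?_ x hx
  · rintro f r rfl α hα
    rw [omegaPullback, Algebra.TensorProduct.map_tmul]
    apply tmul_mem_omegaDeg
    clear hx
    induction hα using Submodule.pow_induction_on_left' with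
    | algebraMap c =>
      rw [AlgHom.commutes]
      exact SetLike.algebraMap_mem_graded (A := fun r : ℕ => ⋀[k]^r (Fin m → k)) c
    | add x y i _ _ h1 h2 =>
      rw [map_add]
      exact add_mem h1 h2
    | mem_mul m hm i x hx ih =>
      obtain ⟨w, rfl⟩ := hm
      rw [map_mul, ExteriorAlgebra.map_apply_ι, Nat.succ_eq_add_one, add_comm]
      exact SetLike.GradedMul.mul_mem (A := fun r : ℕ => ⋀[k]^r (Fin _ → k)) (ι_mem_one _) ih
  · intro z w h1 h2
    rw [map_add]; exact add_mem h1 h2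

theorem omegaD_one (n : ℕ) : omegaD n (1 : Omega k n) = 0 := by
  rw [Algebra.TensorProduct.one_def, omegaD_tmul]; simp

theorem omegaD_bary (n : ℕ) (i : Fin (n + 1)) :
    omegaD n (bary k n i ⊗ₜ[k] 1) = 1 ⊗ₜ[k] ExteriorAlgebra.ι k (baryD k n i) := by
  have h : ∀ i : Fin n, omegaD n ((MvPolynomial.X i : MvPolynomial (Fin n) k) ⊗ₜ[k] 1) =
      1 ⊗ₜ[k] ExteriorAlgebra.ι k (Pi.single i 1) := by
    intro i
    rw [omegaD_tmul]
    simp only [MvPolynomial.pderiv_X, mul_one]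
    rw [Finset.sum_eq_single i]
    · simp
    · intro j _ hj; simp [hj.symm]
    · simp
  refine Fin.cases ?_ (fun i => ?_) i
  · simp only [bary, baryD, Fin.cases_zero, TensorProduct.sub_tmul, TensorProduct.sum_tmul,
      map_sub, map_sum, h, map_neg, TensorProduct.tmul_neg, TensorProduct.tmul_sum]
    rw [← Algebra.TensorProduct.one_def, omegaD_one, zero_sub]
  · simpa [bary, baryD] using h i

theorem omegaPullback_d {m n : ℕ} (θ : Fin (m + 1) → Fin (n + 1)) (x : Omega k n) :
    omegaPullback k θ (omegaD n x) = omegaD m (omegaPullback k θ x) := by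
  have hpoly : ∀ f : MvPolynomial (Fin n) k, omegaPullback k θ (omegaD n (f ⊗ₜ[k] 1)) =
      omegaD m (omegaPullback k θ (f ⊗ₜ[k] 1)) := by
    have hz : ∀ {l : ℕ} (f : MvPolynomial (Fin l) k), f ⊗ₜ[k] 1 ∈ omegaDeg k l 0 := fun f =>
      tmul_mem_omegaDeg (r := 0) f
        (SetLike.GradedOne.one_mem (A := fun r : ℕ => ⋀[k]^r (Fin _ → k)))
    intro f
    induction f using MvPolynomial.induction_on with
    | C a =>
      have h1 : ∀ l : ℕ, (MvPolynomial.C a : MvPolynomial (Fin l) k) ⊗ₜ[k]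
          (1 : ExteriorAlgebra k (Fin l → k)) = a • 1 := by
        intro l
        rw [Algebra.TensorProduct.one_def, TensorProduct.smul_tmul', MvPolynomial.C_eq_smul_one]
      rw [h1, map_smul, omegaD_one, smul_zero, map_zero, map_smul, map_one, map_smul, omegaD_one,
        smul_zero]
    | add p q h1 h2 => rw [TensorProduct.add_tmul, map_add, map_add, map_add, map_add, h1, h2]
    | mul_X p i h =>
      have e : (p * MvPolynomial.X i) ⊗ₜ[k] (1 : ExteriorAlgebra k (Fin n → k)) =
          (p ⊗ₜ[k] 1) * (bary k n i.succ ⊗ₜ[k] 1) := by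
        rw [Algebra.TensorProduct.tmul_mul_tmul]; simp [bary]
      have hX : omegaPullback k θ (omegaD n (bary k n i.succ ⊗ₜ[k] 1)) =
          omegaD m (omegaPullback k θ (bary k n i.succ ⊗ₜ[k] 1)) := by
        rw [omegaD_bary, omegaPullback, Algebra.TensorProduct.map_tmul,
          Algebra.TensorProduct.map_tmul, map_one, map_one, ExteriorAlgebra.map_apply_ι,
          polyPullback_bary, linPullback_baryD, TensorProduct.sum_tmul, map_sum, map_sum,
          TensorProduct.tmul_sum]
        exact Finset.sum_congr rfl fun j _ => (omegaD_bary m j).symm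
      rw [e, omegaD_mul (hz p), map_add, map_smul, map_mul, map_mul, map_mul,
        omegaD_mul (omegaPullback_mem θ (hz p)), h, hX]
  have hext : ∀ α, omegaD m (omegaPullback k θ ((1 : MvPolynomial (Fin n) k) ⊗ₜ[k] α)) = 0 := by
    intro α
    rw [omegaPullback, Algebra.TensorProduct.map_tmul, map_one, omegaD_tmul]
    simp
  have hext' : ∀ α, omegaD n ((1 : MvPolynomial (Fin n) k) ⊗ₜ[k] α) = 0 := by
    intro α; rw [omegaD_tmul]; simp
  induction x using TensorProduct.induction_on with
  | zero => simp
  | add a b h1 h2 => simp only [map_add, h1, h2]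
  | tmul f α =>
    have e : f ⊗ₜ[k] α = (f ⊗ₜ[k] 1) * (1 ⊗ₜ[k] α) := by
      rw [Algebra.TensorProduct.tmul_mul_tmul]; simp
    have hz : ∀ {l : ℕ} (f : MvPolynomial (Fin l) k), f ⊗ₜ[k] 1 ∈ omegaDeg k l 0 := fun f =>
      tmul_mem_omegaDeg (r := 0) f
        (SetLike.GradedOne.one_mem (A := fun r : ℕ => ⋀[k]^r (Fin _ → k)))
    rw [e, omegaD_mul (hz f), map_mul, omegaD_mul (omegaPullback_mem θ (hz f)), hext, hext',
      mul_zero, smul_zero, mul_zero, smul_zero, add_zero, add_zero, map_mul, hpoly]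

end Pullback

/-- A differential `P₀`-algebra over `k`: a unital associative graded commutative algebra
`⨁ Aᵖ` with a Poisson bracket of degree `1` and a differential of degree `1` which is a derivation
of the product and of the bracket. -/
structure DGP0Alg (k : Type u) [Field k] where
  carrier : Type u
  [ring : Ring carrier]
  [algebra : Algebra k carrier]
  /-- the homogeneous component of degree `p` -/
  deg : ℤ → Submodule k carrier
  [graded : GradedAlgebra deg]
  mul_comm' : ∀ {p q : ℤ} {a b : carrier}, a ∈ deg p → b ∈ deg q →
    a * b = (-1 : k) ^ (p * q) • (b * a)
  /-- the Poisson bracket -/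
  bracket : carrier →ₗ[k] carrier →ₗ[k] carrier
  bracket_mem : ∀ {p q : ℤ} {a b : carrier}, a ∈ deg p → b ∈ deg q →
    bracket a b ∈ deg (p + q + 1)
  bracket_symm : ∀ {p q : ℤ} {a b : carrier}, a ∈ deg p → b ∈ deg q →
    bracket a b = - ((-1 : k) ^ ((p - 1) * (q - 1)) • bracket b a)
  bracket_mul : ∀ {p q r : ℤ} {a b c : carrier}, a ∈ deg p → b ∈ deg q → c ∈ deg r →
    bracket (a * b) c = a * bracket b c + (-1 : k) ^ (p * q) • (b * bracket a c)
  jacobi : ∀ {p q r : ℤ} {a b c : carrier}, a ∈ deg p → b ∈ deg q → c ∈ deg r →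
    (-1 : k) ^ ((p - 1) * (r - 1)) • bracket (bracket a b) c +
    (-1 : k) ^ ((q - 1) * (p - 1)) • bracket (bracket b c) a +
    (-1 : k) ^ ((r - 1) * (q - 1)) • bracket (bracket c a) b = 0
  /-- the differential -/
  d : carrier →ₗ[k] carrier
  d_mem : ∀ {p : ℤ} {a : carrier}, a ∈ deg p → d a ∈ deg (p + 1)
  d_d : ∀ a : carrier, d (d a) = 0
  d_mul : ∀ {p q : ℤ} {a b : carrier}, a ∈ deg p → b ∈ deg q →
    d (a * b) = d a * b + (-1 : k) ^ p • (a * d b)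
  d_bracket : ∀ {p q : ℤ} {a b : carrier}, a ∈ deg p → b ∈ deg q →
    d (bracket a b) = bracket (d a) b + (-1 : k) ^ (p - 1) • bracket a (d b)

namespace DGP0Alg

variable {k : Type u} [Field k]

attribute [instance] ring algebra graded

/-- A morphism of differential `P₀`-algebras: a unital algebra homomorphism of degree `0`
compatible with the brackets and the differentials. -/
@[ext]
structure Hom (A B : DGP0Alg k) where
  toAlgHom : A.carrier →ₐ[k] B.carrier
  map_deg : ∀ {p : ℤ} {a : A.carrier}, a ∈ A.deg p → toAlgHom a ∈ B.deg p
  map_bracket : ∀ a b : A.carrier,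
    toAlgHom (A.bracket a b) = B.bracket (toAlgHom a) (toAlgHom b)
  map_d : ∀ a : A.carrier, toAlgHom (A.d a) = B.d (toAlgHom a)

instance : Category (DGP0Alg k) where
  Hom := Hom
  id A := ⟨AlgHom.id k _, fun h => h, fun _ _ => rfl, fun _ => rfl⟩
  comp f g := ⟨g.toAlgHom.comp f.toAlgHom, fun h => g.map_deg (f.map_deg h),
    fun a b => by simp [f.map_bracket, g.map_bracket], fun a => by simp [f.map_d, g.map_d]⟩

theorem hom_ext {A B : DGP0Alg k} {f g : A ⟶ B}
    (h : ∀ a, f.toAlgHom a = g.toAlgHom a) : f = g :=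
  Hom.ext (AlgHom.ext h)

@[simp] theorem id_toAlgHom (A : DGP0Alg k) : Hom.toAlgHom (𝟙 A) = AlgHom.id k _ := rfl

@[simp] theorem comp_toAlgHom {A B C : DGP0Alg k} (f : A ⟶ B) (g : B ⟶ C) :
    Hom.toAlgHom (f ≫ g) = g.toAlgHom.comp f.toAlgHom := rfl

end DGP0Alg

section Scale

variable {k : Type u} [Field k] {M : Type u} [AddCommGroup M] [Module k M]
  (ℳ : ℤ → Submodule k M) [DirectSum.Decomposition ℳ]

/-- The linear map acting on the component of degree `p` as multiplication by `c p`. -/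
def degScale (c : ℤ → k) : M →ₗ[k] M :=
  DirectSum.toModule k ℤ M (fun p => c p • (ℳ p).subtype) ∘ₗ
    (DirectSum.decomposeLinearEquiv ℳ).toLinearMap

theorem degScale_apply (c : ℤ → k) {p : ℤ} {x : M} (hx : x ∈ ℳ p) :
    degScale ℳ c x = c p • x := by
  lift x to ℳ p using hx
  simp only [degScale, LinearMap.comp_apply, LinearEquiv.coe_coe,
    DirectSum.decomposeLinearEquiv_apply, DirectSum.decompose_coe]
  rw [← DirectSum.lof_eq_of k, DirectSum.toModule_lof]
  rfl

end Scale

theorem sign_congr {k : Type u} [Field k] {a b : ℤ} (h : Even (a - b)) :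
    (-1 : k) ^ a = (-1 : k) ^ b := by
  have : a = b + (a - b) := by ring
  rw [this, zpow_add₀ (by simp), h.neg_one_zpow, mul_one]

theorem units_smul_eq {k : Type u} [Field k] {M : Type*} [AddCommGroup M] [Module k M] (a : ℤ)
    (x : M) : ((-1 : ℤˣ) ^ a) • x = (-1 : k) ^ a • x := by
  rcases Int.even_or_odd a with h | h
  · rw [h.neg_one_zpow, h.neg_one_zpow, one_smul, one_smul]
  · rw [h.neg_one_zpow, h.neg_one_zpow, Units.neg_smul, neg_smul, one_smul,
      one_smul]

section Tensor

variable {k : Type u} [Field k] (A : DGP0Alg k) (n : ℕ)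

/-- The underlying algebra of `A ⊗ Ω(Δⁿ)`, with
`(a ⊗ ω) (b ⊗ η) = (-1)^(deg ω deg b) a b ⊗ ω η`. -/
def TensorOmega : Type u := GradedTensorProduct k A.deg (omegaDeg k n)

instance : Ring (TensorOmega A n) :=
  inferInstanceAs (Ring (GradedTensorProduct k A.deg (omegaDeg k n)))

instance : Algebra k (TensorOmega A n) :=
  inferInstanceAs (Algebra k (GradedTensorProduct k A.deg (omegaDeg k n)))

/-- The underlying vector space of `A ⊗ Ω(Δⁿ)` is the tensor product. -/
def TensorOmega.of : A.carrier ⊗[k] Omega k n ≃ₗ[k] TensorOmega A n :=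
  GradedTensorProduct.of k A.deg (omegaDeg k n)

variable {A n} in
/-- The element `a ⊗ ω`. -/
abbrev tmulΩ (a : A.carrier) (ω : Omega k n) : TensorOmega A n :=
  TensorOmega.of A n (a ⊗ₜ[k] ω)

/-- The grading of `A ⊗ Ω(Δⁿ)` by total degree. -/
def TensorOmega.deg : ℤ → Submodule k (TensorOmega A n) :=
  fun m => (tensorDeg A.deg (omegaDeg k n) (fun p q => p + q) m).map (TensorOmega.of A n).toLinearMap

variable {A n}

theorem tmulΩ_mem {p q m : ℤ} {a : A.carrier} {ω : Omega k n} (ha : a ∈ A.deg p)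
    (hω : ω ∈ omegaDeg k n q) (h : p + q = m) : tmulΩ a ω ∈ TensorOmega.deg A n m := by
  subst h
  exact Submodule.mem_map_of_mem
    (tmul_mem_tensorDeg A.deg (omegaDeg k n) (fun p q => p + q) ha hω)

theorem TensorOmega.hom_ext {P : Type*} [AddCommGroup P] [Module k P]
    {f g : TensorOmega A n →ₗ[k] P}
    (h : ∀ p q, ∀ a ∈ A.deg p, ∀ ω ∈ omegaDeg k n q, f (tmulΩ a ω) = g (tmulΩ a ω)) :
    f = g := by
  have : f ∘ₗ (TensorOmega.of A n).toLinearMap = g ∘ₗ (TensorOmega.of A n).toLinearMap :=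
    tensor_hom_ext A.deg (omegaDeg k n) h
  ext z
  simpa using congrArg (fun φ => φ ((TensorOmega.of A n).symm z)) this

/-- Two linear maps agree on elements of degree `m` if they agree on homogeneous tensors. -/
theorem TensorOmega.eq_of_deg {P : Type*} [AddCommGroup P] [Module k P]
    (f g : TensorOmega A n →ₗ[k] P) {m : ℤ}
    (h : ∀ p q, p + q = m → ∀ a ∈ A.deg p, ∀ ω ∈ omegaDeg k n q, f (tmulΩ a ω) = g (tmulΩ a ω))
    {z : TensorOmega A n} (hz : z ∈ TensorOmega.deg A n m) : f z = g z := by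
  obtain ⟨z, hz, rfl⟩ := hz
  refine tensorDeg_induction A.deg (omegaDeg k n) (fun p q => p + q)
    (Q := fun z => f (TensorOmega.of A n z) = g (TensorOmega.of A n z)) h (by simp) ?_ ?_ z hz
  · intro z w h1 h2
    simp only [map_add, h1, h2]
  · intro c z h1
    simp only [map_smul, h1]

/-- A linear map sends elements of degree `m` to `S` if it does so on homogeneous tensors. -/
theorem TensorOmega.mem_of_deg {P : Type*} [AddCommGroup P] [Module k P]
    (f : TensorOmega A n →ₗ[k] P) (S : Submodule k P) {m : ℤ}
    (h : ∀ p q, p + q = m → ∀ a ∈ A.deg p, ∀ ω ∈ omegaDeg k n q, f (tmulΩ a ω) ∈ S)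
    {z : TensorOmega A n} (hz : z ∈ TensorOmega.deg A n m) : f z ∈ S := by
  have := TensorOmega.eq_of_deg (S.mkQ ∘ₗ f) 0 (m := m)
    (fun p q hpq a ha ω hω => by simpa using h p q hpq a ha ω hω) hz
  simpa using this

theorem tmulΩ_mul {p q : ℤ} (a : A.carrier) {ω : Omega k n} (hω : ω ∈ omegaDeg k n q)
    {b : A.carrier} (hb : b ∈ A.deg p) (η : Omega k n) :
    tmulΩ a ω * tmulΩ b η = (-1 : k) ^ (q * p) • tmulΩ (a * b) (ω * η) := by
  have := GradedTensorProduct.tmul_coe_mul_coe_tmul (R := k) A.deg (omegaDeg k n) a ⟨ω, hω⟩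
    ⟨b, hb⟩ η
  rw [← units_smul_eq (k := k)]
  exact this

instance : DirectSum.Decomposition (TensorOmega.deg A n) :=
  letI := tensorDecomposition A.deg (omegaDeg k n) (fun p q => p + q)
  DirectSum.Decomposition.ofLinearMap _
    (DirectSum.toModule k ℤ _ (fun m =>
      DirectSum.lof k ℤ (fun m => TensorOmega.deg A n m) m ∘ₗ
        (TensorOmega.of A n).toLinearMap.submoduleMap
          (tensorDeg A.deg (omegaDeg k n) (fun p q => p + q) m)) ∘ₗ
      (DirectSum.decomposeLinearEquiv
        (tensorDeg A.deg (omegaDeg k n) (fun p q => p + q))).toLinearMap ∘ₗ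
      (TensorOmega.of A n).symm.toLinearMap)
    (by
      refine TensorOmega.hom_ext fun p q a ha ω hω => ?_
      have hm := tmul_mem_tensorDeg A.deg (omegaDeg k n) (fun p q => p + q) ha hω
      simp only [LinearMap.comp_apply, LinearEquiv.coe_coe, LinearEquiv.symm_apply_apply,
        DirectSum.decomposeLinearEquiv_apply, LinearMap.id_apply]
      rw [DirectSum.decompose_of_mem _ hm, ← DirectSum.lof_eq_of k, DirectSum.toModule_lof]
      exact DirectSum.coeLinearMap_lof (TensorOmega.deg A n) _ _)
    (by
      refine DirectSum.linearMap_ext _ fun m => ?_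
      ext ⟨_, z, hz, rfl⟩ : 1
      simp only [LinearMap.comp_apply, LinearEquiv.coe_coe, LinearMap.id_apply,
        DirectSum.coeLinearMap_lof, LinearEquiv.symm_apply_apply,
        DirectSum.decomposeLinearEquiv_apply]
      rw [DirectSum.decompose_of_mem _ hz, ← DirectSum.lof_eq_of k, DirectSum.toModule_lof]
      rfl)

instance : GradedAlgebra (TensorOmega.deg A n) :=
  { (inferInstance : DirectSum.Decomposition (TensorOmega.deg A n)) with
    one_mem := tmulΩ_mem (SetLike.GradedOne.one_mem (A := A.deg))
      (SetLike.GradedOne.one_mem (A := omegaDeg k n)) (by simp)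
    mul_mem := by
      intro i j x y hx hy
      refine TensorOmega.mem_of_deg ((LinearMap.mul k (TensorOmega A n)).flip y) _ ?_ hx
      rintro p q rfl a ha ω hω
      refine TensorOmega.mem_of_deg (LinearMap.mul k (TensorOmega A n) (tmulΩ a ω)) _ ?_ hy
      rintro p' q' rfl b hb η hη
      rw [LinearMap.mul_apply', tmulΩ_mul a hω hb η]
      exact Submodule.smul_mem _ _ (tmulΩ_mem (SetLike.GradedMul.mul_mem ha hb)
        (SetLike.GradedMul.mul_mem hω hη) (by ring)) }

variable (A n)

/-- The differential `d (a ⊗ ω) = d a ⊗ ω + (-1)^(deg a) a ⊗ d ω`. -/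
def TensorOmega.d : TensorOmega A n →ₗ[k] TensorOmega A n :=
  (TensorOmega.of A n).toLinearMap ∘ₗ
  (TensorProduct.map A.d LinearMap.id +
    TensorProduct.map (degScale A.deg fun p => (-1) ^ p) (omegaD n)) ∘ₗ
  (TensorOmega.of A n).symm.toLinearMap

/-- The bracket `[a ⊗ ω, b ⊗ η] = (-1)^(deg ω (deg b - 1)) [a, b] ⊗ ω η`; the two summands take
care of the parts of `b` of even and of odd degree. -/
def TensorOmega.bracket : TensorOmega A n →ₗ[k] TensorOmega A n →ₗ[k] TensorOmega A n :=
  ((TensorProduct.map₂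
      (A.bracket.compl₂ (degScale A.deg fun p => if Even p then 1 else 0))
      (LinearMap.mul k (Omega k n) ∘ₗ degScale (omegaDeg k n) fun q => (-1) ^ q) +
    TensorProduct.map₂
      (A.bracket.compl₂ (degScale A.deg fun p => if Even p then 0 else 1))
      (LinearMap.mul k (Omega k n))).compl₁₂
    (TensorOmega.of A n).symm.toLinearMap
    (TensorOmega.of A n).symm.toLinearMap).compr₂
    (TensorOmega.of A n).toLinearMap

variable {A n}

theorem TensorOmega.d_tmul {p : ℤ} {a : A.carrier} (ha : a ∈ A.deg p) (ω : Omega k n) :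
    TensorOmega.d A n (tmulΩ a ω) =
      tmulΩ (A.d a) ω + (-1 : k) ^ p • tmulΩ a (omegaD n ω) := by
  simp [TensorOmega.d, degScale_apply A.deg _ ha, ← TensorProduct.smul_tmul']

theorem TensorOmega.bracket_tmul {p q : ℤ} (a : A.carrier) {ω : Omega k n}
    (hω : ω ∈ omegaDeg k n q) {b : A.carrier} (hb : b ∈ A.deg p) (η : Omega k n) :
    TensorOmega.bracket A n (tmulΩ a ω) (tmulΩ b η) =
      (-1 : k) ^ (q * (p - 1)) • tmulΩ (A.bracket a b) (ω * η) := by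
  rcases Int.even_or_odd p with h | h
  · have e : (-1 : k) ^ (q * (p - 1)) = (-1) ^ q := by
      apply sign_congr
      obtain ⟨c, rfl⟩ := h
      exact ⟨q * (c - 1), by ring⟩
    simp [TensorOmega.bracket, degScale_apply A.deg _ hb, degScale_apply (omegaDeg k n) _ hω, h, e]
  · have e : (-1 : k) ^ (q * (p - 1)) = 1 := by
      have : Even (q * (p - 1)) := (h.sub_odd odd_one).mul_left q
      exact this.neg_one_zpow
    simp [TensorOmega.bracket, degScale_apply A.deg _ hb, degScale_apply (omegaDeg k n) _ hω,
      Int.not_even_iff_odd.mpr h, e]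

end Tensor

section TensorAxioms

variable {k : Type u} [Field k] {A : DGP0Alg k} {n : ℕ}

theorem smul_tmulΩ (c : k) (a : A.carrier) (ω : Omega k n) :
    tmulΩ (c • a) ω = c • tmulΩ a ω := by
  rw [tmulΩ, ← TensorProduct.smul_tmul', map_smul]

theorem tmulΩ_smul (c : k) (a : A.carrier) (ω : Omega k n) :
    tmulΩ a (c • ω) = c • tmulΩ a ω := by
  rw [tmulΩ, TensorProduct.tmul_smul, map_smul]

theorem add_tmulΩ (a b : A.carrier) (ω : Omega k n) :
    tmulΩ (a + b) ω = tmulΩ a ω + tmulΩ b ω := by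
  rw [tmulΩ, TensorProduct.add_tmul, map_add]

theorem tmulΩ_add (a : A.carrier) (ω η : Omega k n) :
    tmulΩ a (ω + η) = tmulΩ a ω + tmulΩ a η := by
  rw [tmulΩ, TensorProduct.tmul_add, map_add]

theorem neg_tmulΩ (a : A.carrier) (ω : Omega k n) : tmulΩ (-a) ω = - tmulΩ a ω := by
  rw [tmulΩ, TensorProduct.neg_tmul, map_neg]

theorem zero_tmulΩ (ω : Omega k n) : tmulΩ (0 : A.carrier) ω = 0 := by
  rw [tmulΩ, TensorProduct.zero_tmul, map_zero]

theorem tmulΩ_zero (a : A.carrier) : tmulΩ a (0 : Omega k n) = 0 := by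
  rw [tmulΩ, TensorProduct.tmul_zero, map_zero]

theorem sign_mul (a b : ℤ) : (-1 : k) ^ a * (-1 : k) ^ b = (-1 : k) ^ (a + b) :=
  (zpow_add₀ (by simp) a b).symm

theorem tensor_mul_comm {s t : ℤ} {x y : TensorOmega A n} (hx : x ∈ TensorOmega.deg A n s)
    (hy : y ∈ TensorOmega.deg A n t) : x * y = (-1 : k) ^ (s * t) • (y * x) := by
  refine TensorOmega.eq_of_deg ((LinearMap.mul k _).flip y)
    ((-1 : k) ^ (s * t) • LinearMap.mul k _ y) ?_ hx
  rintro p i rfl a ha α hα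
  refine TensorOmega.eq_of_deg (LinearMap.mul k _ (tmulΩ a α))
    ((-1 : k) ^ ((p + i) * t) • (LinearMap.mul k _).flip (tmulΩ a α)) ?_ hy
  rintro q j rfl b hb β hβ
  simp only [LinearMap.mul_apply', LinearMap.smul_apply, LinearMap.flip_apply]
  rw [tmulΩ_mul a hα hb, tmulΩ_mul b hβ ha, A.mul_comm' ha hb, omega_mul_comm hα hβ]
  simp only [smul_tmulΩ, tmulΩ_smul, smul_smul, sign_mul]
  congr 1
  apply sign_congr
  simp only [Int.even_add, Int.even_sub, Int.even_mul]
  grind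

theorem tensor_bracket_mem {s t : ℤ} {x y : TensorOmega A n} (hx : x ∈ TensorOmega.deg A n s)
    (hy : y ∈ TensorOmega.deg A n t) :
    TensorOmega.bracket A n x y ∈ TensorOmega.deg A n (s + t + 1) := by
  refine TensorOmega.mem_of_deg ((TensorOmega.bracket A n).flip y) _ ?_ hx
  rintro p i rfl a ha α hα
  refine TensorOmega.mem_of_deg (TensorOmega.bracket A n (tmulΩ a α)) _ ?_ hy
  rintro q j rfl b hb β hβ
  rw [TensorOmega.bracket_tmul a hα hb]
  exact Submodule.smul_mem _ _ (tmulΩ_mem (A.bracket_mem ha hb)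
    (SetLike.GradedMul.mul_mem hα hβ) (by ring))

theorem tensor_bracket_symm {s t : ℤ} {x y : TensorOmega A n} (hx : x ∈ TensorOmega.deg A n s)
    (hy : y ∈ TensorOmega.deg A n t) : TensorOmega.bracket A n x y =
      - ((-1 : k) ^ ((s - 1) * (t - 1)) • TensorOmega.bracket A n y x) := by
  refine TensorOmega.eq_of_deg ((TensorOmega.bracket A n).flip y)
    (- ((-1 : k) ^ ((s - 1) * (t - 1)) • TensorOmega.bracket A n y)) ?_ hx
  rintro p i rfl a ha α hα
  refine TensorOmega.eq_of_deg (TensorOmega.bracket A n (tmulΩ a α))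
    (- ((-1 : k) ^ ((p + i - 1) * (t - 1)) • (TensorOmega.bracket A n).flip (tmulΩ a α))) ?_ hy
  rintro q j rfl b hb β hβ
  simp only [LinearMap.smul_apply, LinearMap.flip_apply, LinearMap.neg_apply]
  rw [TensorOmega.bracket_tmul a hα hb, TensorOmega.bracket_tmul b hβ ha, A.bracket_symm ha hb,
    omega_mul_comm hα hβ]
  simp only [smul_tmulΩ, tmulΩ_smul, smul_smul, sign_mul, neg_tmulΩ, smul_neg]
  congr 2
  apply sign_congr
  simp only [Int.even_add, Int.even_sub, Int.even_mul, Int.not_even_one]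
  grind

theorem tensor_bracket_mul {s t v : ℤ} {x y z : TensorOmega A n}
    (hx : x ∈ TensorOmega.deg A n s) (hy : y ∈ TensorOmega.deg A n t)
    (hz : z ∈ TensorOmega.deg A n v) :
    TensorOmega.bracket A n (x * y) z = x * TensorOmega.bracket A n y z +
      (-1 : k) ^ (s * t) • (y * TensorOmega.bracket A n x z) := by
  refine TensorOmega.eq_of_deg ((TensorOmega.bracket A n).flip z ∘ₗ (LinearMap.mul k _).flip y)
    ((LinearMap.mul k _).flip (TensorOmega.bracket A n y z) +
      (-1 : k) ^ (s * t) • (LinearMap.mul k _ y ∘ₗ (TensorOmega.bracket A n).flip z)) ?_ hx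
  rintro p i rfl a ha α hα
  refine TensorOmega.eq_of_deg
    ((TensorOmega.bracket A n).flip z ∘ₗ LinearMap.mul k _ (tmulΩ a α))
    (LinearMap.mul k _ (tmulΩ a α) ∘ₗ (TensorOmega.bracket A n).flip z +
      (-1 : k) ^ ((p + i) * t) • (LinearMap.mul k _).flip
        (TensorOmega.bracket A n (tmulΩ a α) z)) ?_ hy
  rintro q j rfl b hb β hβ
  refine TensorOmega.eq_of_deg
    (TensorOmega.bracket A n (tmulΩ a α * tmulΩ b β))
    (LinearMap.mul k _ (tmulΩ a α) ∘ₗ TensorOmega.bracket A n (tmulΩ b β) +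
      (-1 : k) ^ ((p + i) * (q + j)) • (LinearMap.mul k _ (tmulΩ b β) ∘ₗ
        TensorOmega.bracket A n (tmulΩ a α))) ?_ hz
  rintro r l rfl c hc γ hγ
  simp only [LinearMap.mul_apply', LinearMap.smul_apply, LinearMap.add_apply, LinearMap.comp_apply]
  rw [tmulΩ_mul a hα hb, map_smul, LinearMap.smul_apply,
    TensorOmega.bracket_tmul (a * b) (SetLike.GradedMul.mul_mem hα hβ) hc,
    TensorOmega.bracket_tmul b hβ hc, TensorOmega.bracket_tmul a hα hc,
    mul_smul_comm, mul_smul_comm,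
    tmulΩ_mul a hα (A.bracket_mem hb hc), tmulΩ_mul b hβ (A.bracket_mem ha hc),
    A.bracket_mul ha hb hc, ← mul_assoc, ← mul_assoc, omega_mul_comm hβ hα]
  simp only [smul_tmulΩ, tmulΩ_smul, add_tmulΩ, smul_add, smul_mul_assoc, smul_smul, sign_mul]
  congr 2
  · apply sign_congr
    simp only [Int.even_add, Int.even_sub, Int.even_mul, Int.not_even_one]
    grind
  · apply sign_congr
    simp only [Int.even_add, Int.even_sub, Int.even_mul, Int.not_even_one]
    grind

theorem tensor_d_mem {s : ℤ} {x : TensorOmega A n} (hx : x ∈ TensorOmega.deg A n s) :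
    TensorOmega.d A n x ∈ TensorOmega.deg A n (s + 1) := by
  refine TensorOmega.mem_of_deg (TensorOmega.d A n) _ ?_ hx
  rintro p i rfl a ha α hα
  rw [TensorOmega.d_tmul ha]
  exact add_mem (tmulΩ_mem (A.d_mem ha) hα (by ring))
    (Submodule.smul_mem _ _ (tmulΩ_mem ha (omegaD_mem hα) (by ring)))

theorem tensor_d_d (x : TensorOmega A n) : TensorOmega.d A n (TensorOmega.d A n x) = 0 := by
  suffices TensorOmega.d A n ∘ₗ TensorOmega.d A n = 0 from congrArg (fun φ => φ x) this
  refine TensorOmega.hom_ext fun p i a ha α hα => ?_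
  rw [LinearMap.comp_apply, TensorOmega.d_tmul ha, map_add, map_smul,
    TensorOmega.d_tmul (A.d_mem ha), TensorOmega.d_tmul ha, A.d_d, omegaD_omegaD]
  rw [zero_tmulΩ, tmulΩ_zero, zpow_add₀ (by simp)]
  simp

theorem tensor_d_mul {s t : ℤ} {x y : TensorOmega A n} (hx : x ∈ TensorOmega.deg A n s)
    (hy : y ∈ TensorOmega.deg A n t) : TensorOmega.d A n (x * y) =
      TensorOmega.d A n x * y + (-1 : k) ^ s • (x * TensorOmega.d A n y) := by
  refine TensorOmega.eq_of_deg (TensorOmega.d A n ∘ₗ (LinearMap.mul k _).flip y)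
    ((LinearMap.mul k _).flip y ∘ₗ TensorOmega.d A n +
      (-1 : k) ^ s • (LinearMap.mul k _).flip (TensorOmega.d A n y)) ?_ hx
  rintro p i rfl a ha α hα
  refine TensorOmega.eq_of_deg (TensorOmega.d A n ∘ₗ LinearMap.mul k _ (tmulΩ a α))
    (LinearMap.mul k _ (TensorOmega.d A n (tmulΩ a α)) +
      (-1 : k) ^ (p + i) • (LinearMap.mul k _ (tmulΩ a α) ∘ₗ TensorOmega.d A n)) ?_ hy
  rintro q j rfl b hb β hβ
  simp only [LinearMap.mul_apply', LinearMap.smul_apply, LinearMap.add_apply, LinearMap.comp_apply]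
  rw [TensorOmega.d_tmul ha, TensorOmega.d_tmul hb, tmulΩ_mul a hα hb, map_smul,
    TensorOmega.d_tmul (SetLike.GradedMul.mul_mem ha hb), add_mul, mul_add, smul_mul_assoc,
    mul_smul_comm, tmulΩ_mul _ hα hb, tmulΩ_mul _ (omegaD_mem hα) hb, tmulΩ_mul _ hα (A.d_mem hb),
    tmulΩ_mul _ hα hb, A.d_mul ha hb, omegaD_mul hα]
  simp only [smul_tmulΩ, tmulΩ_smul, tmulΩ_add, add_tmulΩ, smul_add, smul_smul, sign_mul]
  have e1 : (-1 : k) ^ (i * q + p) = (-1 : k) ^ (p + i + i * (q + 1)) := sign_congr (by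
    simp only [Int.even_add, Int.even_sub, Int.even_mul, Int.not_even_one]
    grind)
  have e2 : (-1 : k) ^ (i * q + (p + q)) = (-1 : k) ^ (p + (i + 1) * q) := sign_congr (by
    simp only [Int.even_add, Int.even_sub, Int.even_mul, Int.not_even_one]
    grind)
  have e3 : (-1 : k) ^ (i * q + (p + q + i)) = (-1 : k) ^ (p + i + (q + i * q)) := sign_congr (by
    simp only [Int.even_add, Int.even_sub, Int.even_mul, Int.not_even_one]
    grind)
  rw [e1, e2, e3]
  abel

theorem tensor_d_bracket {s t : ℤ} {x y : TensorOmega A n} (hx : x ∈ TensorOmega.deg A n s)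
    (hy : y ∈ TensorOmega.deg A n t) : TensorOmega.d A n (TensorOmega.bracket A n x y) =
      TensorOmega.bracket A n (TensorOmega.d A n x) y +
      (-1 : k) ^ (s - 1) • TensorOmega.bracket A n x (TensorOmega.d A n y) := by
  refine TensorOmega.eq_of_deg (TensorOmega.d A n ∘ₗ (TensorOmega.bracket A n).flip y)
    ((TensorOmega.bracket A n).flip y ∘ₗ TensorOmega.d A n +
      (-1 : k) ^ (s - 1) • (TensorOmega.bracket A n).flip (TensorOmega.d A n y)) ?_ hx
  rintro p i rfl a ha α hα
  refine TensorOmega.eq_of_deg (TensorOmega.d A n ∘ₗ TensorOmega.bracket A n (tmulΩ a α))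
    (TensorOmega.bracket A n (TensorOmega.d A n (tmulΩ a α)) +
      (-1 : k) ^ (p + i - 1) • (TensorOmega.bracket A n (tmulΩ a α) ∘ₗ TensorOmega.d A n)) ?_ hy
  rintro q j rfl b hb β hβ
  simp only [LinearMap.smul_apply, LinearMap.add_apply, LinearMap.comp_apply]
  rw [TensorOmega.d_tmul ha, TensorOmega.d_tmul hb, TensorOmega.bracket_tmul a hα hb, map_smul,
    TensorOmega.d_tmul (A.bracket_mem ha hb)]
  simp only [map_add, map_smul, LinearMap.add_apply, LinearMap.smul_apply]
  rw [TensorOmega.bracket_tmul _ hα hb, TensorOmega.bracket_tmul _ (omegaD_mem hα) hb,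
    TensorOmega.bracket_tmul _ hα (A.d_mem hb),
    TensorOmega.bracket_tmul _ hα hb, A.d_bracket ha hb, omegaD_mul hα]
  simp only [smul_tmulΩ, tmulΩ_smul, tmulΩ_add, add_tmulΩ, smul_add, smul_smul, sign_mul]
  have e1 : (-1 : k) ^ (i * (q - 1) + (p - 1)) = (-1 : k) ^ (p + i - 1 + i * (q + 1 - 1)) :=
    sign_congr (by
      simp only [Int.even_add, Int.even_sub, Int.even_mul, Int.not_even_one]
      grind)
  have e2 : (-1 : k) ^ (i * (q - 1) + (p + q + 1)) = (-1 : k) ^ (p + (i + 1) * (q - 1)) :=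
    sign_congr (by
      simp only [Int.even_add, Int.even_sub, Int.even_mul, Int.not_even_one]
      grind)
  have e3 : (-1 : k) ^ (i * (q - 1) + (p + q + 1 + i)) =
      (-1 : k) ^ (p + i - 1 + (q + i * (q - 1))) := sign_congr (by
    simp only [Int.even_add, Int.even_sub, Int.even_mul, Int.not_even_one]
    grind)
  rw [e1, e2, e3]
  abel

theorem zero_of_deg (f : TensorOmega A n →ₗ[k] TensorOmega A n) {m : ℤ}
    (h : ∀ p q, p + q = m → ∀ a ∈ A.deg p, ∀ ω ∈ omegaDeg k n q, f (tmulΩ a ω) = 0)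
    {z : TensorOmega A n} (hz : z ∈ TensorOmega.deg A n m) : f z = 0 := by
  have := TensorOmega.mem_of_deg f ⊥ (fun p q hpq a ha ω hω =>
    (Submodule.mem_bot k).mpr (h p q hpq a ha ω hω)) hz
  exact (Submodule.mem_bot k).mp this

theorem tensor_jacobi {s t v : ℤ} {x y z : TensorOmega A n}
    (hx : x ∈ TensorOmega.deg A n s) (hy : y ∈ TensorOmega.deg A n t)
    (hz : z ∈ TensorOmega.deg A n v) :
    (-1 : k) ^ ((s - 1) * (v - 1)) • TensorOmega.bracket A n (TensorOmega.bracket A n x y) z +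
    (-1 : k) ^ ((t - 1) * (s - 1)) • TensorOmega.bracket A n (TensorOmega.bracket A n y z) x +
    (-1 : k) ^ ((v - 1) * (t - 1)) • TensorOmega.bracket A n (TensorOmega.bracket A n z x) y
      = 0 := by
  obtain ⟨B, hB⟩ : ∃ B, B = TensorOmega.bracket A n := ⟨_, rfl⟩
  rw [← hB]
  have h1 := zero_of_deg ((-1 : k) ^ ((s - 1) * (v - 1)) • (B.flip z ∘ₗ B.flip y) +
      (-1 : k) ^ ((t - 1) * (s - 1)) • B (B y z) +
      (-1 : k) ^ ((v - 1) * (t - 1)) • (B.flip y ∘ₗ B z)) (z := x) (m := s)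
  simp only [LinearMap.smul_apply, LinearMap.add_apply, LinearMap.comp_apply,
    LinearMap.flip_apply] at h1
  refine h1 ?_ hx
  rintro p i rfl a ha α hα
  have h2 := zero_of_deg ((-1 : k) ^ ((p + i - 1) * (v - 1)) • (B.flip z ∘ₗ B (tmulΩ a α)) +
      (-1 : k) ^ ((t - 1) * (p + i - 1)) • (B.flip (tmulΩ a α) ∘ₗ B.flip z) +
      (-1 : k) ^ ((v - 1) * (t - 1)) • B (B z (tmulΩ a α))) (z := y) (m := t)
  simp only [LinearMap.smul_apply, LinearMap.add_apply, LinearMap.comp_apply,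
    LinearMap.flip_apply] at h2
  refine h2 ?_ hy
  rintro q j rfl b hb β hβ
  have h3 := zero_of_deg ((-1 : k) ^ ((p + i - 1) * (v - 1)) • B (B (tmulΩ a α) (tmulΩ b β)) +
      (-1 : k) ^ ((q + j - 1) * (p + i - 1)) • (B.flip (tmulΩ a α) ∘ₗ B (tmulΩ b β)) +
      (-1 : k) ^ ((v - 1) * (q + j - 1)) • (B.flip (tmulΩ b β) ∘ₗ B.flip (tmulΩ a α)))
      (z := z) (m := v)
  simp only [LinearMap.smul_apply, LinearMap.add_apply, LinearMap.comp_apply,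
    LinearMap.flip_apply] at h3
  refine h3 ?_ hz
  rintro r l rfl c hc γ hγ
  subst hB
  rw [TensorOmega.bracket_tmul a hα hb, TensorOmega.bracket_tmul b hβ hc,
    TensorOmega.bracket_tmul c hγ ha]
  simp only [map_smul, LinearMap.smul_apply]
  rw [TensorOmega.bracket_tmul _ (SetLike.GradedMul.mul_mem hα hβ) hc,
    TensorOmega.bracket_tmul _ (SetLike.GradedMul.mul_mem hβ hγ) ha,
    TensorOmega.bracket_tmul _ (SetLike.GradedMul.mul_mem hγ hα) hb,
    omega_mul_comm (SetLike.GradedMul.mul_mem hβ hγ) hα,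
    mul_assoc γ, omega_mul_comm hγ (SetLike.GradedMul.mul_mem hα hβ), ← mul_assoc]
  simp only [tmulΩ_smul, smul_smul, sign_mul]
  have key := congrArg (fun w => (-1 : k) ^ (i * (q - 1) + (i + j) * (r - 1) + (p - 1) * l +
    i * (r + l - 1)) • tmulΩ w (α * β * γ)) (A.jacobi ha hb hc)
  simp only [smul_tmulΩ, add_tmulΩ, smul_add, smul_smul, sign_mul, zero_tmulΩ, smul_zero] at key
  rw [← key]
  congr 2
  · congr 1
    apply sign_congr
    simp only [Int.even_add, Int.even_sub, Int.even_mul, Int.not_even_one]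
    grind
  · congr 1
    apply sign_congr
    simp only [Int.even_add, Int.even_sub, Int.even_mul, Int.not_even_one]
    grind
  · apply sign_congr
    simp only [Int.even_add, Int.even_sub, Int.even_mul, Int.not_even_one]
    grind

end TensorAxioms

section TensorFunctor

variable {k : Type u} [Field k]

/-- The differential `P₀`-algebra `A ⊗ Ω(Δⁿ)`. -/
abbrev tensorObj (A : DGP0Alg k) (n : ℕ) : DGP0Alg k where
  carrier := TensorOmega A n
  deg := TensorOmega.deg A n
  mul_comm' := tensor_mul_comm
  bracket := TensorOmega.bracket A n
  bracket_mem := tensor_bracket_mem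
  bracket_symm := tensor_bracket_symm
  bracket_mul := tensor_bracket_mul
  jacobi := tensor_jacobi
  d := TensorOmega.d A n
  d_mem := tensor_d_mem
  d_d := tensor_d_d
  d_mul := tensor_d_mul
  d_bracket := tensor_d_bracket

/-- A linear map out of `A ⊗ Ω(Δⁿ)` is a morphism of differential `P₀`-algebras if it is so on
homogeneous tensors. -/
def homOfTensor {A C : DGP0Alg k} {n : ℕ} (L : TensorOmega A n →ₗ[k] C.carrier)
    (h_one : L 1 = 1)
    (h_deg : ∀ p q, ∀ a ∈ A.deg p, ∀ ω ∈ omegaDeg k n q, L (tmulΩ a ω) ∈ C.deg (p + q))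
    (h_mul : ∀ p q, ∀ a ∈ A.deg p, ∀ ω ∈ omegaDeg k n q, ∀ p' q', ∀ b ∈ A.deg p',
      ∀ η ∈ omegaDeg k n q', L (tmulΩ a ω * tmulΩ b η) = L (tmulΩ a ω) * L (tmulΩ b η))
    (h_bracket : ∀ p q, ∀ a ∈ A.deg p, ∀ ω ∈ omegaDeg k n q, ∀ p' q', ∀ b ∈ A.deg p',
      ∀ η ∈ omegaDeg k n q', L (TensorOmega.bracket A n (tmulΩ a ω) (tmulΩ b η)) =
        C.bracket (L (tmulΩ a ω)) (L (tmulΩ b η)))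
    (h_d : ∀ p q, ∀ a ∈ A.deg p, ∀ ω ∈ omegaDeg k n q,
      L (TensorOmega.d A n (tmulΩ a ω)) = C.d (L (tmulΩ a ω))) :
    tensorObj A n ⟶ C where
  toAlgHom := AlgHom.ofLinearMap L h_one (by
    intro x y
    have : (LinearMap.mul k (TensorOmega A n)).compr₂ L =
        (LinearMap.mul k C.carrier).compl₁₂ L L := by
      refine TensorOmega.hom_ext fun p q a ha ω hω => TensorOmega.hom_ext fun p' q' b hb η hη => ?_
      exact h_mul p q a ha ω hω p' q' b hb η hη
    exact congrArg (fun φ => φ x y) this)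
  map_deg := by
    intro m x hx
    refine TensorOmega.mem_of_deg L _ ?_ hx
    rintro p q rfl a ha ω hω
    exact h_deg p q a ha ω hω
  map_bracket := by
    intro x y
    have : (TensorOmega.bracket A n).compr₂ L = C.bracket.compl₁₂ L L := by
      refine TensorOmega.hom_ext fun p q a ha ω hω => TensorOmega.hom_ext fun p' q' b hb η hη => ?_
      exact h_bracket p q a ha ω hω p' q' b hb η hη
    exact congrArg (fun φ => φ x y) this
  map_d := by
    intro x
    have : L ∘ₗ TensorOmega.d A n = C.d ∘ₗ L :=
      TensorOmega.hom_ext fun p q a ha ω hω => h_d p q a ha ω hω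
    exact congrArg (fun φ => φ x) this

theorem tensorObj_hom_ext {A C : DGP0Alg k} {n : ℕ} {f g : tensorObj A n ⟶ C}
    (h : ∀ (a : A.carrier) (ω : Omega k n), f.toAlgHom (tmulΩ a ω) = g.toAlgHom (tmulΩ a ω)) :
    f = g := by
  refine DGP0Alg.hom_ext fun x => ?_
  have : (f.toAlgHom.toLinearMap : TensorOmega A n →ₗ[k] C.carrier) = g.toAlgHom.toLinearMap :=
    TensorOmega.hom_ext fun p q a _ ω _ => h a ω
  exact congrArg (fun φ => φ x) this

/-- The linear map `f ⊗ θ^*`. -/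
def tensorMapLin {A B : DGP0Alg k} (f : A ⟶ B) {m n : ℕ} (θ : Fin (m + 1) → Fin (n + 1)) :
    TensorOmega A n →ₗ[k] TensorOmega B m :=
  (TensorOmega.of B m).toLinearMap ∘ₗ
    TensorProduct.map f.toAlgHom.toLinearMap (omegaPullback k θ).toLinearMap ∘ₗ
    (TensorOmega.of A n).symm.toLinearMap

theorem tensorMapLin_tmul {A B : DGP0Alg k} (f : A ⟶ B) {m n : ℕ}
    (θ : Fin (m + 1) → Fin (n + 1)) (a : A.carrier) (ω : Omega k n) :
    tensorMapLin f θ (tmulΩ a ω) = tmulΩ (f.toAlgHom a) (omegaPullback k θ ω) := by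
  simp [tensorMapLin]

/-- The morphism `f ⊗ θ^* : A ⊗ Ω(Δⁿ) ⟶ B ⊗ Ω(Δᵐ)`. -/
def tensorMap {A B : DGP0Alg k} (f : A ⟶ B) {m n : ℕ} (θ : Fin (m + 1) → Fin (n + 1)) :
    tensorObj A n ⟶ tensorObj B m :=
  homOfTensor (C := tensorObj B m) (tensorMapLin f θ)
    (by
      have := tensorMapLin_tmul f θ 1 1
      rw [map_one, map_one] at this
      exact this)
    (by
      intro p q a ha ω hω
      rw [tensorMapLin_tmul]
      exact tmulΩ_mem (f.map_deg ha) (omegaPullback_mem θ hω) rfl)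
    (by
      intro p q a ha ω hω p' q' b hb η hη
      rw [tmulΩ_mul a hω hb, map_smul]
      simp only [tensorMapLin_tmul]
      rw [map_mul, map_mul]
      exact (tmulΩ_mul _ (omegaPullback_mem θ hω) (f.map_deg hb) _).symm)
    (by
      intro p q a ha ω hω p' q' b hb η hη
      rw [TensorOmega.bracket_tmul a hω hb, map_smul]
      simp only [tensorMapLin_tmul]
      rw [f.map_bracket, map_mul]
      exact (TensorOmega.bracket_tmul _ (omegaPullback_mem θ hω) (f.map_deg hb) _).symm)
    (by
      intro p q a ha ω hω
      rw [TensorOmega.d_tmul ha, map_add, map_smul]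
      simp only [tensorMapLin_tmul]
      rw [f.map_d, omegaPullback_d]
      exact (TensorOmega.d_tmul (f.map_deg ha) _).symm)

theorem tensorMap_tmul {A B : DGP0Alg k} (f : A ⟶ B) {m n : ℕ}
    (θ : Fin (m + 1) → Fin (n + 1)) (a : A.carrier) (ω : Omega k n) :
    (tensorMap f θ).toAlgHom (tmulΩ a ω) = tmulΩ (f.toAlgHom a) (omegaPullback k θ ω) :=
  tensorMapLin_tmul f θ a ω

theorem tensorMap_id (A : DGP0Alg k) (n : ℕ) :
    tensorMap (𝟙 A) (id : Fin (n + 1) → Fin (n + 1)) = 𝟙 _ := by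
  refine tensorObj_hom_ext fun a ω => ?_
  rw [tensorMap_tmul, omegaPullback_id]
  rfl

theorem tensorMap_comp {A B C : DGP0Alg k} (f : A ⟶ B) (g : B ⟶ C) {l m n : ℕ}
    (θ : Fin (m + 1) → Fin (n + 1)) (ψ : Fin (l + 1) → Fin (m + 1)) :
    tensorMap (f ≫ g) (θ ∘ ψ) = tensorMap f θ ≫ tensorMap g ψ := by
  refine tensorObj_hom_ext fun a ω => ?_
  rw [tensorMap_tmul, omegaPullback_comp, DGP0Alg.comp_toAlgHom, AlgHom.comp_apply]
  refine Eq.trans ?_ (congrArg (tensorMap g ψ).toAlgHom (tensorMap_tmul f θ a ω)).symm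
  exact (tensorMap_tmul g ψ _ _).symm

variable (k) in
/-- The functor `A ↦ A ⊗ Ω(Δⁿ)`. -/
def tensorFunctor (n : ℕ) : DGP0Alg k ⥤ DGP0Alg k where
  obj A := tensorObj A n
  map f := tensorMap f id
  map_id A := tensorMap_id A n
  map_comp f g := tensorMap_comp f g id id

variable (k) in
/-- The natural transformation `A ⊗ Ω(Δⁿ) ⟶ A ⊗ Ω(Δᵐ)` induced by a map of simplices. -/
def tensorPullback {m n : ℕ} (θ : Fin (m + 1) → Fin (n + 1)) :
    tensorFunctor k n ⟶ tensorFunctor k m where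
  app A := tensorMap (𝟙 A) θ
  naturality A B f := by
    change tensorMap f id ≫ tensorMap (𝟙 B) θ = tensorMap (𝟙 A) θ ≫ tensorMap f id
    rw [← tensorMap_comp, ← tensorMap_comp]
    simp

theorem bracket_one (A : DGP0Alg k) (x : A.carrier) : A.bracket 1 x = 0 := by
  suffices A.bracket 1 = 0 by rw [this]; rfl
  refine DirectSum.decompose_lhom_ext A.deg fun p => ?_
  ext ⟨c, hc⟩
  have h1 : (1 : A.carrier) ∈ A.deg 0 := SetLike.GradedOne.one_mem (A := A.deg)
  have := A.bracket_mul h1 h1 hc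
  simpa using this

theorem d_one (A : DGP0Alg k) : A.d 1 = 0 := by
  have h1 : (1 : A.carrier) ∈ A.deg 0 := SetLike.GradedOne.one_mem (A := A.deg)
  have := A.d_mul h1 h1
  simpa using this

/-- The element `1 ⊗ ω`. -/
abbrev oneΩ (A : DGP0Alg k) {n : ℕ} (ω : Omega k n) : (tensorObj A n).carrier :=
  tmulΩ (A := A) 1 ω

theorem oneΩ_mem (A : DGP0Alg k) {n : ℕ} {q : ℤ} {ω : Omega k n} (hω : ω ∈ omegaDeg k n q) :
    oneΩ A ω ∈ (tensorObj A n).deg q :=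
  tmulΩ_mem (SetLike.GradedOne.one_mem (A := A.deg)) hω (zero_add q)

theorem oneΩ_mul (A : DGP0Alg k) {n : ℕ} {q : ℤ} {ω : Omega k n} (hω : ω ∈ omegaDeg k n q)
    (η : Omega k n) : oneΩ A ω * oneΩ A η = oneΩ A (ω * η) := by
  have := tmulΩ_mul (A := A) 1 hω (SetLike.GradedOne.one_mem (A := A.deg)) η
  rw [mul_zero, zpow_zero, one_smul, one_mul] at this
  exact this

theorem bracket_oneΩ (A : DGP0Alg k) {n : ℕ} {q : ℤ} {ω : Omega k n} (hω : ω ∈ omegaDeg k n q)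
    (x : (tensorObj A n).carrier) : (tensorObj A n).bracket (oneΩ A ω) x = 0 := by
  suffices TensorOmega.bracket A n (tmulΩ 1 ω) = 0 from congrArg (fun φ => φ x) this
  refine TensorOmega.hom_ext fun p i a ha α hα => ?_
  rw [TensorOmega.bracket_tmul 1 hω ha, bracket_one, zero_tmulΩ, smul_zero]
  rfl

theorem d_oneΩ (A : DGP0Alg k) {n : ℕ} (ω : Omega k n) :
    (tensorObj A n).d (oneΩ A ω) = oneΩ A (omegaD n ω) := by
  have := TensorOmega.d_tmul (SetLike.GradedOne.one_mem (A := A.deg)) ω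
  rw [d_one, zero_tmulΩ, zero_add, zpow_zero, one_smul] at this
  exact this

/-- The linear map `b ⊗ ω ↦ g b · (1 ⊗ ω)`. -/
def extendLin {B C : DGP0Alg k} {n : ℕ} (g : B ⟶ tensorObj C n) :
    TensorOmega B n →ₗ[k] (tensorObj C n).carrier :=
  TensorProduct.lift ((LinearMap.mul k (tensorObj C n).carrier).compl₁₂ g.toAlgHom.toLinearMap
    ((TensorOmega.of C n).toLinearMap ∘ₗ TensorProduct.mk k C.carrier (Omega k n) 1)) ∘ₗ
    (TensorOmega.of B n).symm.toLinearMap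

theorem extendLin_tmul {B C : DGP0Alg k} {n : ℕ} (g : B ⟶ tensorObj C n) (b : B.carrier)
    (ω : Omega k n) : extendLin g (tmulΩ b ω) = g.toAlgHom b * oneΩ C ω := by
  simp [extendLin]

/-- The bracket of two products with central factors. -/
theorem bracket_central (T : DGP0Alg k) {p q i j : ℤ} {a b u v : T.carrier} (ha : a ∈ T.deg p)
    (hb : b ∈ T.deg q) (hu : u ∈ T.deg i) (hv : v ∈ T.deg j) (hu' : ∀ x, T.bracket u x = 0)
    (hv' : ∀ x, T.bracket v x = 0) :
    T.bracket (a * u) (b * v) = (-1 : k) ^ (i * (q - 1)) • (T.bracket a b * (u * v)) := by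
  have hbv : b * v ∈ T.deg (q + j) := SetLike.GradedMul.mul_mem hb hv
  have h1 : T.bracket (b * v) a = (-1 : k) ^ (q * j) • (v * T.bracket b a) := by
    rw [T.bracket_mul hb hv ha, hv', mul_zero, zero_add]
  rw [T.bracket_mul ha hu hbv, hu', mul_zero, zero_add, T.bracket_symm ha hbv, h1,
    T.bracket_symm hb ha, T.mul_comm' (T.bracket_mem ha hb) (SetLike.GradedMul.mul_mem hu hv)]
  simp only [mul_neg, smul_neg, neg_neg, mul_smul_comm, smul_smul, sign_mul, mul_assoc]
  congr 1
  apply sign_congr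
  simp only [Int.even_add, Int.even_sub, Int.even_mul, Int.not_even_one]
  grind

theorem extendLin_mul {B C : DGP0Alg k} {n : ℕ} (g : B ⟶ tensorObj C n) {p' q : ℤ}
    {a b : B.carrier} {ω : Omega k n} (hω : ω ∈ omegaDeg k n q) (hb : b ∈ B.deg p')
    (η : Omega k n) :
    extendLin g (tmulΩ a ω * tmulΩ b η) = extendLin g (tmulΩ a ω) * extendLin g (tmulΩ b η) := by
  rw [tmulΩ_mul a hω hb, map_smul, extendLin_tmul, extendLin_tmul, extendLin_tmul,
    map_mul, ← oneΩ_mul C hω, mul_assoc, ← mul_assoc (g.toAlgHom b),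
    (tensorObj C n).mul_comm' (g.map_deg hb) (oneΩ_mem C hω), smul_mul_assoc, mul_smul_comm,
    smul_smul, sign_mul, mul_assoc, mul_assoc]
  have : (-1 : k) ^ (q * p' + p' * q) = 1 := by
    rw [sign_congr (b := 0) (by simp [mul_comm q])]; simp
  rw [this, one_smul]

theorem extendLin_bracket {B C : DGP0Alg k} {n : ℕ} (g : B ⟶ tensorObj C n) {p p' q q' : ℤ}
    {a b : B.carrier} {ω η : Omega k n} (ha : a ∈ B.deg p) (hω : ω ∈ omegaDeg k n q)
    (hb : b ∈ B.deg p') (hη : η ∈ omegaDeg k n q') :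
    extendLin g (TensorOmega.bracket B n (tmulΩ a ω) (tmulΩ b η)) =
      (tensorObj C n).bracket (extendLin g (tmulΩ a ω)) (extendLin g (tmulΩ b η)) := by
  rw [TensorOmega.bracket_tmul a hω hb, map_smul, extendLin_tmul, extendLin_tmul, extendLin_tmul,
    g.map_bracket, ← oneΩ_mul C hω,
    bracket_central (tensorObj C n) (g.map_deg ha) (g.map_deg hb) (oneΩ_mem C hω)
      (oneΩ_mem C hη) (bracket_oneΩ C hω) (bracket_oneΩ C hη)]

theorem extendLin_d {B C : DGP0Alg k} {n : ℕ} (g : B ⟶ tensorObj C n) {p q : ℤ}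
    {a : B.carrier} {ω : Omega k n} (ha : a ∈ B.deg p) (hω : ω ∈ omegaDeg k n q) :
    extendLin g (TensorOmega.d B n (tmulΩ a ω)) =
      (tensorObj C n).d (extendLin g (tmulΩ a ω)) := by
  rw [TensorOmega.d_tmul ha, map_add, map_smul, extendLin_tmul, extendLin_tmul, extendLin_tmul]
  refine Eq.trans ?_ ((tensorObj C n).d_mul (g.map_deg ha)
    (oneΩ_mem C hω)).symm
  rw [g.map_d, d_oneΩ]

/-- The `Ω(Δⁿ)`-linear extension `B ⊗ Ω(Δⁿ) ⟶ C ⊗ Ω(Δⁿ)` of `g : B ⟶ C ⊗ Ω(Δⁿ)`. -/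
def extend {B C : DGP0Alg k} {n : ℕ} (g : B ⟶ tensorObj C n) : tensorObj B n ⟶ tensorObj C n :=
  homOfTensor (C := tensorObj C n) (extendLin g)
    (by
      have := extendLin_tmul g 1 1
      rw [map_one, one_mul] at this
      exact this)
    (by
      intro p q a ha ω hω
      rw [extendLin_tmul]
      exact SetLike.GradedMul.mul_mem (g.map_deg ha) (oneΩ_mem C hω))
    (fun _ _ _ _ _ hω _ _ _ hb _ _ => extendLin_mul g hω hb _)
    (fun _ _ _ ha _ hω _ _ _ hb _ hη => extendLin_bracket g ha hω hb hη)
    (fun _ _ _ ha _ hω => extendLin_d g ha hω)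

theorem extend_tmul {B C : DGP0Alg k} {n : ℕ} (g : B ⟶ tensorObj C n) (b : B.carrier)
    (ω : Omega k n) : (extend g).toAlgHom (tmulΩ b ω) = g.toAlgHom b * oneΩ C ω :=
  extendLin_tmul g b ω

theorem extend_naturality {B C B' C' : DGP0Alg k} {n : ℕ} (g : B ⟶ tensorObj C n)
    (g' : B' ⟶ tensorObj C' n) (β : B ⟶ B') (γ : C ⟶ C')
    (h : β ≫ g' = g ≫ (tensorFunctor k n).map γ) :
    (tensorFunctor k n).map β ≫ extend g' = extend g ≫ (tensorFunctor k n).map γ := by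
  refine tensorObj_hom_ext fun b ω => ?_
  have hb := congrArg (fun φ : B ⟶ tensorObj C' n => φ.toAlgHom b) h
  simp only [DGP0Alg.comp_toAlgHom, AlgHom.comp_apply] at hb ⊢
  have h1 : ((tensorFunctor k n).map β).toAlgHom (tmulΩ b ω) = tmulΩ (β.toAlgHom b) ω := by
    have := tensorMap_tmul β id b ω
    rw [omegaPullback_id] at this
    exact this
  have h2 : ((tensorFunctor k n).map γ).toAlgHom (oneΩ C ω) = oneΩ C' ω := by
    have := tensorMap_tmul γ id 1 ω
    rw [omegaPullback_id, map_one] at this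
    exact this
  have e1 : ((tensorFunctor k n).map β ≫ extend g').toAlgHom (tmulΩ b ω) =
      g'.toAlgHom (β.toAlgHom b) * oneΩ C' ω :=
    (congrArg (extend g').toAlgHom h1).trans (extend_tmul g' _ _)
  have e2 : (extend g ≫ (tensorFunctor k n).map γ).toAlgHom (tmulΩ b ω) =
      (tensorMap γ id).toAlgHom (g.toAlgHom b) * (tensorMap γ id).toAlgHom (oneΩ C ω) :=
    (congrArg (tensorMap γ id).toAlgHom (extend_tmul g b ω)).trans (map_mul _ _ _)
  exact e1.trans ((congrArg₂ (fun x y : (tensorObj C' n).carrier => x * y) hb h2.symm).trans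
    e2.symm)

end TensorFunctor

section MappingSpace

variable {k : Type u} [Field k] {C : Type u} [SmallCategory C]

/-- The simplicial set of morphisms between two presheaves of differential `P₀`-algebras; its
`m`-simplices are the morphisms `F ⟶ G ⊗ Ω(Δᵐ)`. -/
def mappingSpace (F G : Cᵒᵖ ⥤ DGP0Alg k) : SSet.{u} where
  obj Δ := F ⟶ G ⋙ tensorFunctor k Δ.unop.len
  map φ := ↾fun f => f ≫ Functor.whiskerLeft G (tensorPullback k φ.unop.toOrderHom)
  map_id Δ := by
    ext (f : F ⟶ G ⋙ tensorFunctor k Δ.unop.len) : 3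
    refine NatTrans.ext (funext fun c => ?_)
    change f.app c ≫ tensorMap (𝟙 (G.obj c)) id = f.app c
    rw [tensorMap_id]
    exact Category.comp_id (f.app c)
  map_comp {Δ Δ' Δ''} φ ψ := by
    ext (f : F ⟶ G ⋙ tensorFunctor k Δ.unop.len) : 3
    refine NatTrans.ext (funext fun c => ?_)
    change f.app c ≫ tensorMap (𝟙 (G.obj c)) (φ.unop.toOrderHom ∘ ψ.unop.toOrderHom) =
      (f.app c ≫ tensorMap (𝟙 (G.obj c)) φ.unop.toOrderHom) ≫
        tensorMap (𝟙 (G.obj c)) ψ.unop.toOrderHom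
    refine Eq.trans ?_ (Category.assoc _ _ _).symm
    refine congrArg (fun x => f.app c ≫ x) ?_
    refine Eq.trans ?_ (tensorMap_comp (𝟙 (G.obj c)) (𝟙 (G.obj c)) _ _)
    rw [Category.comp_id]

/-- The composite `F ⟶ G ⊗ Ω(Δᵐ) ⟶ H ⊗ Ω(Δᵐ)`, where the second morphism is the
`Ω(Δᵐ)`-linear extension of `g : G ⟶ H ⊗ Ω(Δᵐ)`. -/
def composeHom {F G H : Cᵒᵖ ⥤ DGP0Alg k} {m : ℕ} (f : F ⟶ G ⋙ tensorFunctor k m)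
    (g : G ⟶ H ⋙ tensorFunctor k m) : F ⟶ H ⋙ tensorFunctor k m where
  app c := f.app c ≫ extend (C := H.obj c) (g.app c)
  naturality c c' φ := by
    have h := extend_naturality (C := H.obj c) (C' := H.obj c') (g.app c) (g.app c') (G.map φ)
      (H.map φ) (g.naturality φ)
    have h1 := congrArg (fun x => x ≫ extend (C := H.obj c') (g.app c')) (f.naturality φ)
    have h2 := congrArg (fun x => f.app c ≫ x) h
    exact (Category.assoc _ _ _).symm.trans (h1.trans ((Category.assoc _ _ _).trans
      (h2.trans (Category.assoc _ _ _).symm)))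

/-- The composition of `m`-simplices of mapping spaces. -/
def compose {F G H : Cᵒᵖ ⥤ DGP0Alg k} {Δ : SimplexCategoryᵒᵖ} (f : (mappingSpace F G).obj Δ)
    (g : (mappingSpace G H).obj Δ) : (mappingSpace F H).obj Δ :=
  composeHom (m := Δ.unop.len) f g

end MappingSpace

section Sheaves

variable {k : Type u} [Field k] {X : TopCat.{u}}

/-- The poset of open subsets of `X` contained in `U`. -/
abbrev OpensIn (U : Opens X) : Type u := {V : Opens X // V ≤ U}

/-- For `W ≤ U`, an open subset of `X` contained in `W`, seen as an open subset of the
space `U`. -/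
def OpensIn.toOpens {U : Opens X} (W : Opens X) :
    OpensIn W ⥤ Opens ((Opens.toTopCat X).obj U) where
  obj V := (Opens.map U.inclusion').obj V.1
  map f := (Opens.map U.inclusion').map (homOfLE (leOfHom f))

/-- The inclusion of the poset of open subsets contained in `W' ≤ W`. -/
def OpensIn.incl {W W' : Opens X} (h : W' ≤ W) : OpensIn W' ⥤ OpensIn W :=
  Monotone.functor (f := fun V => ⟨V.1, V.2.trans h⟩) fun _ _ hV => hV

/-- The restriction to `W ≤ U` of a sheaf on the subspace `U` of `X`, given by its sections over the
open subsets of `X` contained in `W`. -/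
def sections {U : Opens X} (A : TopCat.Sheaf (DGP0Alg k) ((Opens.toTopCat X).obj U))
    (W : Opens X) : (OpensIn W)ᵒᵖ ⥤ DGP0Alg k :=
  (OpensIn.toOpens W).op ⋙ A.presheaf

/-- The restriction of a simplex of a mapping space from `W` to `W' ≤ W`. -/
def restrictSimplex {U U' : Opens X} {A : TopCat.Sheaf (DGP0Alg k) ((Opens.toTopCat X).obj U)}
    {B : TopCat.Sheaf (DGP0Alg k) ((Opens.toTopCat X).obj U')} {W W' : Opens X} (h : W' ≤ W)
    {Δ : SimplexCategoryᵒᵖ} (f : (mappingSpace (sections A W) (sections B W)).obj Δ) :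
    (mappingSpace (sections A W') (sections B W')).obj Δ :=
  Functor.whiskerLeft (OpensIn.incl h).op
    (f : sections A W ⟶ sections B W ⋙ tensorFunctor k Δ.unop.len)

/-- The differential `Aᵖ ⟶ Aᵖ⁺¹`. -/
def degD (A : DGP0Alg k) (p : ℤ) :
    ModuleCat.of k (A.deg p) ⟶ ModuleCat.of k (A.deg (p + 1)) :=
  ModuleCat.ofHom (A.d.restrict fun _ h => A.d_mem h)

theorem degD_comp (A : DGP0Alg k) (p : ℤ) : degD A p ≫ degD A (p + 1) = 0 := by
  refine ModuleCat.hom_ext (LinearMap.ext fun a => ?_)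
  exact Subtype.ext (A.d_d a.1)

/-- The component `Aᵖ ⟶ Bᵖ` of a morphism. -/
def degMap {A B : DGP0Alg k} (f : A ⟶ B) (p : ℤ) :
    ModuleCat.of k (A.deg p) ⟶ ModuleCat.of k (B.deg p) :=
  ModuleCat.ofHom (f.toAlgHom.toLinearMap.restrict fun _ h => f.map_deg h)

theorem degMap_comp_degD {A B : DGP0Alg k} (f : A ⟶ B) (p : ℤ) :
    degMap f p ≫ degD B p = degD A p ≫ degMap f (p + 1) := by
  refine ModuleCat.hom_ext (LinearMap.ext fun a => ?_)
  exact Subtype.ext (f.map_d a.1).symm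

/-- The underlying cochain complex of a differential `P₀`-algebra. -/
def complexFunctor (k : Type u) [Field k] : DGP0Alg k ⥤ CochainComplex (ModuleCat.{u} k) ℤ where
  obj A := CochainComplex.of (fun p => ModuleCat.of k (A.deg p)) (degD A) (degD_comp A)
  map {A B} f := CochainComplex.ofHom (degMap f) (fun p => by
    have hA := CochainComplex.of_d _ (degD A) p
    have hB := CochainComplex.of_d _ (degD B) p
    exact ((congrArg (fun x => degMap f p ≫ x) hB).trans (degMap_comp_degD f p)).trans
      (congrArg (fun x => x ≫ degMap f (p + 1)) hA).symm)
  map_id A := rfl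
  map_comp f g := rfl

/-- The cohomology of degree `p` of a differential `P₀`-algebra. -/
def cohomology (k : Type u) [Field k] (p : ℤ) : DGP0Alg k ⥤ ModuleCat.{u} k :=
  complexFunctor k ⋙ HomologicalComplex.homologyFunctor _ _ p

variable {Y : TopCat.{u}}

/-- A morphism of presheaves of differential `P₀`-algebras is a quasi-isomorphism if it induces
isomorphisms on the stalks of the cohomology presheaves, that is, on the cohomology sheaves. -/
def IsQuasiIso {F G : TopCat.Presheaf (DGP0Alg k) Y} (φ : F ⟶ G) : Prop :=
  ∀ (p : ℤ) (y : Y), IsIso ((TopCat.Presheaf.stalkFunctor (ModuleCat.{u} k) y).map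
    (Functor.whiskerRight φ (cohomology k p)))

/-- Two sheaves of differential `P₀`-algebras are quasi-isomorphic if they are connected by a
zigzag of quasi-isomorphisms. -/
def QuasiIsomorphic (A B : TopCat.Sheaf (DGP0Alg k) Y) : Prop :=
  Relation.EqvGen (fun A B : TopCat.Sheaf (DGP0Alg k) Y =>
    ∃ φ : A.presheaf ⟶ B.presheaf, IsQuasiIso φ) A B

/-- The restriction of a sheaf to an open subset. -/
def restrictSheaf (A : TopCat.Sheaf (DGP0Alg k) X) (U : Opens X) :
    TopCat.Sheaf (DGP0Alg k) ((Opens.toTopCat X).obj U) :=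
  ⟨U.isOpenEmbedding.functor.op ⋙ A.presheaf,
    TopCat.Presheaf.isSheaf_of_isOpenEmbedding U.isOpenEmbedding A.2⟩

/-- An open subset of the subspace `W`, seen as an open subset of `X` contained in `W`. -/
def OpensIn.ofOpens (W : Opens X) : Opens ((Opens.toTopCat X).obj W) ⥤ OpensIn W :=
  Monotone.functor
    (f := fun V => ⟨W.isOpenEmbedding.functor.obj V, by rintro _ ⟨x, -, rfl⟩; exact x.2⟩)
    fun _ _ h => leOfHom (W.isOpenEmbedding.functor.map (homOfLE h))

/-- The presheaf on the subspace `W` given by the sections over the open subsets of `W`. -/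
abbrev sectionsPresheaf {U : Opens X} (A : TopCat.Sheaf (DGP0Alg k) ((Opens.toTopCat X).obj U))
    (W : Opens X) : TopCat.Presheaf (DGP0Alg k) ((Opens.toTopCat X).obj W) :=
  (OpensIn.ofOpens W).op ⋙ sections A W

end Sheaves

section Gluing

variable {n : ℕ}

/-- `I` has at least two elements, its smallest element is `a` and its largest element is `b`. -/
structure IsEnds (I : Finset (Fin (n + 1))) (a b : Fin (n + 1)) : Prop where
  isLeast : IsLeast (I : Set (Fin (n + 1))) a
  isGreatest : IsGreatest (I : Set (Fin (n + 1))) b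
  lt : a < b

/-- The poset of subsets of `I` which contain `a` and `b`. -/
abbrev CubePoset (I : Finset (Fin (n + 1))) (a b : Fin (n + 1)) : Type u :=
  ULift.{u} {K : Finset (Fin (n + 1)) // K ⊆ I ∧ a ∈ K ∧ b ∈ K}

variable {I : Finset (Fin (n + 1))} {a b : Fin (n + 1)} (i : Fin (n + 1))

theorem IsEnds.lower (h : IsEnds I a b) {i : Fin (n + 1)} (hi : i ∈ I) (hai : a < i) :
    IsEnds (I.filter (· ≤ i)) a i where
  isLeast := ⟨by simpa using ⟨h.isLeast.1, hai.le⟩, fun j hj => h.isLeast.2 (by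
    simp only [Finset.coe_filter, Set.mem_ofPred_eq] at hj
    exact hj.1)⟩
  isGreatest := ⟨by simpa using hi, fun j hj => by
    simp only [Finset.coe_filter, Set.mem_ofPred_eq] at hj
    exact hj.2⟩
  lt := hai

theorem IsEnds.upper (h : IsEnds I a b) {i : Fin (n + 1)} (hi : i ∈ I) (hib : i < b) :
    IsEnds (I.filter (i ≤ ·)) i b where
  isLeast := ⟨by simpa using hi, fun j hj => by
    simp only [Finset.coe_filter, Set.mem_ofPred_eq] at hj
    exact hj.2⟩
  isGreatest := ⟨by simpa using ⟨h.isGreatest.1, hib.le⟩, fun j hj => h.isGreatest.2 (by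
    simp only [Finset.coe_filter, Set.mem_ofPred_eq] at hj
    exact hj.1)⟩
  lt := hib

theorem IsEnds.erase (h : IsEnds I a b) {i : Fin (n + 1)} (hai : a < i) (hib : i < b) :
    IsEnds (I.erase i) a b where
  isLeast := ⟨by simpa using ⟨h.isLeast.1, hai.ne⟩, fun _ hj =>
    h.isLeast.2 (Finset.mem_of_mem_erase hj)⟩
  isGreatest := ⟨by simpa using ⟨h.isGreatest.1, hib.ne'⟩, fun _ hj =>
    h.isGreatest.2 (Finset.mem_of_mem_erase hj)⟩
  lt := h.lt

/-- The map `(K, L) ↦ K ∪ L`. -/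
def CubePoset.union : CubePoset.{u} (I.filter (· ≤ i)) a i × CubePoset.{u} (I.filter (i ≤ ·)) i b →o
    CubePoset.{u} I a b where
  toFun x := ⟨x.1.down.1 ∪ x.2.down.1,
    Finset.union_subset (x.1.down.2.1.trans (Finset.filter_subset _ _))
      (x.2.down.2.1.trans (Finset.filter_subset _ _)),
    Finset.mem_union_left _ x.1.down.2.2.1, Finset.mem_union_right _ x.2.down.2.2.2⟩
  monotone' _ _ h := Finset.union_subset_union h.1 h.2

/-- The inclusion of the poset of subsets which do not contain `i`. -/
def CubePoset.incl : CubePoset.{u} (I.erase i) a b →o CubePoset.{u} I a b where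
  toFun K := ⟨K.down.1, K.down.2.1.trans (Finset.erase_subset _ _), K.down.2.2⟩
  monotone' _ _ h := h

/-- The map on `m`-simplices of nerves induced by `(K, L) ↦ K ∪ L`. -/
def unionSimplex {m : ℕ} (σ : ComposableArrows (CubePoset.{u} (I.filter (· ≤ i)) a i) m)
    (τ : ComposableArrows (CubePoset.{u} (I.filter (i ≤ ·)) i b) m) :
    ComposableArrows (CubePoset.{u} I a b) m :=
  ((CubePoset.union i).monotone.comp (σ.monotone.prodMk τ.monotone)).functor

/-- The map on `m`-simplices of nerves induced by the inclusion of the subsets which do not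
contain `i`. -/
def inclSimplex {m : ℕ} (σ : ComposableArrows (CubePoset.{u} (I.erase i) a b) m) :
    ComposableArrows (CubePoset.{u} I a b) m :=
  ((CubePoset.incl i).monotone.comp σ.monotone).functor

/-- Gluing data on the open sets `U 0, …, U n`: a sheaf `A i` of differential `P₀`-algebras on
each `U i`, and for each set of indices `I` with at least two elements, with smallest element `a`
and largest element `b`, a map from the nerve of the cube of subsets of `I` containing `a` and `b`
to the mapping space from `A a` to `A b` over the intersection `I.inf U` of the `U i`, `i ∈ I`. -/
structure GluingData (k : Type u) [Field k] {X : TopCat.{u}} (U : Fin (n + 1) → Opens X) where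
  A : ∀ i, TopCat.Sheaf (DGP0Alg k) ((Opens.toTopCat X).obj (U i))
  K : ∀ {I : Finset (Fin (n + 1))} {a b : Fin (n + 1)}, IsEnds I a b →
    (nerve (CubePoset.{u} I a b) ⟶
      mappingSpace (sections (A a) (I.inf U)) (sections (A b) (I.inf U)))
  /-- For `I` with two elements the nerve is a point, and the corresponding morphism
  `A a ⟶ A b ⊗ Ω(Δ⁰) = A b` is a quasi-isomorphism. -/
  quasiIso : ∀ {I : Finset (Fin (n + 1))} {a b : Fin (n + 1)} (h : IsEnds I a b), I.card = 2 →
    ∀ σ : (nerve (CubePoset.{u} I a b)).obj (op ⦋0⦌),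
      IsQuasiIso (F := sectionsPresheaf (A a) (I.inf U))
        (G := sectionsPresheaf (A b) (I.inf U) ⋙ tensorFunctor k 0)
        (Functor.whiskerLeft (OpensIn.ofOpens (I.inf U)).op ((K h).app (op ⦋0⦌) σ))
  /-- Compatibility of the family with compositions. -/
  union : ∀ {I : Finset (Fin (n + 1))} {a b : Fin (n + 1)} (h : IsEnds I a b) {i : Fin (n + 1)}
    (hi : i ∈ I) (hai : a < i) (hib : i < b) (Δ : SimplexCategoryᵒᵖ)
    (σ : ComposableArrows (CubePoset.{u} (I.filter (· ≤ i)) a i) Δ.unop.len)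
    (τ : ComposableArrows (CubePoset.{u} (I.filter (i ≤ ·)) i b) Δ.unop.len),
      (K h).app Δ (unionSimplex i σ τ) =
        compose
          (restrictSimplex (Finset.inf_mono (Finset.filter_subset _ I))
            ((K (h.lower hi hai)).app Δ σ))
          (restrictSimplex (Finset.inf_mono (Finset.filter_subset _ I))
            ((K (h.upper hi hib)).app Δ τ))
  /-- Compatibility of the family with the omission of an index. -/
  incl : ∀ {I : Finset (Fin (n + 1))} {a b : Fin (n + 1)} (h : IsEnds I a b) {i : Fin (n + 1)}
    (_ : i ∈ I) (hai : a < i) (hib : i < b) (Δ : SimplexCategoryᵒᵖ)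
    (σ : ComposableArrows (CubePoset.{u} (I.erase i) a b) Δ.unop.len),
      (K h).app Δ (inclSimplex i σ) =
        restrictSimplex (Finset.inf_mono (Finset.erase_subset i I))
          ((K (h.erase hai hib)).app Δ σ)

end Gluing

end

end P0Glue

namespace P0Glue

noncomputable section

set_option linter.unusedSectionVars false

/-! ### Homomorphisms between algebras of polynomial forms -/

section FormHom

variable {k : Type u} [Field k]

/-! The gluing data are a diagram that commutes only up to coherent homotopy, so the sheaves cannot
be glued directly. The remedy is to replace each of them by a larger model on which the transitions
become strict. Write `F b` for the direct image of `A b` on X. An element of `R i V` assigns to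
every chain τ₀ ⊆ … ⊆ τₘ of sets of indices ≥ i and every b ∈ τ₀ an element of `F b` over V ∩ U_{τₘ},
tensored with Ω(Δᵐ). The values are natural in the simplex, and for j ≤ b in τ₀ the value at b is
the image, under the coherent morphism from j to b, of the value at j of the chain truncated to
indices ≤ j. All these conditions are equations between images under morphisms of differential
P₀-algebras, so `R i V` is again such an algebra. Forgetting chains gives strictly functorial maps
from `R i V` to `R j V'` for i ≤ j and V' ⊆ V. Hence V ↦ `R i V`, with i the largest index such that
V ⊆ U i, is a presheaf, and A is its associated sheaf.

For V ⊆ U i the algebra `R i V` has the cohomology of `F i` over V. In one direction `sec`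
transports a section to all chains, enlarged by i; in the other, `ev` reads off the value at the
chain {i}. Truncation at i identifies the value of r at τ ∪ {i} with that of `sec (ev r)`, so it
remains to join τ to τ ∪ {i}. The two are the ends of a prism, cut into the m + 1 simplices τ₀ ⊆ … ⊆
τₗ ⊆ τₗ ∪ {i} ⊆ … ⊆ τₘ ∪ {i}; no open set shrinks, because V ⊆ U i. Integrating the values of r over
the fibres of the prism gives a homotopy: by Stokes (`fibreInt_stokes`) the contributions of the
prism telescope to the difference of its two ends (`exists_homotopy`). For the integrals to form an
element of `R i V` again, integration must be natural in the simplex once all prisms are summed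
(`omegaPullback_fibreInt`) and linear over the forms on the base (`fibreInt_mul`,
`tensorInt_extend`). Characteristic 0 provides the primitives of polynomials.

Finally, the composite of `sec`, the passage from `R i` to `R j`, and `ev` is the morphism attached
to the pair {i, j} (`sec_ev_eq_link`), a quasi-isomorphism by hypothesis. Since `ev` for j loses no
cohomology, the map from `F i` to the glued presheaf is locally bijective on cohomology. The
criterion `isQuasiIso_iff` expresses this by closed and exact sections, a form which survives the
passage to the associated sheaf. -/

theorem poly_mem_zero {n : ℕ} (f : MvPolynomial (Fin n) k) :
    f ⊗ₜ[k] (1 : ExteriorAlgebra k (Fin n → k)) ∈ omegaDeg k n 0 :=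
  tmul_mem_omegaDeg (r := 0) f
    (SetLike.GradedOne.one_mem (A := fun r : ℕ => ⋀[k]^r (Fin n → k)))

theorem poly_mul_comm {n : ℕ} (f : MvPolynomial (Fin n) k) (x : Omega k n) :
    f ⊗ₜ[k] (1 : ExteriorAlgebra k (Fin n → k)) * x = x * f ⊗ₜ[k] 1 := by
  induction x using TensorProduct.induction_on with
  | zero => simp
  | tmul g β => simp [Algebra.TensorProduct.tmul_mul_tmul, mul_comm]
  | add a b h1 h2 => rw [mul_add, add_mul, h1, h2]

theorem omegaD_X {n : ℕ} (i : Fin n) :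
    omegaD n ((MvPolynomial.X i : MvPolynomial (Fin n) k) ⊗ₜ[k] 1) =
      1 ⊗ₜ[k] ExteriorAlgebra.ι k (Pi.single i 1) := by
  simpa [bary, baryD] using omegaD_bary (k := k) n i.succ

/-- A morphism of differential graded algebras between algebras of polynomial forms. -/
structure IsFormHom {m n : ℕ} (F : Omega k n →ₐ[k] Omega k m) : Prop where
  map_deg : ∀ {q : ℤ} {x : Omega k n}, x ∈ omegaDeg k n q → F x ∈ omegaDeg k m q
  map_d : ∀ x, F (omegaD n x) = omegaD m (F x)

theorem isFormHom_omegaPullback {m n : ℕ} (θ : Fin (m + 1) → Fin (n + 1)) :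
    IsFormHom (omegaPullback k θ) :=
  ⟨omegaPullback_mem θ, omegaPullback_d θ⟩

theorem isFormHom_id (n : ℕ) : IsFormHom (AlgHom.id k (Omega k n)) :=
  ⟨fun h => h, fun _ => rfl⟩

theorem IsFormHom.comp {l m n : ℕ} {F : Omega k n →ₐ[k] Omega k m} {G : Omega k m →ₐ[k] Omega k l}
    (hG : IsFormHom G) (hF : IsFormHom F) : IsFormHom (G.comp F) :=
  ⟨fun h => hG.map_deg (hF.map_deg h), fun x => by
    rw [AlgHom.comp_apply, hF.map_d, hG.map_d]; rfl⟩

/-- The coordinate functions and their differentials generate Ω, and compatibility with d carries an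
equality from a function to its differential. Identities between pullbacks, evaluations and changes
of coordinates are thus reduced to coordinate functions. -/
theorem IsFormHom.ext {m n : ℕ} {F G : Omega k n →ₐ[k] Omega k m} (hF : IsFormHom F)
    (hG : IsFormHom G)
    (h : ∀ i, F (MvPolynomial.X i ⊗ₜ[k] 1) = G (MvPolynomial.X i ⊗ₜ[k] 1)) : F = G := by
  refine Algebra.TensorProduct.ext ?_ ?_
  · exact MvPolynomial.algHom_ext fun i => h i
  · refine ExteriorAlgebra.hom_ext (LinearMap.pi_ext' fun i => LinearMap.ext_ring ?_)
    have := congrArg (omegaD m) (h i)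
    rw [← hF.map_d, ← hG.map_d, omegaD_X] at this
    simpa using this

/-- Graded commutativity gives 2x² = 0, and 2 is invertible. This is the relation needed to send the
generators of an exterior algebra to arbitrary 1-forms. -/
theorem one_form_sq [CharZero k] {n : ℕ} {x : Omega k n} (hx : x ∈ omegaDeg k n 1) :
    x * x = 0 := by
  have h := omega_mul_comm hx hx
  have h1 : ((-1 : k) ^ ((1 : ℤ) * 1)) = -1 := by simp
  rw [h1] at h
  have h2 : (2 : k) • (x * x) = 0 := by
    have e1 : (2 : k) • (x * x) = x * x + x * x := two_smul k (x * x)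
    have e2 : (-1 : k) • (x * x) = - (x * x) := neg_one_smul k (x * x)
    rw [e1]
    exact eq_neg_iff_add_eq_zero.mp (h.trans e2)
  exact (smul_eq_zero.mp h2).resolve_left two_ne_zero


/-- The linear map `dtᵢ ↦ dφᵢ`. -/
def formLin {m n : ℕ} (φ : Fin n → MvPolynomial (Fin m) k) : (Fin n → k) →ₗ[k] Omega k m :=
  Fintype.linearCombination k fun i => omegaD m (φ i ⊗ₜ[k] 1)

theorem formLin_mem {m n : ℕ} (φ : Fin n → MvPolynomial (Fin m) k) (v : Fin n → k) :
    formLin φ v ∈ omegaDeg k m 1 := by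
  rw [formLin, Fintype.linearCombination_apply]
  exact sum_mem fun i _ => Submodule.smul_mem _ _ (by simpa using omegaD_mem (poly_mem_zero (φ i)))

variable [CharZero k]

/-- The pullback of forms along the polynomial map with components `φᵢ`. -/
def formHom {m n : ℕ} (φ : Fin n → MvPolynomial (Fin m) k) : Omega k n →ₐ[k] Omega k m :=
  Algebra.TensorProduct.lift
    ((Algebra.TensorProduct.includeLeft : MvPolynomial (Fin m) k →ₐ[k] Omega k m).comp
      (MvPolynomial.aeval φ))
    (ExteriorAlgebra.lift k ⟨formLin φ, fun v => one_form_sq (formLin_mem φ v)⟩)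
    (fun x _ => poly_mul_comm (MvPolynomial.aeval φ x) _)

theorem formHom_poly {m n : ℕ} (φ : Fin n → MvPolynomial (Fin m) k) (f : MvPolynomial (Fin n) k) :
    formHom φ (f ⊗ₜ[k] 1) = MvPolynomial.aeval φ f ⊗ₜ[k] 1 := by
  simp [formHom]

theorem formHom_X {m n : ℕ} (φ : Fin n → MvPolynomial (Fin m) k) (i : Fin n) :
    formHom φ (MvPolynomial.X i ⊗ₜ[k] 1) = φ i ⊗ₜ[k] 1 := by
  rw [formHom_poly, MvPolynomial.aeval_X]

/-- Every form is a sum of products of a polynomial and a form with constant coefficients. On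
polynomials compatibility with d follows from the Leibniz rule by induction. A form with constant
coefficients is closed, and it goes to a polynomial in the exact forms dφᵢ, which is closed as well.
-/
theorem isFormHom_formHom {m n : ℕ} (φ : Fin n → MvPolynomial (Fin m) k) :
    IsFormHom (formHom φ) := by
  have hι : ∀ v : Fin n → k, formHom φ (1 ⊗ₜ[k] ExteriorAlgebra.ι k v) = formLin φ v := by
    intro v; simp [formHom, ← Algebra.TensorProduct.one_def]
  have hdι : ∀ v : Fin n → k, omegaD m (formLin φ v) = 0 := by
    intro v
    rw [formLin, Fintype.linearCombination_apply, map_sum]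
    exact Finset.sum_eq_zero fun i _ => by rw [map_smul, omegaD_omegaD, smul_zero]
  have hdeg : ∀ {q : ℤ} {x : Omega k n}, x ∈ omegaDeg k n q → formHom φ x ∈ omegaDeg k m q := by
    intro q x hx
    refine omega_induction (Q := fun x => formHom φ x ∈ omegaDeg k m q) ?_ (by simp) ?_ x hx
    · rintro f r rfl α hα
      have e : f ⊗ₜ[k] α = (f ⊗ₜ[k] 1) * (1 ⊗ₜ[k] α) := by
        rw [Algebra.TensorProduct.tmul_mul_tmul]; simp
      rw [e, map_mul, formHom_poly]
      have : formHom φ (1 ⊗ₜ[k] α) ∈ omegaDeg k m r := by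
        clear hx e
        induction hα using Submodule.pow_induction_on_left' with
        | algebraMap c =>
          have : (1 : MvPolynomial (Fin n) k) ⊗ₜ[k]
              algebraMap k (ExteriorAlgebra k (Fin n → k)) c = algebraMap k (Omega k n) c := by
            rw [Algebra.TensorProduct.algebraMap_apply']
          rw [this, AlgHom.commutes]
          exact SetLike.algebraMap_mem_graded (A := omegaDeg k m) c
        | add x y i _ _ h1 h2 =>
          rw [TensorProduct.tmul_add, map_add]
          exact add_mem h1 h2
        | mem_mul v hv i x hx ih =>
          obtain ⟨w, rfl⟩ := hv
          have e : (1 : MvPolynomial (Fin n) k) ⊗ₜ[k] (ExteriorAlgebra.ι k w * x) =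
            (1 ⊗ₜ[k] ExteriorAlgebra.ι k w) * (1 ⊗ₜ[k] x) := by
            rw [Algebra.TensorProduct.tmul_mul_tmul, one_mul]
          rw [e, map_mul, hι]
          have := SetLike.GradedMul.mul_mem (A := omegaDeg k m) (formLin_mem φ w) ih
          rw [Nat.cast_succ, add_comm]
          exact this
      simpa using SetLike.GradedMul.mul_mem (A := omegaDeg k m)
        (poly_mem_zero (MvPolynomial.aeval φ f)) this
    · intro z w h1 h2
      rw [map_add]; exact add_mem h1 h2
  refine ⟨hdeg, ?_⟩
  have hpoly : ∀ f : MvPolynomial (Fin n) k, formHom φ (omegaD n (f ⊗ₜ[k] 1)) =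
      omegaD m (formHom φ (f ⊗ₜ[k] 1)) := by
    intro f
    induction f using MvPolynomial.induction_on with
    | C a =>
      have h1 : ∀ l : ℕ, (MvPolynomial.C a : MvPolynomial (Fin l) k) ⊗ₜ[k]
          (1 : ExteriorAlgebra k (Fin l → k)) = a • 1 := by
        intro l
        rw [Algebra.TensorProduct.one_def, TensorProduct.smul_tmul', MvPolynomial.C_eq_smul_one]
      rw [h1, map_smul, omegaD_one, smul_zero, map_zero, map_smul, map_one, map_smul, omegaD_one,
        smul_zero]
    | add p q h1 h2 => rw [TensorProduct.add_tmul, map_add, map_add, map_add, map_add, h1, h2]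
    | mul_X p i h =>
      have e : (p * MvPolynomial.X i) ⊗ₜ[k] (1 : ExteriorAlgebra k (Fin n → k)) =
          (p ⊗ₜ[k] 1) * (MvPolynomial.X i ⊗ₜ[k] 1) := by
        rw [Algebra.TensorProduct.tmul_mul_tmul, one_mul]
      have hX : formHom φ (omegaD n (MvPolynomial.X i ⊗ₜ[k] 1)) =
          omegaD m (formHom φ (MvPolynomial.X i ⊗ₜ[k] 1)) := by
        rw [omegaD_X, hι, formHom_X]
        simp [formLin]
      rw [e, omegaD_mul (poly_mem_zero p), map_add, map_smul, map_mul, map_mul, map_mul,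
        omegaD_mul (hdeg (poly_mem_zero p)), h, hX]
  have hext : ∀ α, omegaD m (formHom φ ((1 : MvPolynomial (Fin n) k) ⊗ₜ[k] α)) = 0 := by
    intro α
    induction α using CliffordAlgebra.left_induction with
    | algebraMap r =>
      have : (1 : MvPolynomial (Fin n) k) ⊗ₜ[k]
          algebraMap k (ExteriorAlgebra k (Fin n → k)) r = r • 1 := by
        rw [Algebra.algebraMap_eq_smul_one, TensorProduct.tmul_smul,
          Algebra.TensorProduct.one_def]
      refine (congrArg (fun x => omegaD m (formHom φ x)) this).trans ?_
      rw [map_smul, map_one, map_smul, omegaD_one, smul_zero]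
    | add x y h1 h2 => rw [TensorProduct.tmul_add, map_add, map_add, h1, h2, add_zero]
    | ι_mul x v h =>
      have e : (1 : MvPolynomial (Fin n) k) ⊗ₜ[k] (ExteriorAlgebra.ι k v * x) =
            (1 ⊗ₜ[k] ExteriorAlgebra.ι k v) * (1 ⊗ₜ[k] x) := by
            rw [Algebra.TensorProduct.tmul_mul_tmul, one_mul]
      refine (congrArg (fun x => omegaD m (formHom φ x)) e).trans ?_
      rw [map_mul, hι, omegaD_mul (formLin_mem φ v), hdι, h, zero_mul, mul_zero, smul_zero,
        zero_add]
  have hext' : ∀ α, omegaD n ((1 : MvPolynomial (Fin n) k) ⊗ₜ[k] α) = 0 := by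
    intro α; rw [omegaD_tmul]; simp
  intro x
  induction x using TensorProduct.induction_on with
  | zero => simp
  | add a b h1 h2 => simp only [map_add, h1, h2]
  | tmul f α =>
    have e : f ⊗ₜ[k] α = (f ⊗ₜ[k] 1) * (1 ⊗ₜ[k] α) := by
      rw [Algebra.TensorProduct.tmul_mul_tmul]; simp
    rw [e, omegaD_mul (poly_mem_zero f), map_mul, omegaD_mul (hdeg (poly_mem_zero f)), hext, hext',
      mul_zero, smul_zero, mul_zero, smul_zero, add_zero, add_zero, map_mul, hpoly]

end FormHom

/-! ### Forms on the product of a simplex with the affine line -/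

section Cylinder

variable {k : Type u} [Field k] [CharZero k]

variable (k) in
/-- The inclusion `Ω → Ω[z, dz]`, where `z` is the last variable. -/
def cylIncl (m : ℕ) : Omega k m →ₐ[k] Omega k (m + 1) :=
  formHom fun i => MvPolynomial.X i.castSucc

/-- The evaluation `Ω[z, dz] → Ω` at `z = a`. -/
def cylEval {m : ℕ} (a : MvPolynomial (Fin m) k) : Omega k (m + 1) →ₐ[k] Omega k m :=
  formHom (Fin.snoc (α := fun _ => MvPolynomial (Fin m) k) MvPolynomial.X a)

variable (k) in
/-- The variable `z`. -/
def cylZ (m : ℕ) : Omega k (m + 1) := MvPolynomial.X (Fin.last m) ⊗ₜ[k] 1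

variable (k) in
/-- The form `dz`. -/
def cylDz (m : ℕ) : Omega k (m + 1) := omegaD (m + 1) (cylZ k m)

theorem cylZ_pow (m a : ℕ) : cylZ k m ^ a = (MvPolynomial.X (Fin.last m) ^ a) ⊗ₜ[k] 1 := by
  rw [cylZ, Algebra.TensorProduct.tmul_pow, one_pow]

theorem cylDz_eq (m : ℕ) :
    cylDz k m = 1 ⊗ₜ[k] ExteriorAlgebra.ι k (Pi.single (Fin.last m) 1) := omegaD_X _

theorem cylZ_pow_mem (m a : ℕ) : cylZ k m ^ a ∈ omegaDeg k (m + 1) 0 := by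
  rw [cylZ_pow]; exact poly_mem_zero _

theorem cylDz_mem (m : ℕ) : cylDz k m ∈ omegaDeg k (m + 1) 1 := by
  have := omegaD_mem (cylZ_pow_mem (k := k) m 1)
  rw [pow_one] at this
  exact this

theorem cylZ_pow_comm (m a : ℕ) (x : Omega k (m + 1)) : cylZ k m ^ a * x = x * cylZ k m ^ a := by
  rw [cylZ_pow]; exact poly_mul_comm _ x

theorem omegaD_cylZ_pow (m a : ℕ) :
    omegaD (m + 1) (cylZ k m ^ (a + 1)) = (a + 1 : k) • (cylZ k m ^ a * cylDz k m) := by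
  induction a with
  | zero => simp [cylDz]
  | succ a ih =>
    rw [pow_succ, omegaD_mul (cylZ_pow_mem m (a + 1)), ih, zpow_zero, one_smul, smul_mul_assoc,
      mul_assoc, ← pow_one (cylZ k m), ← cylZ_pow_comm m 1, pow_one, ← mul_assoc, ← pow_succ]
    change _ + cylZ k m ^ (a + 1) * cylDz k m = _
    push_cast
    module

theorem isFormHom_cylIncl (m : ℕ) : IsFormHom (cylIncl k m) := isFormHom_formHom _

theorem isFormHom_cylEval {m : ℕ} (a : MvPolynomial (Fin m) k) : IsFormHom (cylEval a) :=
  isFormHom_formHom _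

theorem cylEval_cylIncl {m : ℕ} (a : MvPolynomial (Fin m) k) (x : Omega k m) :
    cylEval a (cylIncl k m x) = x := by
  have : (cylEval a).comp (cylIncl k m) = AlgHom.id k _ := by
    refine ((isFormHom_cylEval a).comp (isFormHom_cylIncl m)).ext (isFormHom_id m) fun i => ?_
    simp [cylIncl, cylEval, formHom_X]
  exact congrArg (fun F => F x) this

theorem cylEval_cylZ {m : ℕ} (a : MvPolynomial (Fin m) k) :
    cylEval a (cylZ k m) = a ⊗ₜ[k] 1 := by
  rw [cylEval, cylZ, formHom_X]; simp

theorem cylIncl_tmul (m : ℕ) (f : MvPolynomial (Fin m) k) (α : ExteriorAlgebra k (Fin m → k)) :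
    cylIncl k m (f ⊗ₜ[k] α) = MvPolynomial.rename Fin.castSucc f ⊗ₜ[k]
      ExteriorAlgebra.map (Fintype.linearCombination k
        fun i : Fin m => (Pi.single i.castSucc 1 : Fin (m + 1) → k)) α := by
  have : cylIncl k m = Algebra.TensorProduct.map (MvPolynomial.rename Fin.castSucc)
      (ExteriorAlgebra.map (Fintype.linearCombination k
        fun i : Fin m => (Pi.single i.castSucc 1 : Fin (m + 1) → k))) := by
    refine Algebra.TensorProduct.ext ?_ ?_
    · refine MvPolynomial.algHom_ext fun i => ?_
      simp [cylIncl, formHom_X]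
    · refine ExteriorAlgebra.hom_ext (LinearMap.pi_ext' fun i => LinearMap.ext_ring ?_)
      have h := (isFormHom_cylIncl m).map_d (MvPolynomial.X i ⊗ₜ[k] 1)
      rw [omegaD_X] at h
      simp only [cylIncl, formHom_X, omegaD_X] at h
      simp [cylIncl, h]
  rw [this, Algebra.TensorProduct.map_tmul]

/-- A property of forms in `Ω[z, dz]` may be checked on the forms `β zᵃ` and `β zᵃ dz`. -/
theorem cyl_induction {m : ℕ} {Q : Omega k (m + 1) → Prop}
    (hadd : ∀ x y, Q x → Q y → Q (x + y))
    (hz : ∀ (q : ℤ) (β : Omega k m), β ∈ omegaDeg k m q → ∀ a : ℕ,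
      Q (cylIncl k m β * cylZ k m ^ a))
    (hdz : ∀ (q : ℤ) (β : Omega k m), β ∈ omegaDeg k m q → ∀ a : ℕ,
      Q (cylIncl k m β * (cylZ k m ^ a * cylDz k m)))
    (x : Omega k (m + 1)) : Q x := by
  -- The span of the test forms contains 1 and is stable under left multiplication by every
  -- coordinate function and its differential, so it is everything. Homogeneity of β is what allows
  -- dz to be moved across it at the cost of a sign.
  let G : Set (Omega k (m + 1)) := {x | ∃ (q : ℤ) (β : Omega k m) (a : ℕ), β ∈ omegaDeg k m q ∧
    (x = cylIncl k m β * cylZ k m ^ a ∨ x = cylIncl k m β * (cylZ k m ^ a * cylDz k m))}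
  let S : Submodule k (Omega k (m + 1)) := Submodule.span k G
  have hGS : G ⊆ S := Submodule.subset_span
  have hQ : ∀ x ∈ S, Q x := by
    intro x hx
    -- Q is only assumed additive, so the induction over the span carries a scalar, which is
    -- absorbed into β on the generators.
    suffices ∀ c : k, Q (c • x) by simpa using this 1
    have h0 : Q 0 := by simpa using hz 0 0 (zero_mem _) 0
    refine Submodule.span_induction (p := fun z _ => ∀ c : k, Q (c • z)) ?_ ?_ ?_ ?_ hx
    · rintro _ ⟨q, β, a, hβ, rfl | rfl⟩ c
      · rw [← smul_mul_assoc, ← map_smul]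
        exact hz q _ (Submodule.smul_mem _ _ hβ) a
      · rw [← smul_mul_assoc, ← map_smul]
        exact hdz q _ (Submodule.smul_mem _ _ hβ) a
    · intro c; rwa [smul_zero]
    · intro x y _ _ h1 h2 c
      rw [smul_add]; exact hadd _ _ (h1 c) (h2 c)
    · intro d x _ h1 c
      rw [smul_smul]; exact h1 _
  have hmul : ∀ y : Omega k (m + 1), (∀ g ∈ G, y * g ∈ S) → ∀ x ∈ S, y * x ∈ S := by
    intro y hy x hx
    refine Submodule.span_induction (p := fun z _ => y * z ∈ S) hy ?_ ?_ ?_ hx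
    · rw [mul_zero]; exact zero_mem _
    · intro a b _ _ h1 h2; rw [mul_add]; exact add_mem h1 h2
    · intro c a _ h1; rw [mul_smul_comm]; exact Submodule.smul_mem _ _ h1
  have hincl : ∀ (p : ℤ) (γ : Omega k m), γ ∈ omegaDeg k m p → ∀ x ∈ S, cylIncl k m γ * x ∈ S := by
    intro p γ hγ
    refine hmul _ ?_
    rintro _ ⟨q, β, a, hβ, rfl | rfl⟩
    · refine hGS ⟨p + q, γ * β, a, SetLike.GradedMul.mul_mem hγ hβ, Or.inl ?_⟩
      rw [map_mul, mul_assoc]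
    · refine hGS ⟨p + q, γ * β, a, SetLike.GradedMul.mul_mem hγ hβ, Or.inr ?_⟩
      rw [map_mul, mul_assoc]
  have hZ : ∀ x ∈ S, cylZ k m * x ∈ S := by
    refine hmul _ ?_
    rintro _ ⟨q, β, a, hβ, rfl | rfl⟩
    · refine hGS ⟨q, β, a + 1, hβ, Or.inl ?_⟩
      rw [← pow_one (cylZ k m), cylZ_pow_comm, mul_assoc, pow_one, pow_succ]
    · refine hGS ⟨q, β, a + 1, hβ, Or.inr ?_⟩
      rw [← pow_one (cylZ k m), cylZ_pow_comm, mul_assoc, ← cylZ_pow_comm, pow_one, pow_succ',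
        ← mul_assoc (cylZ k m)]
  have hDz : ∀ x ∈ S, cylDz k m * x ∈ S := by
    refine hmul _ ?_
    rintro _ ⟨q, β, a, hβ, rfl | rfl⟩
    · rw [← mul_assoc, omega_mul_comm (cylDz_mem m) ((isFormHom_cylIncl m).map_deg hβ),
        smul_mul_assoc, mul_assoc, ← cylZ_pow_comm]
      exact Submodule.smul_mem _ _ (hGS ⟨q, β, a, hβ, Or.inr rfl⟩)
    · rw [← mul_assoc, omega_mul_comm (cylDz_mem m) ((isFormHom_cylIncl m).map_deg hβ),
        smul_mul_assoc, mul_assoc, cylZ_pow_comm, ← mul_assoc (cylDz k m),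
        one_form_sq (cylDz_mem m), zero_mul, mul_zero, smul_zero]
      exact zero_mem _
  have h1 : (1 : Omega k (m + 1)) ∈ S :=
    hGS ⟨0, 1, 0, SetLike.GradedOne.one_mem (A := omegaDeg k m), Or.inl (by simp)⟩
  have hX : ∀ i : Fin (m + 1), ∀ x ∈ S,
      ((MvPolynomial.X i : MvPolynomial (Fin (m + 1)) k) ⊗ₜ[k] 1) * x ∈ S := by
    intro i
    refine Fin.lastCases hZ (fun i => ?_) i
    have := hincl 0 _ (poly_mem_zero (MvPolynomial.X i))
    rw [cylIncl, formHom_X] at this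
    exact this
  have hdX : ∀ i : Fin (m + 1), ∀ x ∈ S,
      ((1 : MvPolynomial (Fin (m + 1)) k) ⊗ₜ[k] ExteriorAlgebra.ι k (Pi.single i 1)) * x ∈ S := by
    intro i
    refine Fin.lastCases ?_ (fun i => ?_) i
    · rw [← cylDz_eq]; exact hDz
    · have := hincl (0 + 1) _ (omegaD_mem (poly_mem_zero (MvPolynomial.X i)))
      rw [(isFormHom_cylIncl m).map_d, cylIncl, formHom_X, omegaD_X] at this
      exact this
  have hext : ∀ α, (1 : MvPolynomial (Fin (m + 1)) k) ⊗ₜ[k] α ∈ S := by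
    intro α
    induction α using CliffordAlgebra.left_induction with
    | algebraMap r =>
      have : (1 : MvPolynomial (Fin (m + 1)) k) ⊗ₜ[k]
          algebraMap k (ExteriorAlgebra k (Fin (m + 1) → k)) r = r • 1 := by
        rw [Algebra.algebraMap_eq_smul_one, TensorProduct.tmul_smul,
          Algebra.TensorProduct.one_def]
      exact this ▸ Submodule.smul_mem _ _ h1
    | add x y h1 h2 => rw [TensorProduct.tmul_add]; exact add_mem h1 h2
    | ι_mul x v h =>
      have hv : v = ∑ i, v i • (Pi.single i 1 : Fin (m + 1) → k) := by
        ext j; simp [Finset.sum_apply, Pi.single_apply]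
      have e : (1 : MvPolynomial (Fin (m + 1)) k) ⊗ₜ[k] (ExteriorAlgebra.ι k v * x) =
          ∑ i, v i • ((1 ⊗ₜ[k] ExteriorAlgebra.ι k (Pi.single i 1)) * (1 ⊗ₜ[k] x)) := by
        simp only [Algebra.TensorProduct.tmul_mul_tmul, one_mul]
        nth_rewrite 1 [hv]
        rw [map_sum, Finset.sum_mul, TensorProduct.tmul_sum]
        simp
      refine (congrArg (fun y => y ∈ S) e).mpr ?_
      exact sum_mem fun i _ => Submodule.smul_mem _ _ (hdX i _ h)
  refine hQ x ?_
  induction x using TensorProduct.induction_on with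
  | zero => exact zero_mem _
  | add a b h1 h2 => exact add_mem h1 h2
  | tmul f α =>
    have e : f ⊗ₜ[k] α = (f ⊗ₜ[k] 1) * (1 ⊗ₜ[k] α) := by
      rw [Algebra.TensorProduct.tmul_mul_tmul]; simp
    rw [e]
    have := hext α
    generalize (1 : MvPolynomial (Fin (m + 1)) k) ⊗ₜ[k] α = y at this
    -- The induction must range over all y in S, because a variable split off from f is absorbed
    -- into y.
    induction f using MvPolynomial.induction_on generalizing y with
    | C a =>
      have : (MvPolynomial.C a : MvPolynomial (Fin (m + 1)) k) ⊗ₜ[k]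
          (1 : ExteriorAlgebra k (Fin (m + 1) → k)) = a • 1 := by
        rw [Algebra.TensorProduct.one_def, TensorProduct.smul_tmul', MvPolynomial.C_eq_smul_one]
      rw [this, smul_mul_assoc, one_mul]
      exact Submodule.smul_mem _ _ ‹_›
    | add p q h1 h2 =>
      rw [TensorProduct.add_tmul, add_mul]
      exact add_mem (h1 (by rw [Algebra.TensorProduct.tmul_mul_tmul]; simp) _ this)
        (h2 (by rw [Algebra.TensorProduct.tmul_mul_tmul]; simp) _ this)
    | mul_X p i h =>
      have e : (p * MvPolynomial.X i) ⊗ₜ[k] (1 : ExteriorAlgebra k (Fin (m + 1) → k)) =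
          (p ⊗ₜ[k] 1) * (MvPolynomial.X i ⊗ₜ[k] 1) := by
        rw [Algebra.TensorProduct.tmul_mul_tmul, one_mul]
      rw [e, mul_assoc]
      exact h (by rw [Algebra.TensorProduct.tmul_mul_tmul]; simp) _ (hX i _ this)

/-- The primitive of a polynomial with respect to the last variable. -/
def polyPrim (m : ℕ) : MvPolynomial (Fin (m + 1)) k →ₗ[k] MvPolynomial (Fin (m + 1)) k :=
  (MvPolynomial.basisMonomials (Fin (m + 1)) k).constr k fun s =>
    MvPolynomial.monomial (s + Finsupp.single (Fin.last m) 1) ((s (Fin.last m) + 1 : k)⁻¹)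

theorem polyPrim_mul (m a : ℕ) (f : MvPolynomial (Fin m) k) :
    polyPrim m (MvPolynomial.rename Fin.castSucc f * MvPolynomial.X (Fin.last m) ^ a) =
      (a + 1 : k)⁻¹ • (MvPolynomial.rename Fin.castSucc f *
        MvPolynomial.X (Fin.last m) ^ (a + 1)) := by
  induction f using MvPolynomial.induction_on' with
  | add p q h1 h2 => rw [map_add, add_mul, map_add, h1, h2, add_mul, smul_add]
  | monomial s c =>
    -- A renamed monomial does not involve the last variable, so the exponent of z seen by
    -- `polyPrim` is exactly a.
    have hs : Finsupp.mapDomain Fin.castSucc s (Fin.last m) = 0 :=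
      Finsupp.mapDomain_of_notMem_range _ _ (by simp)
    have h : ∀ t : Fin (m + 1) →₀ ℕ, polyPrim m (MvPolynomial.monomial t c) =
        MvPolynomial.monomial (t + Finsupp.single (Fin.last m) 1)
          (c * (t (Fin.last m) + 1 : k)⁻¹) := by
      intro t
      have : MvPolynomial.monomial t c =
          c • MvPolynomial.basisMonomials (Fin (m + 1)) k t := by
        simp [MvPolynomial.smul_monomial]
      rw [this, map_smul, polyPrim, Module.Basis.constr_basis, MvPolynomial.smul_monomial,
        smul_eq_mul]
    rw [MvPolynomial.rename_monomial, MvPolynomial.X_pow_eq_monomial,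
      MvPolynomial.X_pow_eq_monomial, MvPolynomial.monomial_mul, MvPolynomial.monomial_mul, mul_one, h,
      MvPolynomial.smul_monomial, add_assoc, ← Finsupp.single_add]
    congr 1
    simp [hs, mul_comm]

/-- The primitive of a form with respect to the last variable `z`: it vanishes on `β zᵃ` and sends
`β zᵃ dz` to `± β zᵃ⁺¹ / (a + 1)`. -/
def cylPrim (m : ℕ) : Omega k (m + 1) →ₗ[k] Omega k (m + 1) :=
  TensorProduct.map (polyPrim m) (CliffordAlgebra.contractLeft (LinearMap.proj (Fin.last m)))

/-- Contraction with the covector dual to dz is an antiderivation that kills the remaining dtᵢ,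
hence everything coming from the base. -/
theorem contract_map (m : ℕ) (α : ExteriorAlgebra k (Fin m → k)) :
    CliffordAlgebra.contractLeft (LinearMap.proj (Fin.last m))
      (ExteriorAlgebra.map (Fintype.linearCombination k
        fun i : Fin m => (Pi.single i.castSucc 1 : Fin (m + 1) → k)) α) = 0 := by
  induction α using CliffordAlgebra.left_induction with
  | algebraMap r => rw [AlgHom.commutes, CliffordAlgebra.contractLeft_algebraMap]
  | add x y h1 h2 => rw [map_add, map_add, h1, h2, add_zero]
  | ι_mul x v h =>
    rw [map_mul]
    erw [ExteriorAlgebra.map_apply_ι]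
    rw [CliffordAlgebra.contractLeft_ι_mul, h, mul_zero, sub_zero]
    simp [Fintype.linearCombination_apply, Fin.castSucc_ne_last]

/-- The contraction has to pass the r factors of α, with a sign for each, before it meets dz and
gives 1. -/
theorem contract_map_mul (m : ℕ) {r : ℕ} {α : ExteriorAlgebra k (Fin m → k)}
    (hα : α ∈ ⋀[k]^r (Fin m → k)) :
    CliffordAlgebra.contractLeft (LinearMap.proj (Fin.last m))
      (ExteriorAlgebra.map (Fintype.linearCombination k
        fun i : Fin m => (Pi.single i.castSucc 1 : Fin (m + 1) → k)) α *
          ExteriorAlgebra.ι k (Pi.single (Fin.last m) 1)) =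
      (-1 : k) ^ (r : ℤ) • ExteriorAlgebra.map (Fintype.linearCombination k
        fun i : Fin m => (Pi.single i.castSucc 1 : Fin (m + 1) → k)) α := by
  induction hα using Submodule.pow_induction_on_left' with
  | algebraMap c =>
    rw [AlgHom.commutes, CliffordAlgebra.contractLeft_algebraMap_mul]
    erw [CliffordAlgebra.contractLeft_ι]
    simp
  | add x y i _ _ h1 h2 => rw [map_add, add_mul, map_add, h1, h2, smul_add]
  | mem_mul v hv i x hx ih =>
    obtain ⟨w, rfl⟩ := hv
    rw [map_mul (ExteriorAlgebra.map _), ExteriorAlgebra.map_apply_ι, mul_assoc]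
    erw [CliffordAlgebra.contractLeft_ι_mul]
    rw [ih, Nat.cast_succ, zpow_add_one₀ (by simp)]
    have : (LinearMap.proj (Fin.last m) : (Fin (m + 1) → k) →ₗ[k] k)
        (Fintype.linearCombination k
          (fun i : Fin m => (Pi.single i.castSucc 1 : Fin (m + 1) → k)) w) = 0 := by
      simp [Fintype.linearCombination_apply, Fin.castSucc_ne_last]
    rw [this, zero_smul, zero_sub, mul_smul_comm, mul_neg_one, neg_smul]

theorem cylPrim_z {m : ℕ} (β : Omega k m) (a : ℕ) :
    cylPrim m (cylIncl k m β * cylZ k m ^ a) = 0 := by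
  induction β using TensorProduct.induction_on with
  | zero => simp
  | add x y h1 h2 => rw [map_add, add_mul, map_add, h1, h2, add_zero]
  | tmul f α =>
    rw [cylZ_pow, cylIncl_tmul, Algebra.TensorProduct.tmul_mul_tmul, mul_one, cylPrim,
      TensorProduct.map_tmul, contract_map, TensorProduct.tmul_zero]

theorem cylPrim_dz {m : ℕ} {q : ℤ} {β : Omega k m} (hβ : β ∈ omegaDeg k m q) (a : ℕ) :
    cylPrim m (cylIncl k m β * (cylZ k m ^ a * cylDz k m)) =
      ((-1 : k) ^ q * (a + 1 : k)⁻¹) • (cylIncl k m β * cylZ k m ^ (a + 1)) := by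
  refine omega_induction (Q := fun β => cylPrim m (cylIncl k m β * (cylZ k m ^ a * cylDz k m)) =
      ((-1 : k) ^ q * (a + 1 : k)⁻¹) • (cylIncl k m β * cylZ k m ^ (a + 1))) ?_ (by simp) ?_ β hβ
  · rintro f r rfl α hα
    rw [cylZ_pow, cylZ_pow, cylIncl_tmul, cylDz_eq]
    simp only [Algebra.TensorProduct.tmul_mul_tmul, mul_one, one_mul]
    rw [cylPrim, TensorProduct.map_tmul, polyPrim_mul, contract_map_mul m hα,
      TensorProduct.tmul_smul, ← TensorProduct.smul_tmul', smul_smul]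
  · intro z w h1 h2
    rw [map_add, add_mul, map_add, h1, h2, add_mul, smul_add]

end Cylinder

section

variable {k : Type u} [Field k]

theorem omegaPullback_poly {m n : ℕ} (θ : Fin (m + 1) → Fin (n + 1))
    (f : MvPolynomial (Fin n) k) :
    omegaPullback k θ (f ⊗ₜ[k] 1) = polyPullback k θ f ⊗ₜ[k] 1 := by
  rw [omegaPullback, Algebra.TensorProduct.map_tmul, map_one]

end

/-! ### The Poincaré homotopy on the cylinder -/

section CylPrim

variable {k : Type u} [Field k] [CharZero k]

/-- Integrating the coefficient does not change the degree and contraction lowers it by one. In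
degree 0 the contraction vanishes, so degree -1 causes no harm. -/
theorem cylPrim_mem {m : ℕ} {q : ℤ} {x : Omega k (m + 1)} (hx : x ∈ omegaDeg k (m + 1) q) :
    cylPrim m x ∈ omegaDeg k (m + 1) (q - 1) := by
  refine omega_induction (Q := fun x => cylPrim m x ∈ omegaDeg k (m + 1) (q - 1)) ?_ (by simp)
    ?_ x hx
  · rintro f r rfl α hα
    have key : (1 : MvPolynomial (Fin (m + 1)) k) ⊗ₜ[k]
        (CliffordAlgebra.contractLeft (LinearMap.proj (Fin.last m)) α :
          ExteriorAlgebra k (Fin (m + 1) → k)) ∈ omegaDeg k (m + 1) ((r : ℤ) - 1) := by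
      clear hx
      induction hα using Submodule.pow_induction_on_left' with
      | algebraMap c =>
        rw [CliffordAlgebra.contractLeft_algebraMap, TensorProduct.tmul_zero]
        exact zero_mem _
      | add x y i _ _ h1 h2 =>
        rw [map_add, TensorProduct.tmul_add]
        exact add_mem h1 h2
      | mem_mul v hv i x hx ih =>
        obtain ⟨w, rfl⟩ := hv
        erw [CliffordAlgebra.contractLeft_ι_mul]
        rw [TensorProduct.tmul_sub, TensorProduct.tmul_smul]
        refine sub_mem (Submodule.smul_mem _ _ ?_) ?_
        · have := tmul_mem_omegaDeg (1 : MvPolynomial (Fin (m + 1)) k) hx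
          simpa using this
        · have := SetLike.GradedMul.mul_mem (A := omegaDeg k (m + 1))
            (tmul_mem_omegaDeg 1 (ι_mem_one w)) ih
          rw [Algebra.TensorProduct.tmul_mul_tmul, one_mul] at this
          have e : ((1 : ℕ) : ℤ) + ((i : ℤ) - 1) = ((i.succ : ℕ) : ℤ) - 1 := by push_cast; ring
          rw [e] at this
          exact this
    have := SetLike.GradedMul.mul_mem (A := omegaDeg k (m + 1)) (poly_mem_zero (polyPrim m f)) key
    rw [Algebra.TensorProduct.tmul_mul_tmul, one_mul, mul_one, zero_add] at this
    exact this
  · intro z w h1 h2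
    rw [map_add]; exact add_mem h1 h2

/-- Linearity over the forms on the base, with the sign that an operator of degree -1 produces when
it passes α. -/
theorem cylPrim_incl_mul {m : ℕ} {q : ℤ} {α : Omega k m} (hα : α ∈ omegaDeg k m q)
    (x : Omega k (m + 1)) :
    cylPrim m (cylIncl k m α * x) = (-1 : k) ^ q • (cylIncl k m α * cylPrim m x) := by
  induction x using cyl_induction with
  | hadd x y h1 h2 => rw [mul_add, map_add, h1, h2, map_add, mul_add, smul_add]
  | hz p β hβ a => rw [← mul_assoc, ← map_mul, cylPrim_z, cylPrim_z, mul_zero, smul_zero]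
  | hdz p β hβ a =>
    rw [← mul_assoc, ← map_mul, cylPrim_dz (SetLike.GradedMul.mul_mem hα hβ), cylPrim_dz hβ,
      mul_smul_comm, smul_smul, map_mul, mul_assoc, ← mul_assoc ((-1 : k) ^ q), sign_mul]

/-- On βzᵃ with a > 0, differentiating zᵃ and integrating back returns the form; for a = 0 the form
is what evaluation at z = 0 retains. On βzᵃdz, whose value at z = 0 is zero, the two terms
containing dβ cancel because dβ has one degree more than β, and the remaining term is the form
itself. -/
theorem cylPrim_stokes {m : ℕ} (x : Omega k (m + 1)) :
    omegaD (m + 1) (cylPrim m x) + cylPrim m (omegaD (m + 1) x) =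
      x - cylIncl k m (cylEval (0 : MvPolynomial (Fin m) k) x) := by
  have hZ0 : ∀ a : ℕ, cylEval (0 : MvPolynomial (Fin m) k) (cylZ k m ^ (a + 1)) = 0 := by
    intro a
    rw [map_pow, cylEval_cylZ, TensorProduct.zero_tmul, zero_pow (by simp)]
  have hD0 : cylEval (0 : MvPolynomial (Fin m) k) (cylDz k m) = 0 := by
    rw [cylDz, (isFormHom_cylEval _).map_d, cylEval_cylZ, TensorProduct.zero_tmul, map_zero]
  have hsq : ∀ q : ℤ, (-1 : k) ^ q * (-1 : k) ^ q = 1 := by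
    intro q; rw [sign_mul, sign_congr (b := 0) (by simp), zpow_zero]
  have hne : ∀ a : ℕ, (a + 1 : k) ≠ 0 := fun a => by exact_mod_cast Nat.succ_ne_zero a
  induction x using cyl_induction with
  | hadd x y h1 h2 =>
    simp only [map_add]
    rw [add_add_add_comm, h1, h2]
    abel
  | hz p β hβ a =>
    have hβ' := (isFormHom_cylIncl m).map_deg hβ
    rw [cylPrim_z, map_zero, zero_add, omegaD_mul hβ', map_add, ← (isFormHom_cylIncl m).map_d,
      cylPrim_z, zero_add]
    rcases a with _ | a
    · rw [pow_zero, omegaD_one, mul_zero, smul_zero, map_zero, mul_one, cylEval_cylIncl, sub_self]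
    · rw [omegaD_cylZ_pow, mul_smul_comm, map_smul, map_smul, cylPrim_dz hβ, map_mul, hZ0,
        mul_zero, map_zero, sub_zero, smul_smul, smul_smul]
      have : (-1 : k) ^ p * (a + 1) * ((-1 : k) ^ p * (a + 1 : k)⁻¹) = 1 := by
        rw [mul_mul_mul_comm, hsq, one_mul, mul_inv_cancel₀ (hne a)]
      rw [this, one_smul]
  | hdz p β hβ a =>
    have hβ' := (isFormHom_cylIncl m).map_deg hβ
    have hd : omegaD (m + 1) (cylZ k m ^ a * cylDz k m) = 0 := by
      rw [omegaD_mul (cylZ_pow_mem m a), cylDz, omegaD_omegaD, mul_zero, smul_zero, add_zero]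
      rcases a with _ | a
      · rw [pow_zero, omegaD_one, zero_mul]
      · rw [omegaD_cylZ_pow, smul_mul_assoc, mul_assoc, ← cylDz, one_form_sq (cylDz_mem m),
          mul_zero, smul_zero]
    rw [cylPrim_dz hβ, omegaD_mul hβ', hd, mul_zero, smul_zero, add_zero,
      ← (isFormHom_cylIncl m).map_d, cylPrim_dz (omegaD_mem hβ), map_smul, omegaD_mul hβ',
      ← (isFormHom_cylIncl m).map_d, omegaD_cylZ_pow, map_mul (cylEval _), map_mul (cylEval _), hD0, mul_zero, mul_zero,
      map_zero, sub_zero, smul_add, mul_smul_comm, smul_smul, smul_smul]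
    have h1 : (-1 : k) ^ p * (a + 1 : k)⁻¹ * ((-1) ^ p * (a + 1)) = 1 := by
      rw [mul_mul_mul_comm, hsq, one_mul, inv_mul_cancel₀ (hne a)]
    rw [← mul_assoc] at h1
    have h2 : (-1 : k) ^ (p + 1) * (a + 1 : k)⁻¹ = - ((-1 : k) ^ p * (a + 1 : k)⁻¹) := by
      rw [zpow_add_one₀ (by simp)]; ring
    have h3 : ∀ (c : k) (w : Omega k (m + 1)), (-c) • w = - (c • w) := fun c w => neg_smul c w
    rw [h2, h3, h1, one_smul]
    abel

variable (k) in
/-- The pullback along a map of simplices, extended to `Ω[z, dz]` by `z ↦ z`. -/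
def cylMap {m n : ℕ} (θ : Fin (m + 1) → Fin (n + 1)) : Omega k (n + 1) →ₐ[k] Omega k (m + 1) :=
  formHom (Fin.snoc (α := fun _ => MvPolynomial (Fin (m + 1)) k)
    (fun i => MvPolynomial.rename Fin.castSucc (polyPullback k θ (MvPolynomial.X i)))
    (MvPolynomial.X (Fin.last m)))

theorem isFormHom_cylMap {m n : ℕ} (θ : Fin (m + 1) → Fin (n + 1)) :
    IsFormHom (cylMap k θ) := isFormHom_formHom _

theorem cylMap_cylZ {m n : ℕ} (θ : Fin (m + 1) → Fin (n + 1)) :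
    cylMap k θ (cylZ k n) = cylZ k m := by
  rw [cylMap, cylZ, formHom_X]; simp [cylZ]

theorem cylMap_cylDz {m n : ℕ} (θ : Fin (m + 1) → Fin (n + 1)) :
    cylMap k θ (cylDz k n) = cylDz k m := by
  rw [cylDz, (isFormHom_cylMap θ).map_d, cylMap_cylZ, cylDz]

theorem cylIncl_poly {m : ℕ} (f : MvPolynomial (Fin m) k) :
    cylIncl k m (f ⊗ₜ[k] 1) = MvPolynomial.rename Fin.castSucc f ⊗ₜ[k] 1 := by
  rw [cylIncl_tmul, map_one]

theorem cylMap_cylIncl {m n : ℕ} (θ : Fin (m + 1) → Fin (n + 1)) (x : Omega k n) :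
    cylMap k θ (cylIncl k n x) = cylIncl k m (omegaPullback k θ x) := by
  have : (cylMap k θ).comp (cylIncl k n) = (cylIncl k m).comp (omegaPullback k θ) := by
    refine ((isFormHom_cylMap θ).comp (isFormHom_cylIncl n)).ext
      ((isFormHom_cylIncl m).comp (isFormHom_omegaPullback θ)) fun i => ?_
    rw [AlgHom.comp_apply, AlgHom.comp_apply, omegaPullback_poly, cylIncl_poly, cylIncl_poly,
      MvPolynomial.rename_X, cylMap, formHom_X]
    simp
  exact congrArg (fun F => F x) this

/-- `cylMap` fixes z and dz and acts only on the base, while the primitive is taken in the fibre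
direction. -/
theorem cylMap_cylPrim {m n : ℕ} (θ : Fin (m + 1) → Fin (n + 1)) (x : Omega k (n + 1)) :
    cylMap k θ (cylPrim n x) = cylPrim m (cylMap k θ x) := by
  induction x using cyl_induction with
  | hadd x y h1 h2 => simp only [map_add, h1, h2]
  | hz p β hβ a =>
    rw [cylPrim_z, map_mul, map_pow, cylMap_cylZ, cylMap_cylIncl, cylPrim_z, map_zero]
  | hdz p β hβ a =>
    rw [cylPrim_dz hβ, map_smul, map_mul (cylMap k θ), map_mul (cylMap k θ),
      map_mul (cylMap k θ), map_pow, map_pow, cylMap_cylZ,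
      cylMap_cylDz, cylMap_cylIncl, cylPrim_dz (omegaPullback_mem θ hβ)]

end CylPrim

/-! ### Integration along the fibres of a degeneracy -/

section FibreIntegral

variable {k : Type u} [Field k]

variable (k) in
/-- The sum `tᵣ + ⋯ + tₙ` of barycentric coordinates. -/
def cum (n r : ℕ) : MvPolynomial (Fin n) k := ∑ j : Fin (n + 1) with r ≤ j.val, bary k n j

theorem cum_zero (n : ℕ) : cum k n 0 = 1 := by simp [cum, sum_bary]

theorem cum_of_lt {n r : ℕ} (h : n < r) : cum k n r = 0 := by
  rw [cum, Finset.filter_false_of_mem (fun j _ => by have := j.2; omega), Finset.sum_empty]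

theorem bary_add_cum (n : ℕ) (j : Fin (n + 1)) : bary k n j + cum k n (j + 1) = cum k n j := by
  have : Finset.univ.filter (fun i : Fin (n + 1) => j.val ≤ i.val) =
      insert j (Finset.univ.filter fun i : Fin (n + 1) => j.val + 1 ≤ i.val) := by
    ext i
    simp only [Finset.mem_filter, Finset.mem_univ, true_and, Finset.mem_insert, Fin.ext_iff]
    omega
  rw [cum, cum, this, Finset.sum_insert (by simp)]

theorem X_eq_cum {n : ℕ} (i : Fin n) :
    (MvPolynomial.X i : MvPolynomial (Fin n) k) = cum k n (i + 1) - cum k n (i + 2) := by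
  have := bary_add_cum (k := k) n i.succ
  rw [eq_sub_iff_add_eq]
  simpa [bary] using this

theorem IsFormHom.ext_cum {m n : ℕ} {F G : Omega k n →ₐ[k] Omega k m} (hF : IsFormHom F)
    (hG : IsFormHom G)
    (h : ∀ r, 1 ≤ r → r ≤ n → F (cum k n r ⊗ₜ[k] 1) = G (cum k n r ⊗ₜ[k] 1)) : F = G := by
  have h' : ∀ r, 1 ≤ r → F (cum k n r ⊗ₜ[k] 1) = G (cum k n r ⊗ₜ[k] 1) := by
    intro r hr
    by_cases hrn : r ≤ n
    · exact h r hr hrn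
    · rw [cum_of_lt (by omega), TensorProduct.zero_tmul, map_zero, map_zero]
  refine hF.ext hG fun i => ?_
  rw [X_eq_cum, TensorProduct.sub_tmul, map_sub, map_sub, h' _ (by omega), h' _ (by omega)]

/-- This is the reason for working with partial sums of barycentric coordinates: a monotone map
pulls an upper set of vertices back to an upper set, hence a partial sum to a single partial sum,
whereas a barycentric coordinate becomes a sum over a fibre. -/
theorem omegaPullback_cum {m n : ℕ} (θ : Fin (m + 1) → Fin (n + 1)) {r r' : ℕ}
    (h : ∀ i, r ≤ (θ i).val ↔ r' ≤ i.val) :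
    omegaPullback k θ (cum k n r ⊗ₜ[k] 1) = cum k m r' ⊗ₜ[k] 1 := by
  rw [omegaPullback_poly]
  congr 1
  rw [cum, map_sum]
  simp only [polyPullback_bary]
  rw [cum, ← Finset.sum_fiberwise_of_maps_to
    (s := Finset.univ.filter fun j : Fin (m + 1) => r' ≤ j.val)
    (t := Finset.univ.filter fun a : Fin (n + 1) => r ≤ a.val) (g := θ) (by simp [h])]
  refine Finset.sum_congr rfl fun a ha => Finset.sum_congr ?_ fun _ _ => rfl
  ext j
  simp only [Finset.mem_filter, Finset.mem_univ, true_and] at ha ⊢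
  constructor
  · rintro rfl; exact ⟨(h j).mp ha, rfl⟩
  · exact fun h => h.2

variable [CharZero k]

/-- The affine map of forms with `tᵣ + ⋯ + tₙ ↦ g r`. -/
def cumHom {m n : ℕ} (g : ℕ → MvPolynomial (Fin m) k) : Omega k n →ₐ[k] Omega k m :=
  formHom fun i => g (i + 1) - g (i + 2)

/-- `cumHom` is prescribed on the coordinates as successive differences of g, so the values on
partial sums follow by descending from r = n + 1, where the sum is empty; hence the normalisation `g
(n + 1) = 0`. -/
theorem cumHom_cum {m n : ℕ} (g : ℕ → MvPolynomial (Fin m) k) (hg : g (n + 1) = 0) {r : ℕ}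
    (h1 : 1 ≤ r) (h2 : r ≤ n + 1) : cumHom g (cum k n r ⊗ₜ[k] 1) = g r ⊗ₜ[k] 1 := by
  induction h2 using Nat.decreasingInduction with
  | self => rw [cum_of_lt (by omega), hg, TensorProduct.zero_tmul, TensorProduct.zero_tmul,
      map_zero]
  | of_succ r hr ih =>
    obtain ⟨i, rfl⟩ : ∃ i, r = i + 1 := ⟨r - 1, by omega⟩
    have e : cum k n (i + 1) =
        MvPolynomial.X (⟨i, by omega⟩ : Fin n) + cum k n (i + 1 + 1) := by
      rw [X_eq_cum]; simp
    rw [e, TensorProduct.add_tmul, map_add, ih (by omega), cumHom, formHom_X,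
      ← TensorProduct.add_tmul]
    simp

variable (k) in
/-- The sums `tᵣ + ⋯ + tₘ₊₁` of barycentric coordinates on the simplex `Δᵐ⁺¹`, seen as functions on
`Δᵐ × 𝔸¹`, where the last vertex map collapses the vertices `l` and `l + 1`. -/
def shiftCum (m l r : ℕ) : MvPolynomial (Fin (m + 1)) k :=
  if r ≤ l then MvPolynomial.rename Fin.castSucc (cum k m r)
  else if r = l + 1 then MvPolynomial.X (Fin.last m)
  else MvPolynomial.rename Fin.castSucc (cum k m (r - 1))

variable (k) in
/-- The identification of the forms on `Δᵐ⁺¹` with `Ω(Δᵐ)[z, dz]`, where `Δᵐ⁺¹` is fibred over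
`Δᵐ` by the map which collapses the vertices `l` and `l + 1`. -/
def cylShift (m l : ℕ) : Omega k (m + 1) →ₐ[k] Omega k (m + 1) := cumHom (shiftCum k m l)

theorem isFormHom_cylShift (m l : ℕ) : IsFormHom (cylShift k m l) := isFormHom_formHom _

theorem cylShift_cum {m l r : ℕ} (hl : l ≤ m) (h1 : 1 ≤ r) (h2 : r ≤ m + 2) :
    cylShift k m l (cum k (m + 1) r ⊗ₜ[k] 1) = shiftCum k m l r ⊗ₜ[k] 1 := by
  refine cumHom_cum _ ?_ h1 h2
  rw [shiftCum, if_neg (by omega), if_neg (by omega), cum_of_lt (by omega), map_zero]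

theorem cylEval_shiftCum (m l r : ℕ) (a : MvPolynomial (Fin m) k) :
    cylEval a (shiftCum k m l r ⊗ₜ[k] 1) =
      (if r ≤ l then cum k m r else if r = l + 1 then a else cum k m (r - 1)) ⊗ₜ[k] 1 := by
  rw [shiftCum]
  split_ifs
  · rw [← cylIncl_poly, cylEval_cylIncl]
  · exact cylEval_cylZ a
  · rw [← cylIncl_poly, cylEval_cylIncl]

/-- In these coordinates z is the sum of the barycentric coordinates of index > l. Over a point of
the base it reaches the upper end of its range when the l-th coordinate vanishes, which is the face
omitting the vertex l. -/
theorem cylEval_cylShift_left {m : ℕ} (l : Fin (m + 1)) (x : Omega k (m + 1)) :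
    cylEval (cum k m l) (cylShift k m l x) = omegaPullback k l.castSucc.succAbove x := by
  have : (cylEval (cum k m l)).comp (cylShift k m l) = omegaPullback k l.castSucc.succAbove := by
    refine ((isFormHom_cylEval _).comp (isFormHom_cylShift m l)).ext_cum
      (isFormHom_omegaPullback _) fun r h1 h2 => ?_
    rw [AlgHom.comp_apply, cylShift_cum (by omega) h1 (by omega), cylEval_shiftCum,
      omegaPullback_cum (r' := if r ≤ l then r else r - 1)]
    · split_ifs with h3 h4
      · rfl
      · rw [h4]; rfl
      · rfl
    · intro i
      simp only [Fin.succAbove, Fin.lt_def, Fin.val_castSucc]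
      split_ifs <;> simp <;> omega
  exact congrArg (fun F => F x) this

/-- At the lower end of the range of z the coordinate of index l + 1 vanishes, which is the face
omitting the vertex l + 1. -/
theorem cylEval_cylShift_right {m : ℕ} (l : Fin (m + 1)) (x : Omega k (m + 1)) :
    cylEval (cum k m (l + 1)) (cylShift k m l x) = omegaPullback k l.succ.succAbove x := by
  have : (cylEval (cum k m (l + 1))).comp (cylShift k m l) =
      omegaPullback k l.succ.succAbove := by
    refine ((isFormHom_cylEval _).comp (isFormHom_cylShift m l)).ext_cum
      (isFormHom_omegaPullback _) fun r h1 h2 => ?_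
    rw [AlgHom.comp_apply, cylShift_cum (by omega) h1 (by omega), cylEval_shiftCum,
      omegaPullback_cum (r' := if r ≤ l + 1 then r else r - 1)]
    · split_ifs with h3 h4 h5 h6
      · rfl
      · omega
      · rw [h5]
      · omega
      · omega
      · rfl
    · intro i
      simp only [Fin.succAbove, Fin.lt_def, Fin.val_castSucc, Fin.val_succ]
      split_ifs <;> simp <;> omega
  exact congrArg (fun F => F x) this

/-- In the coordinates (base, z) the degeneracy is the projection to the base. -/
theorem cylShift_degeneracy {m : ℕ} (l : Fin (m + 1)) (x : Omega k m) :
    cylShift k m l (omegaPullback k l.predAbove x) = cylIncl k m x := by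
  have : (cylShift k m l).comp (omegaPullback k l.predAbove) = cylIncl k m := by
    refine ((isFormHom_cylShift m l).comp (isFormHom_omegaPullback _)).ext_cum
      (isFormHom_cylIncl m) fun r h1 h2 => ?_
    have hpa : ∀ i : Fin (m + 2), (l.predAbove i).val =
        if i.val ≤ l.val then i.val else i.val - 1 := by
      intro i
      simp only [Fin.predAbove, Fin.lt_def, Fin.val_castSucc]
      split_ifs <;> simp <;> omega
    by_cases h : r ≤ l
    · rw [AlgHom.comp_apply, omegaPullback_cum (r' := r), cylShift_cum (by omega) h1 (by omega),
        shiftCum, if_pos h, cylIncl_poly]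
      intro i
      rw [hpa]
      split_ifs <;> omega
    · rw [AlgHom.comp_apply, omegaPullback_cum (r' := r + 1),
        cylShift_cum (by omega) (by omega) (by omega), shiftCum, if_neg (by omega),
        if_neg (by omega), cylIncl_poly]
      · rfl
      · intro i
        rw [hpa]
        split_ifs <;> omega
  exact congrArg (fun F => F x) this

/-- The map of simplices induced by `θ` on the `p`-th simplices of the prisms. -/
def prismMap {m n : ℕ} (θ : Fin (m + 1) → Fin (n + 1)) (p : Fin (m + 1)) (t : Fin (m + 2)) :
    Fin (n + 2) :=
  if t ≤ p.castSucc then (θ (p.predAbove t)).castSucc else (θ (p.predAbove t)).succ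

/-- The preimage of an upper set under a monotone map is an upper set. The value m + 1 stands for
the empty preimage. -/
theorem exists_threshold {m n : ℕ} {θ : Fin (m + 1) → Fin (n + 1)} (hθ : Monotone θ) (r : ℕ) :
    ∃ r' ≤ m + 1, ∀ i, r ≤ (θ i).val ↔ r' ≤ i.val := by
  classical
  have hex : ∃ r', ∀ i : Fin (m + 1), r' ≤ i.val → r ≤ (θ i).val :=
    ⟨m + 1, fun i hi => by have := i.2; omega⟩
  refine ⟨Nat.find hex, Nat.find_le fun i hi => by have := i.2; omega, fun i => ⟨fun h => ?_,
    fun h => Nat.find_spec hex i h⟩⟩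
  exact Nat.find_le fun j hj => h.trans (hθ hj)

/-- In the coordinates (base, z) of the two simplices, `prismMap θ p` is θ times the identity of the
z-line. Compared on partial sums: for r ≤ θ p and for r ≥ θ p + 2 both sides come from the base, and
for r = θ p + 1 both are z. -/
theorem cylMap_cylShift {m n : ℕ} {θ : Fin (m + 1) → Fin (n + 1)} (hθ : Monotone θ)
    (p : Fin (m + 1)) (x : Omega k (n + 1)) :
    cylMap k θ (cylShift k n (θ p) x) = cylShift k m p (omegaPullback k (prismMap θ p) x) := by
  have : (cylMap k θ).comp (cylShift k n (θ p)) =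
      (cylShift k m p).comp (omegaPullback k (prismMap θ p)) := by
    refine ((isFormHom_cylMap θ).comp (isFormHom_cylShift n (θ p))).ext_cum
      ((isFormHom_cylShift m p).comp (isFormHom_omegaPullback _)) fun r h1 h2 => ?_
    rw [AlgHom.comp_apply, AlgHom.comp_apply, cylShift_cum (by omega) h1 (by omega)]
    have hp := (θ p).2
    have hval : ∀ t : Fin (m + 2), (prismMap θ p t).val = if h : t.val ≤ p.val then
        (θ ⟨t.val, by omega⟩).val else (θ ⟨t.val - 1, by omega⟩).val + 1 := by
      intro t
      simp only [prismMap, Fin.le_def, Fin.val_castSucc]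
      have hpa : p.predAbove t = if h : t.val ≤ p.val then ⟨t.val, by omega⟩
          else ⟨t.val - 1, by omega⟩ := by
        ext
        simp only [Fin.predAbove, Fin.lt_def, Fin.val_castSucc]
        split_ifs <;> simp <;> omega
      split_ifs with h <;> simp [hpa, h]
    have hmono : ∀ (a b : ℕ) (ha : a < m + 1) (hb : b < m + 1), a ≤ b →
        (θ ⟨a, ha⟩).val ≤ (θ ⟨b, hb⟩).val := fun a b ha hb hab => hθ hab
    rcases lt_trichotomy r ((θ p).val + 1) with h | h | h
    · obtain ⟨r', hr', hr⟩ := exists_threshold hθ r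
      have hrp : r' ≤ p.val := (hr p).mp (by omega)
      have hr0 : ∀ i, (hi : i < m + 1) → (r ≤ (θ ⟨i, hi⟩).val ↔ r' ≤ i) := fun i hi => hr ⟨i, hi⟩
      -- When the threshold is 0 the pulled back partial sum is the full sum 1; this case is
      -- separate because `cylShift_cum` concerns positive indices.
      rcases Nat.eq_zero_or_pos r' with h0 | h0
      · rw [omegaPullback_cum (r' := r')]
        · subst h0
          rw [shiftCum, if_pos (by omega), ← cylIncl_poly, cylMap_cylIncl, omegaPullback_cum _ hr,
            cum_zero, cum_zero]
          simp [← Algebra.TensorProduct.one_def]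
        · intro i
          rw [hval]
          split_ifs with h3
          · exact hr0 _ _
          · have := hr0 (i - 1) (by omega); omega
      · rw [omegaPullback_cum (r' := r'), cylShift_cum (by omega) h0 (by omega), shiftCum,
          if_pos (by omega), shiftCum, if_pos hrp, ← cylIncl_poly, cylMap_cylIncl,
          omegaPullback_cum _ hr, cylIncl_poly]
        intro i
        rw [hval]
        split_ifs with h3
        · exact hr0 _ _
        · have := hr0 (i - 1) (by omega); omega
    · subst h
      rw [omegaPullback_cum (r' := p.val + 1), cylShift_cum (by omega) (by omega) (by omega),
        shiftCum, if_neg (by omega), if_pos rfl, shiftCum, if_neg (by omega), if_pos rfl]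
      · exact cylMap_cylZ θ
      · intro i
        rw [hval]
        split_ifs with h3
        · have := hmono i p (by omega) p.2 h3
          simp only [Fin.eta] at this
          omega
        · have := hmono p (i - 1) p.2 (by omega) (by omega)
          simp only [Fin.eta] at this
          omega
    · obtain ⟨r', hr', hr⟩ := exists_threshold hθ (r - 1)
      have hrp : ¬ r' ≤ p.val := fun h' => by have := (hr p).mpr h'; omega
      have hr0 : ∀ i, (hi : i < m + 1) → (r - 1 ≤ (θ ⟨i, hi⟩).val ↔ r' ≤ i) :=
        fun i hi => hr ⟨i, hi⟩
      rw [omegaPullback_cum (r' := r' + 1), cylShift_cum (by omega) (by omega) (by omega),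
        shiftCum, if_neg (by omega), if_neg (by omega), shiftCum, if_neg (by omega),
        if_neg (by omega), ← cylIncl_poly, cylMap_cylIncl, omegaPullback_cum _ hr, cylIncl_poly]
      · rfl
      · intro i
        rw [hval]
        split_ifs with h3
        · have := hmono i p (by omega) p.2 h3
          simp only [Fin.eta] at this
          omega
        · have := hr0 (i - 1) (by omega); omega
  exact congrArg (fun F => F x) this

theorem omegaPullback_cylEval {m n : ℕ} (θ : Fin (m + 1) → Fin (n + 1)) {r r' : ℕ}
    (h : ∀ i, r ≤ (θ i).val ↔ r' ≤ i.val) (x : Omega k (n + 1)) :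
    omegaPullback k θ (cylEval (cum k n r) x) = cylEval (cum k m r') (cylMap k θ x) := by
  have : (omegaPullback k θ).comp (cylEval (cum k n r)) =
      (cylEval (cum k m r')).comp (cylMap k θ) := by
    refine ((isFormHom_omegaPullback θ).comp (isFormHom_cylEval _)).ext
      ((isFormHom_cylEval _).comp (isFormHom_cylMap θ)) fun i => ?_
    refine Fin.lastCases ?_ (fun i => ?_) i
    · have h1 := cylEval_cylZ (cum k n r)
      have h2 := cylMap_cylZ (k := k) θ
      have h3 := cylEval_cylZ (cum k m r')
      rw [cylZ] at h1 h2
      rw [AlgHom.comp_apply, AlgHom.comp_apply, h1, h2, h3, omegaPullback_cum θ h]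
    · have h1 := cylIncl_poly (MvPolynomial.X i : MvPolynomial (Fin n) k)
      rw [MvPolynomial.rename_X] at h1
      rw [AlgHom.comp_apply, AlgHom.comp_apply, ← h1, cylEval_cylIncl, cylMap_cylIncl,
        cylEval_cylIncl]
  exact congrArg (fun F => F x) this

/-- The integral of forms along the fibres of the map `Δᵐ⁺¹ → Δᵐ` which collapses the vertices `l`
and `l + 1`. -/
def fibreInt {m : ℕ} (l : Fin (m + 1)) : Omega k (m + 1) →ₗ[k] Omega k m :=
  ((cylEval (cum k m l)).toLinearMap - (cylEval (cum k m (l + 1))).toLinearMap) ∘ₗ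
    cylPrim m ∘ₗ (cylShift k m l).toLinearMap

theorem fibreInt_apply {m : ℕ} (l : Fin (m + 1)) (x : Omega k (m + 1)) :
    fibreInt l x = cylEval (cum k m l) (cylPrim m (cylShift k m l x)) -
      cylEval (cum k m (l + 1)) (cylPrim m (cylShift k m l x)) := rfl

theorem fibreInt_mem {m : ℕ} (l : Fin (m + 1)) {q : ℤ} {x : Omega k (m + 1)}
    (hx : x ∈ omegaDeg k (m + 1) q) : fibreInt l x ∈ omegaDeg k m (q - 1) := by
  have := cylPrim_mem ((isFormHom_cylShift m l).map_deg hx)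
  exact sub_mem ((isFormHom_cylEval _).map_deg this) ((isFormHom_cylEval _).map_deg this)

/-- In the formula on the cylinder the term that comes from the base is the same at both ends of the
fibre and cancels in the difference. What remains are the boundary values, which are the
restrictions to the two faces. -/
theorem fibreInt_stokes {m : ℕ} (l : Fin (m + 1)) (x : Omega k (m + 1)) :
    omegaD m (fibreInt l x) + fibreInt l (omegaD (m + 1) x) =
      omegaPullback k l.castSucc.succAbove x - omegaPullback k l.succ.succAbove x := by
  have h := cylPrim_stokes (cylShift k m l x)
  have h1 := congrArg (cylEval (cum k m l)) h
  have h2 := congrArg (cylEval (cum k m (l + 1))) h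
  rw [map_add, map_sub, cylEval_cylIncl, cylEval_cylShift_left] at h1
  rw [map_add, map_sub, cylEval_cylIncl, cylEval_cylShift_right] at h2
  rw [fibreInt_apply, fibreInt_apply, map_sub, ← (isFormHom_cylEval _).map_d,
    ← (isFormHom_cylEval _).map_d, (isFormHom_cylShift m l).map_d]
  rw [sub_add_sub_comm, h1, h2]
  abel

/-- The projection formula. -/
theorem fibreInt_mul {m : ℕ} (l : Fin (m + 1)) {q : ℤ} {α : Omega k m} (hα : α ∈ omegaDeg k m q)
    (x : Omega k (m + 1)) : fibreInt l (omegaPullback k l.predAbove α * x) =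
      (-1 : k) ^ q • (α * fibreInt l x) := by
  rw [fibreInt_apply, fibreInt_apply, map_mul, cylShift_degeneracy, cylPrim_incl_mul hα, map_smul,
    map_smul, map_mul, map_mul, cylEval_cylIncl, cylEval_cylIncl, mul_sub, smul_sub]

/-- The end points of the fibre interval for l pull back to the partial sums at r and s, where r, …,
s - 1 are the vertices in the fibre of θ over l. The intermediate partial sums subdivide this
interval into the fibre intervals of these vertices, so the integral is a telescoping sum. A fibre
integral thus becomes a sum, which is empty when l is not in the image of θ. -/
theorem omegaPullback_fibreInt {m n : ℕ} {θ : Fin (m + 1) → Fin (n + 1)} (hθ : Monotone θ)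
    (l : Fin (n + 1)) (x : Omega k (n + 1)) :
    omegaPullback k θ (fibreInt l x) =
      ∑ p with θ p = l, fibreInt p (omegaPullback k (prismMap θ p) x) := by
  obtain ⟨r, hr', hr⟩ := exists_threshold hθ l
  obtain ⟨s, hs', hs⟩ := exists_threshold hθ (l + 1)
  set y := cylPrim m (cylMap k θ (cylShift k n l x)) with hy
  have e : ∀ p : Fin (m + 1), θ p = l → fibreInt p (omegaPullback k (prismMap θ p) x) =
      cylEval (cum k m p) y - cylEval (cum k m (p + 1)) y := by
    rintro p rfl
    rw [hy, cylMap_cylShift hθ, fibreInt_apply]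
  rw [Finset.sum_congr rfl fun p hp => e p (by simpa using hp), fibreInt_apply, map_sub,
    omegaPullback_cylEval θ hr, omegaPullback_cylEval θ hs, cylMap_cylPrim, ← hy]
  have hrs : r ≤ s := by
    by_contra hlt
    have h1 := hs ⟨s, by omega⟩
    have h2 := hr ⟨s, by omega⟩
    simp only [le_refl, iff_true] at h1 h2
    omega
  -- The fibre of a monotone map is an interval, here bounded by the two thresholds.
  have hset : (Finset.univ.filter fun p : Fin (m + 1) => θ p = l).map Fin.valEmbedding =
      Finset.Ico r s := by
    ext a
    simp only [Finset.mem_map, Finset.mem_filter, Finset.mem_univ, true_and, Finset.mem_Ico,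
      Fin.valEmbedding_apply]
    constructor
    · rintro ⟨p, rfl, rfl⟩
      have h1 := hr p
      have h2 := hs p
      omega
    · rintro ⟨h1, h2⟩
      refine ⟨⟨a, by omega⟩, ?_, rfl⟩
      have h3 := hr ⟨a, by omega⟩
      have h4 := hs ⟨a, by omega⟩
      ext
      simp only at h3 h4
      omega
  have hsum := Finset.sum_map (Finset.univ.filter fun p : Fin (m + 1) => θ p = l)
    Fin.valEmbedding (fun p => cylEval (cum k m p) y - cylEval (cum k m (p + 1)) y)
  rw [hset] at hsum
  refine Eq.trans ?_ hsum
  rw [← neg_inj, ← Finset.sum_neg_distrib]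
  simp only [neg_sub]
  rw [Finset.sum_Ico_sub (fun p => cylEval (cum k m p) y) hrs]

end FibreIntegral

/-! ### Subalgebras of products of differential P₀-algebras -/

section Decomposition

variable {k : Type u} [Field k] {M : Type u} [AddCommGroup M] [Module k M]

/-- A family of spanning submodules with a family of projections is a grading. -/
abbrev decompositionOfProj (ℳ : ℤ → Submodule k M) (π : ℤ → M →ₗ[k] M)
    (h_self : ∀ p, ∀ x ∈ ℳ p, π p x = x) (h_ne : ∀ p q, q ≠ p → ∀ x ∈ ℳ q, π p x = 0)
    (h_top : ⨆ p, ℳ p = ⊤) : DirectSum.Decomposition ℳ :=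
  DirectSum.IsInternal.chooseDecomposition ℳ (by
    rw [DirectSum.isInternal_submodule_iff_iSupIndep_and_iSup_eq_top]
    refine ⟨iSupIndep_def.mpr fun p => ?_, h_top⟩
    rw [Submodule.disjoint_def]
    intro x hx hx'
    have : ⨆ j, ⨆ (_ : j ≠ p), ℳ j ≤ LinearMap.ker (π p) :=
      iSup₂_le fun q hq y hy => h_ne p q hq y hy
    rw [← h_self p x hx]
    exact this hx')

end Decomposition

section GradedSub

variable {k : Type u} [Field k]

theorem proj_self (A : DGP0Alg k) {p : ℤ} {a : A.carrier} (ha : a ∈ A.deg p) :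
    GradedAlgebra.proj A.deg p a = a := by
  rw [GradedAlgebra.proj_apply, DirectSum.decompose_of_mem_same _ ha]

theorem proj_ne (A : DGP0Alg k) {p q : ℤ} (h : q ≠ p) {a : A.carrier} (ha : a ∈ A.deg q) :
    GradedAlgebra.proj A.deg p a = 0 := by
  rw [GradedAlgebra.proj_apply, DirectSum.decompose_of_mem_ne _ ha h]

/-- A graded subalgebra of a product of differential `P₀`-algebras, closed under the brackets and
the differential. -/
structure GradedSub {ι : Type u} (A : ι → DGP0Alg k) where
  S : ℤ → Submodule k (∀ i, (A i).carrier)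
  mem_deg : ∀ {p : ℤ} {x}, x ∈ S p → ∀ i, x i ∈ (A i).deg p
  one_mem : 1 ∈ S 0
  mul_mem : ∀ {p q : ℤ} {x y}, x ∈ S p → y ∈ S q → x * y ∈ S (p + q)
  bracket_mem : ∀ {p q : ℤ} {x y}, x ∈ S p → y ∈ S q →
    (fun i => (A i).bracket (x i) (y i)) ∈ S (p + q + 1)
  d_mem : ∀ {p : ℤ} {x}, x ∈ S p → (fun i => (A i).d (x i)) ∈ S (p + 1)

namespace GradedSub

variable {ι : Type u} {A : ι → DGP0Alg k} (T : GradedSub A)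

/-- The differential of a product. -/
def piD (A : ι → DGP0Alg k) : (∀ i, (A i).carrier) →ₗ[k] ∀ i, (A i).carrier :=
  LinearMap.pi fun i => (A i).d ∘ₗ LinearMap.proj i

/-- The bracket of a product. -/
def piBracket (A : ι → DGP0Alg k) :
    (∀ i, (A i).carrier) →ₗ[k] (∀ i, (A i).carrier) →ₗ[k] ∀ i, (A i).carrier :=
  LinearMap.mk₂ k (fun x y i => (A i).bracket (x i) (y i))
    (fun _ _ _ => funext fun i => by simp) (fun _ _ _ => funext fun i => by simp)
    (fun _ _ _ => funext fun i => by simp) (fun _ _ _ => funext fun i => by simp)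

/-- The projection of a product to the component of degree `p`. -/
def piProj (A : ι → DGP0Alg k) (p : ℤ) : (∀ i, (A i).carrier) →ₗ[k] ∀ i, (A i).carrier :=
  LinearMap.pi fun i => GradedAlgebra.proj (A i).deg p ∘ₗ LinearMap.proj i

theorem bilin_mem (B : (∀ i, (A i).carrier) →ₗ[k] (∀ i, (A i).carrier) →ₗ[k] ∀ i, (A i).carrier)
    (h : ∀ p q, ∀ x ∈ T.S p, ∀ y ∈ T.S q, B x y ∈ ⨆ p, T.S p) {x y} (hx : x ∈ ⨆ p, T.S p)
    (hy : y ∈ ⨆ p, T.S p) : B x y ∈ ⨆ p, T.S p := by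
  refine Submodule.iSup_induction T.S (motive := fun x => B x y ∈ ⨆ p, T.S p) hx ?_ ?_ ?_
  · intro p x hx
    refine Submodule.iSup_induction T.S (motive := fun y => B x y ∈ ⨆ p, T.S p) hy ?_ ?_ ?_
    · exact fun q y hy => h p q x hx y hy
    · rw [map_zero]; exact zero_mem _
    · intro y z h1 h2; rw [map_add]; exact add_mem h1 h2
  · rw [map_zero]; exact zero_mem _
  · intro y z h1 h2; rw [map_add]; exact add_mem h1 h2

/-- The sum of the homogeneous components. -/
def subalg : Subalgebra k (∀ i, (A i).carrier) :=
  -- An infinite product of graded algebras is in general larger than the sum of its homogeneous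
  -- parts. The algebra consists of the finite sums of homogeneous families, so that it is graded.
  Submodule.toSubalgebra (⨆ p, T.S p) (Submodule.mem_iSup_of_mem 0 T.one_mem)
    (fun _ _ hx hy => T.bilin_mem (LinearMap.mul k _)
      (fun p q _ hx _ hy => Submodule.mem_iSup_of_mem (p + q) (T.mul_mem hx hy)) hx hy)

theorem le_subalg {p : ℤ} {x} (hx : x ∈ T.S p) : x ∈ T.subalg := Submodule.mem_iSup_of_mem p hx

theorem map_mem (L : (∀ i, (A i).carrier) →ₗ[k] ∀ i, (A i).carrier)
    (h : ∀ p, ∀ x ∈ T.S p, L x ∈ T.subalg) {x} (hx : x ∈ T.subalg) : L x ∈ T.subalg := by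
  refine Submodule.iSup_induction T.S (motive := fun x => L x ∈ T.subalg) hx h ?_ ?_
  · rw [map_zero]; exact zero_mem _
  · intro y z h1 h2; rw [map_add]; exact add_mem h1 h2

/-- The homogeneous components. -/
def deg (p : ℤ) : Submodule k T.subalg := (T.S p).comap T.subalg.val.toLinearMap

theorem piProj_self {p : ℤ} {x} (hx : x ∈ T.S p) : piProj A p x = x :=
  funext fun i => proj_self _ (T.mem_deg hx i)

theorem piProj_ne {p q : ℤ} (h : q ≠ p) {x} (hx : x ∈ T.S q) : piProj A p x = 0 :=
  funext fun i => proj_ne _ h (T.mem_deg hx i)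

instance : GradedAlgebra T.deg :=
  { decompositionOfProj T.deg
      (fun p => ((piProj A p).restrict (p := Subalgebra.toSubmodule T.subalg)
        (q := Subalgebra.toSubmodule T.subalg) fun x hx => T.map_mem _ (fun q x hx => by
          by_cases h : q = p
          · subst h; rw [T.piProj_self hx]; exact T.le_subalg hx
          · rw [T.piProj_ne h hx]; exact zero_mem _) hx))
      (fun p x hx => Subtype.ext (T.piProj_self hx))
      (fun p q h x hx => Subtype.ext (T.piProj_ne h hx))
      (by
        rw [eq_top_iff]
        rintro ⟨x, hx⟩ -
        have : ∀ x ∈ ⨆ p, T.S p, ∃ y ∈ ⨆ p, T.deg p, y.1 = x := by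
          intro x hx
          refine Submodule.iSup_induction T.S
            (motive := fun x => ∃ y ∈ ⨆ p, T.deg p, y.1 = x) hx ?_ ?_ ?_
          · exact fun p x hx => ⟨⟨x, T.le_subalg hx⟩, Submodule.mem_iSup_of_mem p hx, rfl⟩
          · exact ⟨0, zero_mem _, rfl⟩
          · rintro _ _ ⟨y, hy, rfl⟩ ⟨z, hz, rfl⟩
            exact ⟨y + z, add_mem hy hz, rfl⟩
        obtain ⟨y, hy, e⟩ := this x hx
        have : y = ⟨x, hx⟩ := Subtype.ext e
        rwa [← this]) with
    one_mem := T.one_mem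
    mul_mem := fun _ _ _ _ hx hy => T.mul_mem hx hy }

/-- The differential `P₀`-algebra defined by a graded subalgebra of a product. -/
def toAlg : DGP0Alg k where
  carrier := T.subalg
  deg := T.deg
  mul_comm' ha hb := Subtype.ext (funext fun i => (A i).mul_comm' (T.mem_deg ha i) (T.mem_deg hb i))
  bracket := LinearMap.mk₂ k
    (fun x y => (⟨piBracket A x.1 y.1, T.bilin_mem _ (fun p q _ hx _ hy =>
      Submodule.mem_iSup_of_mem (p + q + 1) (T.bracket_mem hx hy)) x.2 y.2⟩ : T.subalg))
    (fun _ _ _ => Subtype.ext (by simp)) (fun _ _ _ => Subtype.ext (by simp))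
    (fun _ _ _ => Subtype.ext (by simp)) (fun _ _ _ => Subtype.ext (by simp))
  bracket_mem ha hb := T.bracket_mem ha hb
  bracket_symm ha hb :=
    Subtype.ext (funext fun i => (A i).bracket_symm (T.mem_deg ha i) (T.mem_deg hb i))
  bracket_mul ha hb hc := Subtype.ext (funext fun i =>
    (A i).bracket_mul (T.mem_deg ha i) (T.mem_deg hb i) (T.mem_deg hc i))
  jacobi ha hb hc := Subtype.ext (funext fun i =>
    (A i).jacobi (T.mem_deg ha i) (T.mem_deg hb i) (T.mem_deg hc i))
  d := (piD A).restrict (p := Subalgebra.toSubmodule T.subalg)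
    (q := Subalgebra.toSubmodule T.subalg) fun _ hx => T.map_mem _ (fun _ _ hx =>
      T.le_subalg (T.d_mem hx)) hx
  d_mem ha := T.d_mem ha
  d_d a := Subtype.ext (funext fun i => (A i).d_d (a.1 i))
  d_mul ha hb := Subtype.ext (funext fun i => (A i).d_mul (T.mem_deg ha i) (T.mem_deg hb i))
  d_bracket ha hb :=
    Subtype.ext (funext fun i => (A i).d_bracket (T.mem_deg ha i) (T.mem_deg hb i))

/-- The projections. -/
def proj (i : ι) : T.toAlg ⟶ A i where
  toAlgHom := (Pi.evalAlgHom k (fun i => (A i).carrier) i).comp T.subalg.val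
  map_deg ha := T.mem_deg ha i
  map_bracket _ _ := rfl
  map_d _ := rfl

/-- The element of degree `p` with given components. -/
def elt {p : ℤ} (x : ∀ i, (A i).carrier) (hx : x ∈ T.S p) : T.toAlg.carrier := ⟨x, T.le_subalg hx⟩

theorem elt_mem {p : ℤ} (x : ∀ i, (A i).carrier) (hx : x ∈ T.S p) :
    T.elt x hx ∈ T.toAlg.deg p := hx

theorem ext {x y : T.toAlg.carrier} (h : ∀ i, (T.proj i).toAlgHom x = (T.proj i).toAlgHom y) :
    x = y := Subtype.ext (funext h)

theorem mem_of_deg {p : ℤ} {x : T.toAlg.carrier} (hx : x ∈ T.toAlg.deg p) :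
    (fun i => (T.proj i).toAlgHom x) ∈ T.S p := hx

/-- Elements are finite sums of homogeneous ones, so an additive property need only be known degree
by degree; the zero element is included among the homogeneous ones. -/
theorem deg_induction (B : DGP0Alg k) {Q : B.carrier → Prop} (h : ∀ p, ∀ x ∈ B.deg p, Q x)
    (hadd : ∀ x y, Q x → Q y → Q (x + y)) (x : B.carrier) : Q x := by
  have hx : x ∈ ⨆ p, B.deg p := by
    rw [(DirectSum.Decomposition.isInternal B.deg).submodule_iSup_eq_top]; trivial
  exact Submodule.iSup_induction B.deg (motive := Q) hx h (h 0 0 (zero_mem _)) hadd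

/-- The morphism to a graded subalgebra of a product with given components. -/
def lift {B : DGP0Alg k} (f : ∀ i, B ⟶ A i)
    (hf : ∀ p, ∀ b ∈ B.deg p, (fun i => (f i).toAlgHom b) ∈ T.S p) : B ⟶ T.toAlg where
  toAlgHom := (AlgHom.pi fun i => (f i).toAlgHom).codRestrict T.subalg
    (fun b => by
      refine deg_induction B (Q := fun b => (AlgHom.pi fun i => (f i).toAlgHom) b ∈ T.subalg)
        ?_ ?_ b
      · exact fun p x hx => T.le_subalg (hf p x hx)
      · intro x y h1 h2; rw [map_add]; exact add_mem h1 h2)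
  map_deg ha := hf _ _ ha
  map_bracket a b := Subtype.ext (funext fun i => (f i).map_bracket a b)
  map_d a := Subtype.ext (funext fun i => (f i).map_d a)

theorem hom_ext {B : DGP0Alg k} {f g : B ⟶ T.toAlg}
    (h : ∀ i, f ≫ T.proj i = g ≫ T.proj i) : f = g :=
  DGP0Alg.hom_ext fun b => T.ext fun i =>
    congrArg (fun φ : B ⟶ A i => φ.toAlgHom b) (h i)

end GradedSub

end GradedSub

/-! ### Direct limits of differential P₀-algebras -/

section Colimit

variable {k : Type u} [Field k] {ι : Type u} [Preorder ι] [IsDirectedOrder ι] [Nonempty ι]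
  (G : ι → DGP0Alg k) (f : ∀ i j, i ≤ j → (G i ⟶ G j))
  [DirectedSystem (fun i => (G i).carrier) (fun i j h => (f i j h).toAlgHom)]

/-- The direct limit of a directed system of differential `P₀`-algebras. -/
abbrev Colim : Type u := DirectLimit (fun i => (G i).carrier) (fun i j h => (f i j h).toAlgHom)

namespace Colim

/-- The canonical map to the direct limit. -/
def of (i : ι) : (G i).carrier →ₐ[k] Colim G f :=
  { DirectLimit.Ring.of (fun i => (G i).carrier) (fun i j h => (f i j h).toAlgHom) i with
    commutes' := fun r => (DirectLimit.algebraMap_def i r).symm }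

variable {G f}

theorem of_map {i j : ι} (h : i ≤ j) (x : (G i).carrier) :
    of G f j ((f i j h).toAlgHom x) = of G f i x :=
  (DirectLimit.eq_of_le (F := fun i => (G i).carrier) (f := fun i j h => (f i j h).toAlgHom)
    ⟨i, x⟩ j h).symm

theorem exists_eq_of (z : Colim G f) : ∃ i x, z = of G f i x := DirectLimit.exists_eq_mk _ z

theorem of_eq_zero {i : ι} {x : (G i).carrier} (h : of G f i x = 0) :
    ∃ j, ∃ hij : i ≤ j, (f i j hij).toAlgHom x = 0 :=
  (DirectLimit.exists_eq_zero (G := fun i => (G i).carrier)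
    (f := fun i j h => (f i j h).toAlgHom) ⟨i, x⟩).mp h

/-- The linear map induced by a compatible family of linear maps. -/
def mapLin (L : ∀ i, (G i).carrier →ₗ[k] (G i).carrier)
    (hL : ∀ i j (h : i ≤ j) x, (f i j h).toAlgHom (L i x) = L j ((f i j h).toAlgHom x)) :
    Colim G f →ₗ[k] Colim G f :=
  DirectLimit.Module.lift k ι _ _ (fun i => (of G f i).toLinearMap ∘ₗ L i) (fun i j h x => by
    change of G f j (L j ((f i j h).toAlgHom x)) = of G f i (L i x)
    rw [← hL, of_map])

theorem mapLin_of (L : ∀ i, (G i).carrier →ₗ[k] (G i).carrier)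
    (hL : ∀ i j (h : i ≤ j) x, (f i j h).toAlgHom (L i x) = L j ((f i j h).toAlgHom x)) (i : ι)
    (x : (G i).carrier) : mapLin L hL (of G f i x) = of G f i (L i x) := rfl

/-- The bracket of the direct limit. -/
def bracket : Colim G f →ₗ[k] Colim G f →ₗ[k] Colim G f :=
  LinearMap.mk₂ k (DirectLimit.map₂ _ _ _ (fun i x y => (G i).bracket x y)
      (fun i j h x y => (f i j h).map_bracket x y))
    (DirectLimit.induction₃ _ fun i x y z => by
      simp only [DirectLimit.add_def, DirectLimit.map₂_def, map_add, LinearMap.add_apply])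
    (fun c => DirectLimit.induction₂ _ fun i x y => by
      simp only [DirectLimit.smul_def, DirectLimit.map₂_def, map_smul, LinearMap.smul_apply])
    (DirectLimit.induction₃ _ fun i x y z => by
      simp only [DirectLimit.add_def, DirectLimit.map₂_def, map_add])
    (fun c => DirectLimit.induction₂ _ fun i x y => by
      simp only [DirectLimit.smul_def, DirectLimit.map₂_def, map_smul])

theorem bracket_of (i : ι) (x y : (G i).carrier) :
    bracket (of G f i x) (of G f i y) = of G f i ((G i).bracket x y) :=
  DirectLimit.map₂_def (F₁ := fun i => (G i).carrier) (F₂ := fun i => (G i).carrier)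
    (F := fun i => (G i).carrier) (f₁ := fun i j h => (f i j h).toAlgHom)
    (f₂ := fun i j h => (f i j h).toAlgHom) (f := fun i j h => (f i j h).toAlgHom)
    (fun i x y => (G i).bracket x y) (fun i j h x y => (f i j h).map_bracket x y) i x y

variable (G f) in
/-- The homogeneous components of the direct limit. -/
def deg (p : ℤ) : Submodule k (Colim G f) where
  carrier := {z | ∃ i, ∃ x ∈ (G i).deg p, z = of G f i x}
  zero_mem' := ⟨Classical.arbitrary ι, 0, zero_mem _, (map_zero _).symm⟩
  add_mem' := by
    rintro _ _ ⟨i, x, hx, rfl⟩ ⟨j, y, hy, rfl⟩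
    obtain ⟨l, h1, h2⟩ := exists_ge_ge i j
    refine ⟨l, _, add_mem ((f i l h1).map_deg hx) ((f j l h2).map_deg hy), ?_⟩
    rw [map_add, of_map, of_map]
  smul_mem' := by
    rintro c _ ⟨i, x, hx, rfl⟩
    exact ⟨i, _, Submodule.smul_mem _ c hx, (map_smul _ _ _).symm⟩

theorem of_mem {i : ι} {p : ℤ} {x : (G i).carrier} (hx : x ∈ (G i).deg p) :
    of G f i x ∈ deg G f p := ⟨i, x, hx, rfl⟩

/-- Morphisms have degree 0. This compatibility lets the projections pass to the direct limit, which
is how its grading is obtained. -/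
theorem proj_map {A B : DGP0Alg k} (φ : A ⟶ B) (p : ℤ) (x : A.carrier) :
    φ.toAlgHom (GradedAlgebra.proj A.deg p x) = GradedAlgebra.proj B.deg p (φ.toAlgHom x) := by
  refine GradedSub.deg_induction A (Q := fun x => φ.toAlgHom (GradedAlgebra.proj A.deg p x) =
    GradedAlgebra.proj B.deg p (φ.toAlgHom x)) ?_ ?_ x
  · intro q x hx
    by_cases h : q = p
    · subst h; rw [proj_self _ hx, proj_self _ (φ.map_deg hx)]
    · rw [proj_ne _ h hx, proj_ne _ h (φ.map_deg hx), map_zero]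
  · intro x y h1 h2; simp only [map_add, h1, h2]

/-- Two or three homogeneous elements of the direct limit come from the same stage. -/
theorem exists_deg₃ {p q r : ℤ} {x y z : Colim G f} (hx : x ∈ deg G f p) (hy : y ∈ deg G f q)
    (hz : z ∈ deg G f r) : ∃ i, ∃ a ∈ (G i).deg p, ∃ b ∈ (G i).deg q, ∃ c ∈ (G i).deg r,
      x = of G f i a ∧ y = of G f i b ∧ z = of G f i c := by
  obtain ⟨i, a, ha, rfl⟩ := hx
  obtain ⟨j, b, hb, rfl⟩ := hy
  obtain ⟨l, c, hc, rfl⟩ := hz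
  obtain ⟨s, h1, h2⟩ := exists_ge_ge i j
  obtain ⟨t, h3, h4⟩ := exists_ge_ge s l
  exact ⟨t, _, (f i t (h1.trans h3)).map_deg ha, _, (f j t (h2.trans h3)).map_deg hb, _,
    (f l t h4).map_deg hc, (of_map _ _).symm, (of_map _ _).symm, (of_map _ _).symm⟩

theorem exists_deg₂ {p q : ℤ} {x y : Colim G f} (hx : x ∈ deg G f p) (hy : y ∈ deg G f q) :
    ∃ i, ∃ a ∈ (G i).deg p, ∃ b ∈ (G i).deg q, x = of G f i a ∧ y = of G f i b := by
  obtain ⟨i, a, ha, b, hb, -, -, h1, h2, -⟩ := exists_deg₃ hx hy hy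
  exact ⟨i, a, ha, b, hb, h1, h2⟩

instance : GradedAlgebra (deg G f) :=
  { decompositionOfProj (deg G f)
      (fun p => mapLin (fun i => GradedAlgebra.proj (G i).deg p) fun i j h x => proj_map _ p x)
      (by rintro p _ ⟨i, x, hx, rfl⟩; rw [mapLin_of, proj_self _ hx])
      (by rintro p q h _ ⟨i, x, hx, rfl⟩; rw [mapLin_of, proj_ne _ h hx, map_zero])
      (by
        rw [eq_top_iff]
        rintro z -
        obtain ⟨i, x, rfl⟩ := exists_eq_of z
        refine GradedSub.deg_induction (G i) (Q := fun x => of G f i x ∈ ⨆ p, deg G f p) ?_ ?_ x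
        · exact fun p x hx => Submodule.mem_iSup_of_mem p (of_mem hx)
        · intro x y h1 h2; rw [map_add]; exact add_mem h1 h2) with
    one_mem := ⟨Classical.arbitrary ι, 1, SetLike.GradedOne.one_mem, (map_one _).symm⟩
    mul_mem := by
      intro p q x y hx hy
      obtain ⟨i, a, ha, b, hb, rfl, rfl⟩ := exists_deg₂ hx hy
      exact ⟨i, _, SetLike.GradedMul.mul_mem ha hb, (map_mul _ _ _).symm⟩ }

variable (G f) in
/-- The direct limit as a differential `P₀`-algebra. -/
def toAlg : DGP0Alg k where
  carrier := Colim G f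
  deg := deg G f
  mul_comm' hx hy := by
    obtain ⟨i, a, ha, b, hb, rfl, rfl⟩ := exists_deg₂ hx hy
    rw [← map_mul, (G i).mul_comm' ha hb, map_smul, map_mul]
  bracket := bracket
  bracket_mem hx hy := by
    obtain ⟨i, a, ha, b, hb, rfl, rfl⟩ := exists_deg₂ hx hy
    rw [bracket_of]
    exact of_mem ((G i).bracket_mem ha hb)
  bracket_symm hx hy := by
    obtain ⟨i, a, ha, b, hb, rfl, rfl⟩ := exists_deg₂ hx hy
    rw [bracket_of, (G i).bracket_symm ha hb, map_neg, map_smul, bracket_of]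
  bracket_mul hx hy hz := by
    obtain ⟨i, a, ha, b, hb, c, hc, rfl, rfl, rfl⟩ := exists_deg₃ hx hy hz
    rw [← map_mul, bracket_of, bracket_of, bracket_of, (G i).bracket_mul ha hb hc, map_add,
      map_smul, map_mul, map_mul]
  jacobi hx hy hz := by
    obtain ⟨i, a, ha, b, hb, c, hc, rfl, rfl, rfl⟩ := exists_deg₃ hx hy hz
    rw [bracket_of, bracket_of, bracket_of, bracket_of, bracket_of, bracket_of,
      ← map_smul (of G f i), ← map_smul (of G f i), ← map_smul (of G f i), ← map_add (of G f i),
      ← map_add (of G f i), (G i).jacobi ha hb hc, map_zero]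
  d := mapLin (fun i => (G i).d) fun i j h x => (f i j h).map_d x
  d_mem hx := by
    obtain ⟨i, a, ha, rfl⟩ := hx
    exact of_mem ((G i).d_mem ha)
  d_d x := by
    obtain ⟨i, a, rfl⟩ := exists_eq_of x
    rw [mapLin_of, mapLin_of, (G i).d_d, map_zero]
  d_mul hx hy := by
    obtain ⟨i, a, ha, b, hb, rfl, rfl⟩ := exists_deg₂ hx hy
    rw [← map_mul, mapLin_of, mapLin_of, mapLin_of, (G i).d_mul ha hb, map_add, map_smul, map_mul,
      map_mul]
  d_bracket hx hy := by
    obtain ⟨i, a, ha, b, hb, rfl, rfl⟩ := exists_deg₂ hx hy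
    rw [bracket_of, mapLin_of, mapLin_of, mapLin_of, bracket_of, bracket_of,
      (G i).d_bracket ha hb, map_add, map_smul]

variable (G f) in
/-- The canonical morphism to the direct limit. -/
def ofHom (i : ι) : G i ⟶ toAlg G f where
  toAlgHom := of G f i
  map_deg h := of_mem h
  map_bracket x y := (bracket_of i x y).symm
  map_d _ := rfl

end Colim

end Colimit

/-! ### Constant families and forms on the point -/

section Unit

variable {k : Type u} [Field k]

/-- The morphism `a ↦ a ⊗ 1`. -/
def unitHom (A : DGP0Alg k) (n : ℕ) : A ⟶ tensorObj A n where
  toAlgHom := AlgHom.ofLinearMap ((TensorOmega.of A n).toLinearMap ∘ₗ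
      (TensorProduct.mk k A.carrier (Omega k n)).flip 1) rfl (by
    intro a b
    suffices (LinearMap.mul k A.carrier).compr₂ ((TensorOmega.of A n).toLinearMap ∘ₗ
        (TensorProduct.mk k A.carrier (Omega k n)).flip 1) =
        (LinearMap.mul k (TensorOmega A n)).compl₁₂ ((TensorOmega.of A n).toLinearMap ∘ₗ
        (TensorProduct.mk k A.carrier (Omega k n)).flip 1) ((TensorOmega.of A n).toLinearMap ∘ₗ
        (TensorProduct.mk k A.carrier (Omega k n)).flip 1) from
      congrArg (fun φ => φ a b) this
    refine LinearMap.ext fun a => DirectSum.decompose_lhom_ext A.deg fun p => ?_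
    ext ⟨b, hb⟩
    have := tmulΩ_mul (A := A) a (SetLike.GradedOne.one_mem (A := omegaDeg k n)) hb 1
    rw [zero_mul, zpow_zero, one_smul, one_mul] at this
    exact this.symm)
  map_deg ha := tmulΩ_mem ha (SetLike.GradedOne.one_mem (A := omegaDeg k n)) (add_zero _)
  map_bracket a b := by
    suffices A.bracket.compr₂ ((TensorOmega.of A n).toLinearMap ∘ₗ
        (TensorProduct.mk k A.carrier (Omega k n)).flip 1) =
        (TensorOmega.bracket A n).compl₁₂ ((TensorOmega.of A n).toLinearMap ∘ₗ
        (TensorProduct.mk k A.carrier (Omega k n)).flip 1) ((TensorOmega.of A n).toLinearMap ∘ₗ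
        (TensorProduct.mk k A.carrier (Omega k n)).flip 1) from
      congrArg (fun φ => φ a b) this
    refine LinearMap.ext fun a => DirectSum.decompose_lhom_ext A.deg fun p => ?_
    ext ⟨b, hb⟩
    have := TensorOmega.bracket_tmul (A := A) a (SetLike.GradedOne.one_mem (A := omegaDeg k n)) hb 1
    rw [zero_mul, zpow_zero, one_smul, one_mul] at this
    exact this.symm
  map_d a := by
    suffices (TensorOmega.of A n).toLinearMap ∘ₗ
        (TensorProduct.mk k A.carrier (Omega k n)).flip 1 ∘ₗ A.d =
        TensorOmega.d A n ∘ₗ (TensorOmega.of A n).toLinearMap ∘ₗ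
        (TensorProduct.mk k A.carrier (Omega k n)).flip 1 from congrArg (fun φ => φ a) this
    refine DirectSum.decompose_lhom_ext A.deg fun p => ?_
    ext ⟨a, ha⟩
    have := TensorOmega.d_tmul (n := n) ha 1
    rw [omegaD_one, tmulΩ_zero, smul_zero, add_zero] at this
    exact this.symm

theorem unitHom_apply (A : DGP0Alg k) (n : ℕ) (a : A.carrier) :
    (unitHom A n).toAlgHom a = tmulΩ a 1 := rfl

theorem unitHom_tensorMap {A B : DGP0Alg k} (f : A ⟶ B) {m n : ℕ}
    (θ : Fin (m + 1) → Fin (n + 1)) : unitHom A n ≫ tensorMap f θ = f ≫ unitHom B m := by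
  refine DGP0Alg.hom_ext fun a => ?_
  refine (tensorMap_tmul f θ a 1).trans ?_
  rw [map_one]
  rfl

theorem unitHom_extend {B C : DGP0Alg k} {n : ℕ} (g : B ⟶ tensorObj C n) :
    unitHom B n ≫ extend g = g := by
  refine DGP0Alg.hom_ext fun b => ?_
  refine (extend_tmul g b 1).trans ?_
  exact mul_one _

/-- Together with `unitHom_extend` this says that a ↦ a ⊗ 1 is a two-sided identity for the
composition of simplices of mapping spaces. -/
theorem extend_unitHom (A : DGP0Alg k) (n : ℕ) : extend (unitHom A n) = 𝟙 (tensorObj A n) := by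
  refine tensorObj_hom_ext fun a ω => ?_
  refine (extend_tmul _ a ω).trans ?_
  have := tmulΩ_mul (A := A) a (SetLike.GradedOne.one_mem (A := omegaDeg k n))
    (SetLike.GradedOne.one_mem (A := A.deg)) ω
  rw [zero_mul, zpow_zero, one_smul, one_mul, mul_one] at this
  exact this

/-- There are no variables and no differentials, so both tensor factors consist of scalars. -/
theorem omega_zero_eq_smul (ω : Omega k 0) : ∃ c : k, ω = c • 1 := by
  induction ω using TensorProduct.induction_on with
  | zero => exact ⟨0, (zero_smul _ _).symm⟩
  | add x y hx hy =>
    obtain ⟨c, rfl⟩ := hx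
    obtain ⟨d, rfl⟩ := hy
    exact ⟨c + d, (add_smul _ _ _).symm⟩
  | tmul f α =>
    have h1 : ∃ c : k, f = c • 1 := ⟨_, by
      rw [← MvPolynomial.C_eq_smul_one]; exact MvPolynomial.eq_C_of_isEmpty f⟩
    have h2 : ∃ c : k, α = c • 1 := by
      induction α using ExteriorAlgebra.induction with
      | algebraMap r => exact ⟨r, Algebra.algebraMap_eq_smul_one r⟩
      | ι x => exact ⟨0, by rw [Subsingleton.elim x 0, map_zero, zero_smul]⟩
      | mul a b ha hb =>
        obtain ⟨c, rfl⟩ := ha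
        obtain ⟨d, rfl⟩ := hb
        exact ⟨c * d, by rw [smul_mul_smul_comm, one_mul]⟩
      | add a b ha hb =>
        obtain ⟨c, rfl⟩ := ha
        obtain ⟨d, rfl⟩ := hb
        exact ⟨c + d, (add_smul _ _ _).symm⟩
    obtain ⟨c, rfl⟩ := h1
    obtain ⟨d, rfl⟩ := h2
    exact ⟨c * d, by rw [TensorProduct.smul_tmul_smul]; rfl⟩

/-- The augmentation `A ⊗ Ω(Δ⁰) → A`. -/
def augZero (A : DGP0Alg k) : TensorOmega A 0 →ₗ[k] A.carrier :=
  (TensorProduct.rid k A.carrier).toLinearMap ∘ₗ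
    (TensorProduct.map LinearMap.id
      ((TensorProduct.lid k k).toLinearMap ∘ₗ TensorProduct.map
        (MvPolynomial.aeval (0 : Fin 0 → k)).toLinearMap
        ExteriorAlgebra.algebraMapInv.toLinearMap)) ∘ₗ (TensorOmega.of A 0).symm.toLinearMap

theorem augZero_unitHom (A : DGP0Alg k) (a : A.carrier) :
    augZero A ((unitHom A 0).toAlgHom a) = a := by
  rw [unitHom_apply]
  simp [augZero, Algebra.TensorProduct.one_def]

theorem unitHom_injective (A : DGP0Alg k) : Function.Injective (unitHom A 0).toAlgHom :=
  Function.LeftInverse.injective (augZero_unitHom A)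

theorem unitHom_surjective (A : DGP0Alg k) (z : TensorOmega A 0) :
    ∃ a, (unitHom A 0).toAlgHom a = z := by
  refine ⟨augZero A z, ?_⟩
  suffices (unitHom A 0).toAlgHom.toLinearMap ∘ₗ augZero A = LinearMap.id from
    congrArg (fun φ => φ z) this
  refine TensorOmega.hom_ext fun p q a _ ω _ => ?_
  obtain ⟨c, rfl⟩ := omega_zero_eq_smul ω
  rw [tmulΩ_smul, map_smul, map_smul]
  refine congrArg (fun x => c • x) ?_
  exact congrArg (unitHom A 0).toAlgHom (augZero_unitHom A a)

/-- The unit is injective and commutes with the projections to the homogeneous components, so the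
degree can be read off after applying it. With injectivity and surjectivity this identifies A with A
⊗ Ω(Δ⁰). -/
theorem unitHom_mem {A : DGP0Alg k} {p : ℤ} {a : A.carrier}
    (h : (unitHom A 0).toAlgHom a ∈ (tensorObj A 0).deg p) : a ∈ A.deg p := by
  have e : GradedAlgebra.proj A.deg p a = a := by
    refine unitHom_injective A ?_
    rw [Colim.proj_map (unitHom A 0)]
    exact proj_self (tensorObj A 0) h
  rw [← e]
  exact SetLike.coe_mem _

end Unit

/-! ### Fibre integration with coefficients -/

section FibreIntegral

variable {k : Type u} [Field k] [CharZero k] {A B : DGP0Alg k} {m n : ℕ}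

variable (A) in
/-- The fibre integral `a ⊗ ω ↦ (-1)^(deg a) a ⊗ ∫ ω` along a degeneracy. -/
def tensorInt (l : Fin (m + 1)) : TensorOmega A (m + 1) →ₗ[k] TensorOmega A m :=
  (TensorOmega.of A m).toLinearMap ∘ₗ
    TensorProduct.map (degScale A.deg fun p => (-1) ^ p) (fibreInt l) ∘ₗ
    (TensorOmega.of A (m + 1)).symm.toLinearMap

theorem tensorInt_tmul (l : Fin (m + 1)) {p : ℤ} {a : A.carrier} (ha : a ∈ A.deg p)
    (ω : Omega k (m + 1)) :
    tensorInt A l (tmulΩ a ω) = (-1 : k) ^ p • tmulΩ a (fibreInt l ω) := by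
  simp [tensorInt, degScale_apply A.deg _ ha, ← TensorProduct.smul_tmul']

theorem tensorInt_mem (l : Fin (m + 1)) {p : ℤ} {z : TensorOmega A (m + 1)}
    (hz : z ∈ TensorOmega.deg A (m + 1) p) : tensorInt A l z ∈ TensorOmega.deg A m (p - 1) := by
  refine TensorOmega.mem_of_deg (tensorInt A l) _ ?_ hz
  rintro i q rfl a ha ω hω
  rw [tensorInt_tmul l ha]
  exact Submodule.smul_mem _ _ (tmulΩ_mem ha (fibreInt_mem l hω) (by ring))

/-- The sign (-1)^(deg a) in `tensorInt` is chosen so that the two terms da ⊗ ∫ω, which arise with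
signs (-1)^(deg a) and (-1)^(deg a + 1), cancel; the terms with a undifferentiated have total sign 1
and give Stokes' formula for forms. -/
theorem tensorInt_stokes (l : Fin (m + 1)) (z : TensorOmega A (m + 1)) :
    TensorOmega.d A m (tensorInt A l z) + tensorInt A l (TensorOmega.d A (m + 1) z) =
      (tensorMap (𝟙 A) l.castSucc.succAbove).toAlgHom z -
        (tensorMap (𝟙 A) l.succ.succAbove).toAlgHom z := by
  suffices TensorOmega.d A m ∘ₗ tensorInt A l + tensorInt A l ∘ₗ TensorOmega.d A (m + 1) =
      tensorMapLin (𝟙 A) l.castSucc.succAbove - tensorMapLin (𝟙 A) l.succ.succAbove from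
    congrArg (fun φ => φ z) this
  refine TensorOmega.hom_ext fun p q a ha ω hω => ?_
  simp only [LinearMap.add_apply, LinearMap.comp_apply, LinearMap.sub_apply]
  rw [tensorMapLin_tmul, tensorMapLin_tmul, tensorInt_tmul l ha, TensorOmega.d_tmul ha, map_add,
    map_smul, map_smul, tensorInt_tmul l ha, tensorInt_tmul l (A.d_mem ha), TensorOmega.d_tmul ha]
  have h := congrArg (fun x => tmulΩ a x) (fibreInt_stokes l ω)
  simp only [tmulΩ_add] at h
  have e : (-1 : k) ^ (p + 1) = - (-1) ^ p := by rw [zpow_add_one₀ (by simp)]; ring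
  have e2 : (-1 : k) ^ p * (-1) ^ p = 1 := by
    rw [sign_mul, sign_congr (b := 0) ⟨p, by ring⟩, zpow_zero]
  have hn : ∀ (c : k) (w : TensorOmega A m), (-c) • w = -(c • w) := fun c w => neg_smul c w
  rw [smul_add, smul_smul, smul_smul, e, e2, hn, one_smul, one_smul]
  have h3 : ∀ x y : Omega k m, (tmulΩ a (x - y) : TensorOmega A m) = tmulΩ a x - tmulΩ a y := by
    intro x y
    rw [tmulΩ, TensorProduct.tmul_sub, map_sub]
  rw [h3] at h
  change _ = tmulΩ a _ - tmulΩ a _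
  rw [← h]
  abel

theorem tensorMap_tensorInt (f : A ⟶ B) (θ : Fin (m + 1) → Fin (n + 1)) (hθ : Monotone θ)
    (l : Fin (n + 1)) (z : TensorOmega A (n + 1)) :
    (tensorMap f θ).toAlgHom (tensorInt A l z) =
      ∑ p with θ p = l, tensorInt B p ((tensorMap f (prismMap θ p)).toAlgHom z) := by
  suffices tensorMapLin f θ ∘ₗ tensorInt A l =
      ∑ p with θ p = l, tensorInt B p ∘ₗ tensorMapLin f (prismMap θ p) by
    have := congrArg (fun φ => φ z) this
    simp only [LinearMap.sum_apply] at this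
    exact this
  refine TensorOmega.hom_ext fun p q a ha ω hω => ?_
  simp only [LinearMap.sum_apply, LinearMap.comp_apply]
  rw [tensorInt_tmul l ha, map_smul, tensorMapLin_tmul, omegaPullback_fibreInt hθ]
  have : ∀ x, tensorInt B x (tensorMapLin f (prismMap θ x) (tmulΩ a ω)) =
      (-1 : k) ^ p • tmulΩ (f.toAlgHom a) (fibreInt x (omegaPullback k (prismMap θ x) ω)) := by
    intro x
    rw [tensorMapLin_tmul, tensorInt_tmul x (f.map_deg ha)]
  rw [Finset.sum_congr rfl fun x _ => this x, ← Finset.smul_sum, tmulΩ, TensorProduct.tmul_sum,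
    map_sum]

theorem tensorMap_id_tensorInt (f : A ⟶ B) (l : Fin (m + 1)) (z : TensorOmega A (m + 1)) :
    (tensorMap f id).toAlgHom (tensorInt A l z) =
      tensorInt B l ((tensorMap f id).toAlgHom z) := by
  suffices tensorMapLin f id ∘ₗ tensorInt A l = tensorInt B l ∘ₗ tensorMapLin f id from
    congrArg (fun φ => φ z) this
  refine TensorOmega.hom_ext fun p q a ha ω hω => ?_
  simp only [LinearMap.comp_apply]
  rw [tensorInt_tmul l ha, map_smul, tensorMapLin_tmul, tensorMapLin_tmul,
    tensorInt_tmul l (f.map_deg ha), omegaPullback_id, omegaPullback_id]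
  rfl

/-- The projection formula with coefficients. The sign is that of the total degree: the coefficient
contributes its part through `tensorInt`, the form on the base through `fibreInt_mul`. -/
theorem tensorInt_mul_oneΩ (l : Fin (m + 1)) {p : ℤ} {w : TensorOmega A m}
    (hw : w ∈ TensorOmega.deg A m p) (ω : Omega k (m + 1)) :
    tensorInt A l ((tensorMap (𝟙 A) l.predAbove).toAlgHom w * oneΩ A ω) =
      (-1 : k) ^ p • (w * oneΩ A (fibreInt l ω)) := by
  refine TensorOmega.eq_of_deg (tensorInt A l ∘ₗ (LinearMap.mul k _).flip (oneΩ A ω) ∘ₗ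
    tensorMapLin (𝟙 A) l.predAbove)
    ((-1 : k) ^ p • (LinearMap.mul k (TensorOmega A m)).flip (oneΩ A (fibreInt l ω))) ?_ hw
  rintro i j rfl a ha α hα
  simp only [LinearMap.comp_apply, LinearMap.smul_apply, LinearMap.flip_apply, LinearMap.mul_apply']
  have e1 := tmulΩ_mul (A := A) a (omegaPullback_mem l.predAbove hα)
    (SetLike.GradedOne.one_mem (A := A.deg)) ω
  have e2 := tmulΩ_mul (A := A) a hα (SetLike.GradedOne.one_mem (A := A.deg)) (fibreInt l ω)
  rw [mul_zero, zpow_zero, one_smul, mul_one] at e1 e2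
  rw [tensorMapLin_tmul, e2]
  refine (congrArg (tensorInt A l) e1).trans ?_
  rw [tensorInt_tmul l ha, fibreInt_mul l hα, tmulΩ_smul, smul_smul, sign_mul]

/-- When g' is constant along the fibres of the degeneracy, its linear extension commutes with fibre
integration. This makes the homotopy respect the truncation equations. -/
theorem tensorInt_extend (l : Fin (m + 1)) (g : B ⟶ tensorObj A m)
    (g' : B ⟶ tensorObj A (m + 1)) (h : g' = g ≫ tensorMap (𝟙 A) l.predAbove)
    (z : TensorOmega B (m + 1)) :
    tensorInt A l ((extend g').toAlgHom z) = (extend g).toAlgHom (tensorInt B l z) := by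
  subst h
  suffices tensorInt A l ∘ₗ extendLin (g ≫ tensorMap (𝟙 A) l.predAbove) =
      extendLin g ∘ₗ tensorInt B l from congrArg (fun φ => φ z) this
  refine TensorOmega.hom_ext fun p q b hb ω hω => ?_
  simp only [LinearMap.comp_apply]
  rw [extendLin_tmul, tensorInt_tmul l hb, map_smul, extendLin_tmul]
  exact tensorInt_mul_oneΩ l (g.map_deg hb) ω

end FibreIntegral

/-! ### The coherent system of a family of gluing data -/

section Coherent

variable {n : ℕ}

/-- An increasing chain of sets of indices. -/
abbrev Chain (n m : ℕ) : Type := Fin (m + 1) →o Finset (Fin (n + 1))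

/-- Presheaves `F a` of differential `P₀`-algebras and morphisms `F a ⟶ F b ⊗ Ω(Δᵐ)`, indexed by
chains of sets which contain `a` and `b`, compatible with composition and pullback. -/
structure CoherentSystem (k : Type u) [Field k] {X : TopCat.{u}} (U : Fin (n + 1) → Opens X) where
  F : Fin (n + 1) → (Opens X)ᵒᵖ ⥤ DGP0Alg k
  T : ∀ {m : ℕ} (τ : Chain n m) {a b : Fin (n + 1)} (_ : a ∈ τ 0) (_ : b ∈ τ 0) (_ : a ≤ b)
    (W : Opens X) (_ : W ≤ (τ (Fin.last m)).inf U),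
    (F a).obj (op W) ⟶ tensorObj ((F b).obj (op W)) m
  T_res : ∀ {m : ℕ} (τ : Chain n m) {a b : Fin (n + 1)} (ha : a ∈ τ 0) (hb : b ∈ τ 0)
    (hab : a ≤ b) {W W' : Opens X} (hW : W ≤ (τ (Fin.last m)).inf U) (h : W' ≤ W),
    (F a).map (homOfLE h).op ≫ T τ ha hb hab W' (h.trans hW) =
      T τ ha hb hab W hW ≫ tensorMap ((F b).map (homOfLE h).op) id
  T_pull : ∀ {m m' : ℕ} (τ : Chain n m) (θ : Fin (m' + 1) →o Fin (m + 1)) {a b : Fin (n + 1)}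
    (ha : a ∈ τ 0) (hb : b ∈ τ 0) (hab : a ≤ b) {W : Opens X}
    (hW : W ≤ (τ (Fin.last m)).inf U) (ha' : a ∈ τ.comp θ 0) (hb' : b ∈ τ.comp θ 0)
    (hW' : W ≤ (τ.comp θ (Fin.last m')).inf U),
    T (τ.comp θ) ha' hb' hab W hW' = T τ ha hb hab W hW ≫ tensorMap (𝟙 _) θ
  T_comp : ∀ {m : ℕ} (τ : Chain n m) {a j b : Fin (n + 1)} (ha : a ∈ τ 0) (hj : j ∈ τ 0)
    (hb : b ∈ τ 0) (haj : a ≤ j) (hjb : j ≤ b) {W : Opens X}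
    (hW : W ≤ (τ (Fin.last m)).inf U),
    T τ ha hb (haj.trans hjb) W hW = T τ ha hj haj W hW ≫ extend (T τ hj hb hjb W hW)
  T_self : ∀ {m : ℕ} (τ : Chain n m) {a : Fin (n + 1)} (ha : a ∈ τ 0) {W : Opens X}
    (hW : W ≤ (τ (Fin.last m)).inf U), T τ ha ha le_rfl W hW = unitHom _ m
  T_congr : ∀ {m : ℕ} (τ τ' : Chain n m) {a b : Fin (n + 1)} (ha : a ∈ τ 0) (hb : b ∈ τ 0)
    (hab : a ≤ b) {W : Opens X} (hW : W ≤ (τ (Fin.last m)).inf U) (ha' : a ∈ τ' 0)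
    (hb' : b ∈ τ' 0) (hW' : W ≤ (τ' (Fin.last m)).inf U)
    (_ : ∀ t, (τ t).filter (fun j => a ≤ j ∧ j ≤ b) = (τ' t).filter (fun j => a ≤ j ∧ j ≤ b)),
    T τ ha hb hab W hW = T τ' ha' hb' hab W hW'

namespace GluingData

variable {k : Type u} [Field k] {X : TopCat.{u}} {U : Fin (n + 1) → Opens X} (D : GluingData k U)

/-- The direct image of the sheaf `A b` on `X`. -/
def direct (b : Fin (n + 1)) : (Opens X)ᵒᵖ ⥤ DGP0Alg k :=
  (Opens.map (U b).inclusion').op ⋙ (D.A b).presheaf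

variable {I I' : Finset (Fin (n + 1))} {a b : Fin (n + 1)} {m m' : ℕ}

/-- The simplex of the nerve of a cube given by a chain of sets. -/
def cubeHom (I : Finset (Fin (n + 1))) (a b : Fin (n + 1)) (τ : Chain n m)
    (hτ : ∀ t, τ t ⊆ I ∧ a ∈ τ t ∧ b ∈ τ t) : Fin (m + 1) →o CubePoset.{u} I a b where
  toFun t := ⟨τ t, hτ t⟩
  monotone' _ _ h := τ.monotone h

/-- The morphism over `W` given by a chain of subsets of `I`. -/
def chainHom (h : IsEnds I a b) (τ : Chain n m) (hτ : ∀ t, τ t ⊆ I ∧ a ∈ τ t ∧ b ∈ τ t)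
    (W : Opens X) (hW : W ≤ I.inf U) :
    (D.direct a).obj (op W) ⟶ tensorObj ((D.direct b).obj (op W)) m :=
  ((D.K h).app (op ⦋m⦌) (cubeHom.{u} I a b τ hτ).monotone.functor :
    sections (D.A a) (I.inf U) ⟶ sections (D.A b) (I.inf U) ⋙ tensorFunctor k m).app (op ⟨W, hW⟩)

theorem chainHom_res (h : IsEnds I a b) (τ : Chain n m)
    (hτ : ∀ t, τ t ⊆ I ∧ a ∈ τ t ∧ b ∈ τ t) {W W' : Opens X} (hW : W ≤ I.inf U) (hW' : W' ≤ W) :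
    (D.direct a).map (homOfLE hW').op ≫ D.chainHom h τ hτ W' (hW'.trans hW) =
      D.chainHom h τ hτ W hW ≫ tensorMap ((D.direct b).map (homOfLE hW').op) id :=
  ((D.K h).app (op ⦋m⦌) (cubeHom.{u} I a b τ hτ).monotone.functor :
    sections (D.A a) (I.inf U) ⟶ sections (D.A b) (I.inf U) ⋙ tensorFunctor k m).naturality
    (X := op ⟨W, hW⟩) (Y := op ⟨W', hW'.trans hW⟩) (homOfLE hW').op

theorem chainHom_pull (h : IsEnds I a b) (τ : Chain n m)
    (hτ : ∀ t, τ t ⊆ I ∧ a ∈ τ t ∧ b ∈ τ t) (θ : Fin (m' + 1) →o Fin (m + 1)) {W : Opens X}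
    (hW : W ≤ I.inf U) :
    D.chainHom h (τ.comp θ) (fun t => hτ (θ t)) W hW =
      D.chainHom h τ hτ W hW ≫ tensorMap (𝟙 _) θ := by
  have key := ConcreteCategory.congr_hom
    ((D.K h).naturality (SimplexCategory.mkHom θ).op)
    ((cubeHom.{u} I a b τ hτ).monotone.functor : ComposableArrows (CubePoset.{u} I a b) m)
  exact congrArg (fun φ : sections (D.A a) (I.inf U) ⟶
    sections (D.A b) (I.inf U) ⋙ tensorFunctor k m' => φ.app (op ⟨W, hW⟩)) key

theorem chainHom_erase (h : IsEnds I a b) {i : Fin (n + 1)} (hi : i ∈ I) (hai : a < i) (hib : i < b)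
    (τ : Chain n m) (hτ : ∀ t, τ t ⊆ I ∧ a ∈ τ t ∧ b ∈ τ t)
    (hτ' : ∀ t, τ t ⊆ I.erase i ∧ a ∈ τ t ∧ b ∈ τ t) {W : Opens X} (hW : W ≤ I.inf U) :
    D.chainHom h τ hτ W hW = D.chainHom (h.erase hai hib) τ hτ' W
      (hW.trans (Finset.inf_mono (Finset.erase_subset i I))) :=
  congrArg (fun φ : sections (D.A a) (I.inf U) ⟶
    sections (D.A b) (I.inf U) ⋙ tensorFunctor k m => φ.app (op ⟨W, hW⟩))
    (D.incl h hi hai hib (op ⦋m⦌) (cubeHom.{u} (I.erase i) a b τ hτ').monotone.functor)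

/-- The indices of I outside I' do not occur in the chain and lie strictly between a and b, since a
and b belong to I'. They are removed one at a time by the third gluing condition. -/
theorem chainHom_congr (h : IsEnds I a b) (h' : IsEnds I' a b) (hI : I' ⊆ I)
    (τ τ' : Chain n m) (hτ : ∀ t, τ t ⊆ I ∧ a ∈ τ t ∧ b ∈ τ t)
    (hτ' : ∀ t, τ' t ⊆ I' ∧ a ∈ τ' t ∧ b ∈ τ' t) (e : ∀ t, τ t = τ' t) {W : Opens X}
    (hW : W ≤ I.inf U) (hW' : W ≤ I'.inf U) :
    D.chainHom h τ hτ W hW = D.chainHom h' τ' hτ' W hW' := by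
  obtain rfl : τ = τ' := OrderHom.ext _ _ (funext e)
  induction hc : (I \ I').card generalizing I with
  | zero =>
    obtain rfl : I = I' := subset_antisymm (Finset.sdiff_eq_empty_iff_subset.mp
      (Finset.card_eq_zero.mp hc)) hI
    rfl
  | succ c ih =>
    obtain ⟨i, hi⟩ : (I \ I').Nonempty := Finset.card_pos.mp (by omega)
    rw [Finset.mem_sdiff] at hi
    have hai : a < i := lt_of_le_of_ne (h.isLeast.2 hi.1) fun e => hi.2 (e ▸ h'.isLeast.1)
    have hib : i < b := lt_of_le_of_ne (h.isGreatest.2 hi.1) fun e => hi.2 (e ▸ h'.isGreatest.1)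
    have hsub : ∀ t, τ t ⊆ I.erase i ∧ a ∈ τ t ∧ b ∈ τ t := fun t =>
      ⟨Finset.subset_erase.mpr ⟨(hτ t).1, fun ht => hi.2 ((hτ' t).1 ht)⟩, (hτ t).2⟩
    rw [D.chainHom_erase h hi.1 hai hib τ hτ hsub hW]
    refine ih (h.erase hai hib) (Finset.subset_erase.mpr ⟨hI, hi.2⟩) hsub _ ?_
    rw [Finset.erase_sdiff_comm, Finset.card_erase_of_mem (Finset.mem_sdiff.mpr hi), hc]
    rfl

/-- The restriction of a chain to the indices with a given property. -/
def _root_.P0Glue.Chain.filter (τ : Chain n m) (p : Fin (n + 1) → Prop) [DecidablePred p] :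
    Chain n m where
  toFun t := (τ t).filter p
  monotone' _ _ h := Finset.filter_subset_filter _ (τ.monotone h)

/-- Each set of the chain is the union of its parts below and above i. Since i belongs to all of
them, both parts lie in the smaller cubes and the second gluing condition applies. -/
theorem chainHom_union (h : IsEnds I a b) {i : Fin (n + 1)} (hi : i ∈ I) (hai : a < i) (hib : i < b)
    (τ : Chain n m) (hτ : ∀ t, τ t ⊆ I ∧ a ∈ τ t ∧ b ∈ τ t) (hiτ : ∀ t, i ∈ τ t) {W : Opens X}
    (hW : W ≤ I.inf U) :
    D.chainHom h τ hτ W hW =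
      D.chainHom (h.lower hi hai) (τ.filter (· ≤ i)) (fun t =>
        ⟨Finset.filter_subset_filter _ (hτ t).1, Finset.mem_filter.mpr ⟨(hτ t).2.1, hai.le⟩,
          Finset.mem_filter.mpr ⟨hiτ t, le_rfl⟩⟩) W
        (hW.trans (Finset.inf_mono (Finset.filter_subset _ I))) ≫
      extend (D.chainHom (h.upper hi hib) (τ.filter (i ≤ ·)) (fun t =>
        ⟨Finset.filter_subset_filter _ (hτ t).1, Finset.mem_filter.mpr ⟨hiτ t, le_rfl⟩,
          Finset.mem_filter.mpr ⟨(hτ t).2.2, hib.le⟩⟩) W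
        (hW.trans (Finset.inf_mono (Finset.filter_subset _ I)))) := by
  have key := D.union h hi hai hib (op ⦋m⦌)
    (cubeHom.{u} (I.filter (· ≤ i)) a i (τ.filter (· ≤ i)) (fun t =>
      ⟨Finset.filter_subset_filter _ (hτ t).1, Finset.mem_filter.mpr ⟨(hτ t).2.1, hai.le⟩,
        Finset.mem_filter.mpr ⟨hiτ t, le_rfl⟩⟩)).monotone.functor
    (cubeHom.{u} (I.filter (i ≤ ·)) i b (τ.filter (i ≤ ·)) (fun t =>
      ⟨Finset.filter_subset_filter _ (hτ t).1, Finset.mem_filter.mpr ⟨hiτ t, le_rfl⟩,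
        Finset.mem_filter.mpr ⟨(hτ t).2.2, hib.le⟩⟩)).monotone.functor
  refine Eq.trans ?_ (congrArg (fun φ : sections (D.A a) (I.inf U) ⟶
    sections (D.A b) (I.inf U) ⋙ tensorFunctor k m => φ.app (op ⟨W, hW⟩)) key)
  have e : ∀ t, τ t = (τ t).filter (· ≤ i) ∪ (τ t).filter (i ≤ ·) := by
    intro t
    ext j
    simp only [Finset.mem_union, Finset.mem_filter]
    have := le_total j i
    tauto
  have hm : ∀ s t : Fin (m + 1), s ≤ t → (τ s).filter (· ≤ i) ∪ (τ s).filter (i ≤ ·) ⊆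
      (τ t).filter (· ≤ i) ∪ (τ t).filter (i ≤ ·) := by
    intro s t hst
    rw [← e, ← e]
    exact τ.monotone hst
  exact D.chainHom_congr h h subset_rfl τ
    ⟨fun t => (τ t).filter (· ≤ i) ∪ (τ t).filter (i ≤ ·), hm⟩ hτ
    (fun t => by have := hτ t; rw [e t] at this; exact this) e hW hW

theorem isEnds_filter (J : Finset (Fin (n + 1))) (ha : a ∈ J) (hb : b ∈ J) (hab : a < b) :
    IsEnds (J.filter fun j => a ≤ j ∧ j ≤ b) a b where
  isLeast := ⟨by simpa using ⟨ha, hab.le⟩, fun j hj => by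
    simp only [Finset.coe_filter, Set.mem_ofPred_eq] at hj
    exact hj.2.1⟩
  isGreatest := ⟨by simpa using ⟨hb, hab.le⟩, fun j hj => by
    simp only [Finset.coe_filter, Set.mem_ofPred_eq] at hj
    exact hj.2.2⟩
  lt := hab

theorem filter_subset_last (τ : Chain n m) (ha : a ∈ τ 0) (hb : b ∈ τ 0) (hab : a ≤ b)
    (t : Fin (m + 1)) : τ.filter (fun j => a ≤ j ∧ j ≤ b) t ⊆
      (τ (Fin.last m)).filter (fun j => a ≤ j ∧ j ≤ b) ∧
      a ∈ τ.filter (fun j => a ≤ j ∧ j ≤ b) t ∧ b ∈ τ.filter (fun j => a ≤ j ∧ j ≤ b) t :=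
  ⟨Finset.filter_subset_filter _ (τ.monotone (Fin.le_last t)),
    Finset.mem_filter.mpr ⟨τ.monotone (Fin.zero_le t) ha, le_rfl, hab⟩,
    Finset.mem_filter.mpr ⟨τ.monotone (Fin.zero_le t) hb, hab, le_rfl⟩⟩

/-- The morphism over `W` given by a chain of sets which contain `a` and `b`. -/
def transition (τ : Chain n m) {a b : Fin (n + 1)} (ha : a ∈ τ 0) (hb : b ∈ τ 0) (hab : a ≤ b)
    (W : Opens X) (hW : W ≤ (τ (Fin.last m)).inf U) :
    (D.direct a).obj (op W) ⟶ tensorObj ((D.direct b).obj (op W)) m :=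
  -- The gluing data contain nothing for a single index; the identity of composition is put on the
  -- diagonal.
  if h : a = b then (congrArg (fun c => (D.direct c).obj (op W)) h) ▸ unitHom _ m
  else
    D.chainHom (isEnds_filter (τ (Fin.last m)) (τ.monotone (Fin.zero_le _) ha)
      (τ.monotone (Fin.zero_le _) hb) (lt_of_le_of_ne hab h)) (τ.filter fun j => a ≤ j ∧ j ≤ b)
      (filter_subset_last τ ha hb hab) W
      (hW.trans (Finset.inf_mono (Finset.filter_subset _ _)))

theorem transition_self (τ : Chain n m) (ha : a ∈ τ 0) {W : Opens X}
    (hW : W ≤ (τ (Fin.last m)).inf U) :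
    D.transition τ ha ha le_rfl W hW = unitHom _ m := by
  rw [transition, dif_pos rfl]

/-- The ambient set I is left free here, so that several transitions can be expressed inside one
cube before the gluing conditions are applied. -/
theorem transition_of_lt (τ : Chain n m) (ha : a ∈ τ 0) (hb : b ∈ τ 0) (hab : a < b)
    {W : Opens X} (hW : W ≤ (τ (Fin.last m)).inf U) (h : IsEnds I a b) (τ' : Chain n m)
    (hτ' : ∀ t, τ' t ⊆ I ∧ a ∈ τ' t ∧ b ∈ τ' t)
    (e : ∀ t, (τ t).filter (fun j => a ≤ j ∧ j ≤ b) = τ' t)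
    (hI : (τ (Fin.last m)).filter (fun j => a ≤ j ∧ j ≤ b) ⊆ I) (hW' : W ≤ I.inf U) :
    D.transition τ ha hb hab.le W hW = D.chainHom h τ' hτ' W hW' := by
  rw [transition, dif_neg hab.ne]
  exact (D.chainHom_congr h _ hI τ' _ hτ' _ (fun t => (e t).symm) hW' _).symm

/-- If j is one of the ends, one factor is the identity. Otherwise everything takes place in the
cube of the indices between a and b, where it is the composition law for unions. -/
theorem transition_comp (τ : Chain n m) {a j b : Fin (n + 1)} (ha : a ∈ τ 0) (hj : j ∈ τ 0)
    (hb : b ∈ τ 0) (haj : a ≤ j) (hjb : j ≤ b) {W : Opens X}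
    (hW : W ≤ (τ (Fin.last m)).inf U) :
    D.transition τ ha hb (haj.trans hjb) W hW =
      D.transition τ ha hj haj W hW ≫ extend (D.transition τ hj hb hjb W hW) := by
  rcases haj.eq_or_lt with rfl | haj
  · rw [D.transition_self]
    exact (unitHom_extend _).symm
  rcases hjb.eq_or_lt with rfl | hjb
  · rw [D.transition_self, extend_unitHom]
    exact (Category.comp_id _).symm
  have hja : j ∈ (τ (Fin.last m)).filter (fun i => a ≤ i ∧ i ≤ b) :=
    Finset.mem_filter.mpr ⟨τ.monotone (Fin.zero_le _) hj, haj.le, hjb.le⟩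
  have E := isEnds_filter (τ (Fin.last m)) (τ.monotone (Fin.zero_le _) ha)
      (τ.monotone (Fin.zero_le _) hb) (haj.trans hjb)
  have hW2 : W ≤ ((τ (Fin.last m)).filter (fun i => a ≤ i ∧ i ≤ b)).inf U :=
    hW.trans (Finset.inf_mono (Finset.filter_subset _ _))
  have e1 : ∀ t, (τ t).filter (fun i => a ≤ i ∧ i ≤ j) =
      ((τ t).filter fun i => a ≤ i ∧ i ≤ b).filter (· ≤ j) := fun t => by
    ext i
    simp only [Finset.mem_filter]
    exact ⟨fun h => ⟨⟨h.1, h.2.1, h.2.2.trans hjb.le⟩, h.2.2⟩, fun h => ⟨h.1.1, h.1.2.1, h.2⟩⟩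
  have e2 : ∀ t, (τ t).filter (fun i => j ≤ i ∧ i ≤ b) =
      ((τ t).filter fun i => a ≤ i ∧ i ≤ b).filter (j ≤ ·) := fun t => by
    ext i
    simp only [Finset.mem_filter]
    exact ⟨fun h => ⟨⟨h.1, haj.le.trans h.2.1, h.2.2⟩, h.2.1⟩, fun h => ⟨h.1.1, h.2, h.1.2.2⟩⟩
  rw [D.transition_of_lt τ ha hb (haj.trans hjb) hW E (τ.filter fun i => a ≤ i ∧ i ≤ b)
      (filter_subset_last τ ha hb (haj.trans hjb).le) (fun _ => rfl) subset_rfl hW2,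
    D.chainHom_union E hja haj hjb _ _ (fun t => Finset.mem_filter.mpr
      ⟨τ.monotone (Fin.zero_le _) hj, haj.le, hjb.le⟩) hW2,
    D.transition_of_lt τ ha hj haj hW (E.lower hja haj)
      ((τ.filter fun i => a ≤ i ∧ i ≤ b).filter (· ≤ j)) _ e1 (e1 _).subset _,
    D.transition_of_lt τ hj hb hjb hW (E.upper hja hjb)
      ((τ.filter fun i => a ≤ i ∧ i ≤ b).filter (j ≤ ·)) _ e2 (e2 _).subset _]

theorem transition_res (τ : Chain n m) (ha : a ∈ τ 0) (hb : b ∈ τ 0)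
    (hab : a ≤ b) {W W' : Opens X} (hW : W ≤ (τ (Fin.last m)).inf U) (h : W' ≤ W) :
    (D.direct a).map (homOfLE h).op ≫ D.transition τ ha hb hab W' (h.trans hW) =
      D.transition τ ha hb hab W hW ≫ tensorMap ((D.direct b).map (homOfLE h).op) id := by
  rcases hab.eq_or_lt with rfl | hab
  · rw [D.transition_self, D.transition_self]
    exact (unitHom_tensorMap _ id).symm
  · rw [transition, transition, dif_neg hab.ne, dif_neg hab.ne]
    exact D.chainHom_res ..

theorem transition_pull (τ : Chain n m) (θ : Fin (m' + 1) →o Fin (m + 1))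
    (ha : a ∈ τ 0) (hb : b ∈ τ 0) (hab : a ≤ b) {W : Opens X}
    (hW : W ≤ (τ (Fin.last m)).inf U) (ha' : a ∈ τ.comp θ 0) (hb' : b ∈ τ.comp θ 0)
    (hW' : W ≤ (τ.comp θ (Fin.last m')).inf U) :
    D.transition (τ.comp θ) ha' hb' hab W hW' =
      D.transition τ ha hb hab W hW ≫ tensorMap (𝟙 _) θ := by
  rcases hab.eq_or_lt with rfl | hab
  · rw [D.transition_self, D.transition_self]
    refine ((unitHom_tensorMap _ θ).trans ?_).symm
    exact Category.id_comp _
  · have E := isEnds_filter (τ (Fin.last m)) (τ.monotone (Fin.zero_le _) ha)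
      (τ.monotone (Fin.zero_le _) hb) hab
    have hW2 : W ≤ ((τ (Fin.last m)).filter (fun i => a ≤ i ∧ i ≤ b)).inf U :=
      hW.trans (Finset.inf_mono (Finset.filter_subset _ _))
    rw [D.transition_of_lt τ ha hb hab hW E (τ.filter fun i => a ≤ i ∧ i ≤ b)
        (filter_subset_last τ ha hb hab.le) (fun _ => rfl) subset_rfl hW2,
      D.transition_of_lt (τ.comp θ) ha' hb' hab hW' E
        ((τ.filter fun i => a ≤ i ∧ i ≤ b).comp θ)
        (fun t => filter_subset_last τ ha hb hab.le (θ t)) (fun _ => rfl)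
        (Finset.filter_subset_filter _ (τ.monotone (Fin.le_last _))) hW2]
    exact D.chainHom_pull ..

/-- A transition from a to b depends only on the indices between a and b. This is why indices
outside that range can later be adjoined to or removed from a chain. -/
theorem transition_congr (τ τ' : Chain n m) (ha : a ∈ τ 0) (hb : b ∈ τ 0)
    (hab : a ≤ b) {W : Opens X} (hW : W ≤ (τ (Fin.last m)).inf U) (ha' : a ∈ τ' 0)
    (hb' : b ∈ τ' 0) (hW' : W ≤ (τ' (Fin.last m)).inf U)
    (e : ∀ t, (τ t).filter (fun j => a ≤ j ∧ j ≤ b) = (τ' t).filter (fun j => a ≤ j ∧ j ≤ b)) :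
    D.transition τ ha hb hab W hW = D.transition τ' ha' hb' hab W hW' := by
  rcases hab.eq_or_lt with rfl | hab
  · rw [D.transition_self, D.transition_self]
  · have E := isEnds_filter (τ' (Fin.last m)) (τ'.monotone (Fin.zero_le _) ha')
      (τ'.monotone (Fin.zero_le _) hb') hab
    have hW2 : W ≤ ((τ' (Fin.last m)).filter (fun i => a ≤ i ∧ i ≤ b)).inf U :=
      hW'.trans (Finset.inf_mono (Finset.filter_subset _ _))
    rw [D.transition_of_lt τ ha hb hab hW E (τ'.filter fun i => a ≤ i ∧ i ≤ b)
        (filter_subset_last τ' ha' hb' hab.le) e (e _).subset hW2,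
      D.transition_of_lt τ' ha' hb' hab hW' E (τ'.filter fun i => a ≤ i ∧ i ≤ b)
        (filter_subset_last τ' ha' hb' hab.le) (fun _ => rfl) subset_rfl hW2]

/-- The coherent system of morphisms defined by gluing data. -/
def system : CoherentSystem k U where
  F := D.direct
  T := D.transition
  T_res τ _ _ ha hb hab _ _ hW h := D.transition_res τ ha hb hab hW h
  T_pull τ θ _ _ ha hb hab _ hW ha' hb' hW' :=
    D.transition_pull τ θ ha hb hab hW ha' hb' hW'
  T_comp τ _ _ _ ha hj hb haj hjb _ hW := D.transition_comp τ ha hj hb haj hjb hW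
  T_self τ _ ha _ hW := D.transition_self τ ha hW
  T_congr τ τ' _ _ ha hb hab _ hW ha' hb' hW' e :=
    D.transition_congr τ τ' ha hb hab hW ha' hb' hW' e

end GluingData

end Coherent

/-! ### Equalizers of differential P₀-algebras -/

section Equalizer

variable {k : Type u} [Field k] {ι : Type u} {A : ι → DGP0Alg k}

/-- The families in a product of differential `P₀`-algebras which satisfy equations between images
of their components under morphisms. -/
def GradedSub.equalizer {κ : Type*} (x y : κ → ι) (Z : κ → DGP0Alg k) (f : ∀ c, A (x c) ⟶ Z c)
    (g : ∀ c, A (y c) ⟶ Z c) : GradedSub A where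
  S p :=
    { carrier := {a | (∀ i, a i ∈ (A i).deg p) ∧
        ∀ c, (f c).toAlgHom (a (x c)) = (g c).toAlgHom (a (y c))}
      zero_mem' := ⟨fun i => zero_mem _, fun c => by simp⟩
      add_mem' := fun ha hb => ⟨fun i => add_mem (ha.1 i) (hb.1 i), fun c => by
        rw [Pi.add_apply, Pi.add_apply, map_add, map_add, ha.2, hb.2]⟩
      smul_mem' := fun r a ha => ⟨fun i => Submodule.smul_mem _ r (ha.1 i), fun c => by
        rw [Pi.smul_apply, Pi.smul_apply, map_smul, map_smul, ha.2]⟩ }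
  mem_deg h := h.1
  one_mem := ⟨fun _ => SetLike.GradedOne.one_mem, fun c => by simp⟩
  mul_mem ha hb := ⟨fun i => SetLike.GradedMul.mul_mem (ha.1 i) (hb.1 i), fun c => by
    rw [Pi.mul_apply, Pi.mul_apply, map_mul, map_mul, ha.2, hb.2]⟩
  bracket_mem ha hb := ⟨fun i => (A i).bracket_mem (ha.1 i) (hb.1 i), fun c => by
    rw [(f c).map_bracket, (g c).map_bracket, ha.2, hb.2]⟩
  d_mem ha := ⟨fun i => (A i).d_mem (ha.1 i), fun c => by
    rw [(f c).map_d, (g c).map_d, ha.2]⟩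

end Equalizer

/-! ### Prisms over chains of index sets -/

section Chains

variable {n m : ℕ}

/-- The chain of the sets `insert i (τ t)`. -/
def Chain.insert (i : Fin (n + 1)) (τ : Chain n m) : Chain n m where
  toFun t := Insert.insert i (τ t)
  monotone' _ _ h := Finset.insert_subset_insert i (τ.monotone h)

theorem Chain.mem_insert_self (i : Fin (n + 1)) (τ : Chain n m) (t : Fin (m + 1)) :
    i ∈ τ.insert i t := Finset.mem_insert_self _ _

theorem Chain.mem_insert (i : Fin (n + 1)) {j : Fin (n + 1)} {τ : Chain n m} {t : Fin (m + 1)}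
    (h : j ∈ τ t) : j ∈ τ.insert i t := Finset.mem_insert_of_mem h

/-- The chain `τ 0, …, τ l, insert i (τ l), …, insert i (τ m)`. -/
def Chain.prism (i : Fin (n + 1)) (τ : Chain n m) (l : Fin (m + 1)) : Chain n (m + 1) where
  toFun t := if t ≤ l.castSucc then τ (l.predAbove t) else Insert.insert i (τ (l.predAbove t))
  monotone' s t h := by
    have h2 := τ.monotone (Fin.predAbove_right_monotone l h)
    dsimp only
    split_ifs with h3 h4 h4
    · exact h2
    · exact h2.trans (Finset.subset_insert _ _)
    · exact absurd (h.trans h4) h3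
    · exact Finset.insert_subset_insert i h2

/-- The chain of the sets `τ t` for `t < l` and `insert i (τ t)` for `l ≤ t`. -/
def Chain.step (i : Fin (n + 1)) (τ : Chain n m) (l : ℕ) : Chain n m where
  toFun t := if t.val < l then τ t else Insert.insert i (τ t)
  monotone' s t h := by
    have h2 := τ.monotone h
    dsimp only
    split_ifs with h3 h4 h4
    · exact h2
    · exact h2.trans (Finset.subset_insert _ _)
    · exact absurd (lt_of_le_of_lt (Fin.le_def.mp h) h4) h3
    · exact Finset.insert_subset_insert i h2

/-- The constant chain `{i}` of length `0`. -/
def Chain.single (i : Fin (n + 1)) : Chain n 0 where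
  toFun _ := {i}
  monotone' _ _ _ := subset_rfl

theorem Chain.mem_single (i : Fin (n + 1)) (t : Fin 1) : i ∈ Chain.single i t :=
  Finset.mem_singleton_self i

theorem Chain.le_of_mem_single (i : Fin (n + 1)) (t : Fin 1) (j : Fin (n + 1))
    (h : j ∈ Chain.single i t) : i ≤ j := (Finset.mem_singleton.mp h).ge

/-- The maps `prismMap θ p` preserve the order. -/
def prismHom {m n : ℕ} (θ : Fin (m + 1) →o Fin (n + 1)) (p : Fin (m + 1)) :
    Fin (m + 2) →o Fin (n + 2) where
  toFun := prismMap θ p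
  monotone' s t h := by
    have h2 := θ.monotone (Fin.predAbove_right_monotone p h)
    unfold prismMap
    split_ifs with h3 h4 h4
    · exact Fin.castSucc_le_castSucc_iff.mpr h2
    · exact (Fin.castSucc_le_castSucc_iff.mpr h2).trans (Fin.castSucc_lt_succ).le
    · exact absurd (h.trans h4) h3
    · exact Fin.succ_le_succ_iff.mpr h2

/-- `prismMap θ p` takes the lower vertices of the p-th simplex of one prism to lower vertices of
the (θ p)-th simplex of the other, and upper vertices to upper ones, acting by θ on the base. -/
theorem Chain.prism_comp_prismHom {m' : ℕ} (i : Fin (n + 1)) (τ : Chain n m)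
    (θ : Fin (m' + 1) →o Fin (m + 1)) (p : Fin (m' + 1)) (t : Fin (m' + 2)) :
    (τ.prism i (θ p)).comp (prismHom θ p) t = Chain.prism i (τ.comp θ) p t := by
  change (if prismMap θ p t ≤ _ then _ else _) = if t ≤ _ then _ else _
  have h2 : ∀ q, θ q ≤ θ p → (θ p).predAbove (θ q).castSucc = θ q := fun q h => by
    rw [Fin.predAbove_castSucc_of_le _ _ h]
  have h3 : ∀ q, θ p ≤ θ q → (θ p).predAbove (θ q).succ = θ q := fun q h => by
    rw [Fin.predAbove_succ_of_le _ _ h]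
  by_cases h : t ≤ p.castSucc
  · rw [if_pos h]
    have hq : p.predAbove t ≤ p := by
      rw [Fin.predAbove_of_le_castSucc _ _ h]
      exact Fin.castPred_le_iff _ |>.mpr h
    have e : prismMap θ p t = (θ (p.predAbove t)).castSucc := if_pos h
    rw [if_pos (by rw [e]; exact Fin.castSucc_le_castSucc_iff.mpr (θ.monotone hq))]
    change τ ((θ p).predAbove (prismMap θ p t)) = _
    rw [e, h2 _ (θ.monotone hq)]
    rfl
  · have h' : p.castSucc < t := not_le.mp h
    have hq : p ≤ p.predAbove t := by
      rw [Fin.predAbove_of_castSucc_lt _ _ h', Fin.le_pred_iff]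
      exact Fin.castSucc_lt_iff_succ_le.mp h'
    have e : prismMap θ p t = (θ (p.predAbove t)).succ := if_neg h
    rw [if_neg h, if_neg (by
      rw [e]
      exact not_le.mpr (Fin.castSucc_lt_succ_iff.mpr (θ.monotone hq)))]
    change Insert.insert i (τ ((θ p).predAbove (prismMap θ p t))) = _
    rw [e, h3 _ (θ.monotone hq)]
    rfl

/-- The faces l and l + 1 of the l-th simplex of the prism are the steps l and l + 1, so consecutive
simplices share a face. Step 0 has i adjoined everywhere and step m + 1 is the chain itself. -/
theorem Chain.prism_face (i : Fin (n + 1)) (τ : Chain n m) (l : Fin (m + 1)) (t : Fin (m + 1)) :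
    τ.prism i l (l.castSucc.succAbove t) = τ.step i l t := by
  change (if _ then _ else _) = if _ then _ else _
  by_cases h : t.val < l
  · have h1 : t.castSucc < l.castSucc := h
    rw [Fin.succAbove_of_castSucc_lt _ _ h1, if_pos h1.le, if_pos h,
      Fin.predAbove_castSucc_of_le _ _ (le_of_lt h)]
  · have h1 : l.castSucc ≤ t.castSucc := not_lt.mp h
    rw [Fin.succAbove_of_le_castSucc _ _ h1, if_neg h,
      if_neg (not_le.mpr (Fin.castSucc_lt_succ_iff.mpr (Fin.castSucc_le_castSucc_iff.mp h1))),
      Fin.predAbove_succ_of_le _ _ (Fin.castSucc_le_castSucc_iff.mp h1)]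

theorem Chain.prism_face_succ (i : Fin (n + 1)) (τ : Chain n m) (l : Fin (m + 1))
    (t : Fin (m + 1)) :
    τ.prism i l (l.succ.succAbove t) = τ.step i (l + 1) t := by
  change (if _ then _ else _) = if _ then _ else _
  by_cases h : t.val < l + 1
  · have h0 : t ≤ l := Nat.lt_succ_iff.mp h
    have h1 : t.castSucc < l.succ := h
    rw [Fin.succAbove_of_castSucc_lt _ _ h1, if_pos (Fin.castSucc_le_castSucc_iff.mpr h0), if_pos h,
      Fin.predAbove_castSucc_of_le _ _ h0]
  · have h1 : l.succ ≤ t.castSucc := not_lt.mp h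
    have h2 : l ≤ t := (Nat.lt_of_lt_of_le (Nat.lt_succ_self _) (not_lt.mp h)).le
    rw [Fin.succAbove_of_le_castSucc _ _ h1, if_neg h,
      if_neg (not_le.mpr (Fin.castSucc_lt_succ_iff.mpr h2)),
      Fin.predAbove_succ_of_le _ _ h2]

end Chains

/-! ### The strict resolution attached to a coherent system -/

namespace CoherentSystem

variable {k : Type u} [Field k] {n : ℕ} {X : TopCat.{u}} {U : Fin (n + 1) → Opens X}
  (C : CoherentSystem k U)

/-- The restriction morphism `F b V ⟶ F b W`. -/
abbrev res (b : Fin (n + 1)) {V W : Opens X} (h : W ≤ V) :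
    (C.F b).obj (op V) ⟶ (C.F b).obj (op W) := (C.F b).map (homOfLE h).op

theorem res_comp (b : Fin (n + 1)) {V W Y : Opens X} (h : W ≤ V) (h' : Y ≤ W) :
    C.res b h ≫ C.res b h' = C.res b (h'.trans h) := by
  rw [← Functor.map_comp]
  rfl

theorem res_self (b : Fin (n + 1)) {V : Opens X} (h : V ≤ V) : C.res b h = 𝟙 _ :=
  (C.F b).map_id _

/-- Chains of sets of indices `≥ i`, with an element of the smallest set. -/
structure Idx (n : ℕ) (i : Fin (n + 1)) : Type u where
  m : ℕ
  τ : Chain n m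
  b : Fin (n + 1)
  hb : b ∈ τ 0
  hi : ∀ j ∈ τ (Fin.last m), i ≤ j

/-- The values of a section at an index. -/
abbrev component {i : Fin (n + 1)} (V : Opens X) (x : Idx.{u} n i) : DGP0Alg k :=
  tensorObj ((C.F x.b).obj (op (V ⊓ (x.τ (Fin.last x.m)).inf U))) x.m

/-- The equations for the sections of the resolution. -/
inductive Con (U : Fin (n + 1) → Opens X) (i : Fin (n + 1)) (V : Opens X) : Type u where
  | pull {m m' : ℕ} (τ : Chain n m) (θ : Fin (m' + 1) →o Fin (m + 1)) (b : Fin (n + 1))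
      (hb : b ∈ τ 0) (hi : ∀ j ∈ τ (Fin.last m), i ≤ j) (hb' : b ∈ τ.comp θ 0)
      (hi' : ∀ j ∈ τ.comp θ (Fin.last m'), i ≤ j) (W : Opens X)
      (hW : W ≤ V ⊓ (τ (Fin.last m)).inf U) (hW' : W ≤ V ⊓ (τ.comp θ (Fin.last m')).inf U)
  | cut {m : ℕ} (τ : Chain n m) (j b : Fin (n + 1)) (hj : j ∈ τ 0) (hb : b ∈ τ 0) (hjb : j ≤ b)
      (hi : ∀ j ∈ τ (Fin.last m), i ≤ j) (hj' : j ∈ τ.filter (· ≤ j) 0)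
      (hi' : ∀ l ∈ τ.filter (· ≤ j) (Fin.last m), i ≤ l) (W : Opens X)
      (hW : W ≤ V ⊓ (τ (Fin.last m)).inf U)
      (hW' : W ≤ V ⊓ (τ.filter (· ≤ j) (Fin.last m)).inf U)

variable {i : Fin (n + 1)} {V : Opens X}

/-- The index of the left hand side of an equation. -/
def Con.lhs (c : Con U i V) : Idx.{u} n i :=
  Con.casesOn c (fun τ θ b _ _ hb' hi' _ _ _ => ⟨_, τ.comp θ, b, hb', hi'⟩)
    (fun τ _ b _ hb _ hi _ _ _ _ _ => ⟨_, τ, b, hb, hi⟩)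

/-- The index of the right hand side of an equation. -/
def Con.rhs (c : Con U i V) : Idx.{u} n i :=
  Con.casesOn c (fun τ _ b hb hi _ _ _ _ _ => ⟨_, τ, b, hb, hi⟩)
    (fun τ j _ _ _ _ _ hj' hi' _ _ _ => ⟨_, τ.filter (· ≤ j), j, hj', hi'⟩)

/-- The algebra in which an equation takes place. -/
def Con.alg (c : Con U i V) : DGP0Alg k :=
  Con.casesOn c (fun {_ m'} _ _ b _ _ _ _ W _ _ => tensorObj ((C.F b).obj (op W)) m')
    (fun {m} _ _ b _ _ _ _ _ _ W _ _ => tensorObj ((C.F b).obj (op W)) m)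

/-- The left hand side of an equation. -/
def Con.left (c : Con U i V) : C.component V c.lhs ⟶ c.alg C :=
  Con.rec (motive := fun c => C.component V c.lhs ⟶ c.alg C)
    (fun _ _ b _ _ _ _ _ _ hW' => tensorMap (C.res b hW') id)
    (fun _ _ b _ _ _ _ _ _ _ hW _ => tensorMap (C.res b hW) id) c

/-- The right hand side of an equation. -/
def Con.right (c : Con U i V) : C.component V c.rhs ⟶ c.alg C :=
  Con.rec (motive := fun c => C.component V c.rhs ⟶ c.alg C)
    (fun _ θ b _ _ _ _ _ hW _ => tensorMap (C.res b hW) id ≫ tensorMap (𝟙 _) θ)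
    (fun τ j _ hj hb hjb _ _ _ W hW hW' =>
      tensorMap (C.res j hW') id ≫ extend (C.T τ hj hb hjb W (hW.trans inf_le_right))) c

variable (i V)

/-- The families which satisfy the equations. -/
def subR : GradedSub fun x : Idx.{u} n i => C.component V x :=
  GradedSub.equalizer Con.lhs Con.rhs (Con.alg C) (Con.left C) (Con.right C)

/-- The sections over `V` of the resolution of `F i`. -/
def R : DGP0Alg k := (C.subR i V).toAlg

variable {i V}

/-- The value of a section at a chain, over a smaller open set. -/
def val {m : ℕ} (τ : Chain n m) {b : Fin (n + 1)} (hb : b ∈ τ 0)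
    (hi : ∀ j ∈ τ (Fin.last m), i ≤ j) {W : Opens X} (hW : W ≤ V ⊓ (τ (Fin.last m)).inf U) :
    C.R i V ⟶ tensorObj ((C.F b).obj (op W)) m :=
  (C.subR i V).proj ⟨m, τ, b, hb, hi⟩ ≫ tensorMap (C.res b hW) id

section Values

variable {m m' : ℕ} (τ τ' : Chain n m) {b j : Fin (n + 1)} (hb : b ∈ τ 0)
  (hi : ∀ j ∈ τ (Fin.last m), i ≤ j) {W : Opens X} (hW : W ≤ V ⊓ (τ (Fin.last m)).inf U)

theorem val_res {W' : Opens X} (h : W' ≤ W) :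
    C.val τ hb hi hW ≫ tensorMap (C.res b h) id = C.val τ hb hi (h.trans hW) := by
  refine (Category.assoc _ _ _).trans ?_
  refine congrArg (fun x => (C.subR i V).proj ⟨m, τ, b, hb, hi⟩ ≫ x) ?_
  rw [← C.res_comp b hW h]
  exact (tensorMap_comp _ _ id id).symm

theorem val_congr (e : ∀ t, τ t = τ' t) (hb' : b ∈ τ' 0) (hi' : ∀ j ∈ τ' (Fin.last m), i ≤ j)
    (hW' : W ≤ V ⊓ (τ' (Fin.last m)).inf U) : C.val τ hb hi hW = C.val τ' hb' hi' hW' := by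
  obtain rfl : τ = τ' := OrderHom.ext _ _ (funext e)
  rfl

theorem ext_R {r s : (C.R i V).carrier} (h : ∀ {m : ℕ} (τ : Chain n m) {b : Fin (n + 1)}
    (hb : b ∈ τ 0) (hi : ∀ j ∈ τ (Fin.last m), i ≤ j) {W : Opens X}
    (hW : W ≤ V ⊓ (τ (Fin.last m)).inf U),
    (C.val τ hb hi hW).toAlgHom r = (C.val τ hb hi hW).toAlgHom s) : r = s := by
  refine (C.subR i V).ext fun x => ?_
  have := h x.τ x.hb x.hi le_rfl
  rw [val, C.res_self, tensorMap_id] at this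
  exact this

theorem hom_ext_R {B : DGP0Alg k} {f g : B ⟶ C.R i V} (h : ∀ {m : ℕ} (τ : Chain n m)
    {b : Fin (n + 1)} (hb : b ∈ τ 0) (hi : ∀ j ∈ τ (Fin.last m), i ≤ j) {W : Opens X}
    (hW : W ≤ V ⊓ (τ (Fin.last m)).inf U), f ≫ C.val τ hb hi hW = g ≫ C.val τ hb hi hW) :
    f = g :=
  DGP0Alg.hom_ext fun x => C.ext_R fun τ _ hb hi _ hW =>
    congrArg (fun φ : B ⟶ tensorObj _ _ => φ.toAlgHom x) (h τ hb hi hW)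

/-- The defining equations are imposed on homogeneous families; additivity extends them to all
elements. -/
theorem val_pull (θ : Fin (m' + 1) →o Fin (m + 1)) (hb' : b ∈ τ.comp θ 0)
    (hi' : ∀ j ∈ τ.comp θ (Fin.last m'), i ≤ j)
    (hW' : W ≤ V ⊓ (τ.comp θ (Fin.last m')).inf U) :
    C.val (τ.comp θ) hb' hi' hW' = C.val τ hb hi hW ≫ tensorMap (𝟙 _) θ := by
  refine DGP0Alg.hom_ext fun r => ?_
  refine GradedSub.deg_induction (C.R i V) (Q := fun r => (C.val (τ.comp θ) hb' hi' hW').toAlgHom r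
    = (C.val τ hb hi hW ≫ tensorMap (𝟙 _) θ).toAlgHom r) ?_ ?_ r
  · intro p r hr
    exact ((C.subR i V).mem_of_deg hr).2 (Con.pull τ θ b hb hi hb' hi' W hW hW')
  · intro x y hx hy
    rw [map_add, map_add, hx, hy]

theorem val_cut (hj : j ∈ τ 0) (hjb : j ≤ b) (hj' : j ∈ τ.filter (· ≤ j) 0)
    (hi' : ∀ l ∈ τ.filter (· ≤ j) (Fin.last m), i ≤ l)
    (hW' : W ≤ V ⊓ (τ.filter (· ≤ j) (Fin.last m)).inf U) :
    C.val τ hb hi hW = C.val (τ.filter (· ≤ j)) hj' hi' hW' ≫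
      extend (C.T τ hj hb hjb W (hW.trans inf_le_right)) := by
  refine DGP0Alg.hom_ext fun r => ?_
  refine GradedSub.deg_induction (C.R i V) (Q := fun r => (C.val τ hb hi hW).toAlgHom r
    = (C.val (τ.filter (· ≤ j)) hj' hi' hW' ≫
      extend (C.T τ hj hb hjb W (hW.trans inf_le_right))).toAlgHom r) ?_ ?_ r
  · intro p r hr
    exact ((C.subR i V).mem_of_deg hr).2 (Con.cut τ j b hj hb hjb hi hj' hi' W hW hW')
  · intro x y hx hy
    rw [map_add, map_add, hx, hy]

end Values

/-- A compatible family of values of degree `p`. -/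
structure Family (i : Fin (n + 1)) (V : Opens X) (p : ℤ) where
  v : ∀ {m : ℕ} (τ : Chain n m) {b : Fin (n + 1)} (_ : b ∈ τ 0)
    (_ : ∀ j ∈ τ (Fin.last m), i ≤ j) {W : Opens X} (_ : W ≤ V ⊓ (τ (Fin.last m)).inf U),
    (tensorObj ((C.F b).obj (op W)) m).carrier
  mem : ∀ {m : ℕ} (τ : Chain n m) {b : Fin (n + 1)} (hb : b ∈ τ 0)
    (hi : ∀ j ∈ τ (Fin.last m), i ≤ j) {W : Opens X} (hW : W ≤ V ⊓ (τ (Fin.last m)).inf U),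
    v τ hb hi hW ∈ (tensorObj ((C.F b).obj (op W)) m).deg p
  v_res : ∀ {m : ℕ} (τ : Chain n m) {b : Fin (n + 1)} (hb : b ∈ τ 0)
    (hi : ∀ j ∈ τ (Fin.last m), i ≤ j) {W W' : Opens X} (hW : W ≤ V ⊓ (τ (Fin.last m)).inf U)
    (h : W' ≤ W), (tensorMap (C.res b h) id).toAlgHom (v τ hb hi hW) = v τ hb hi (h.trans hW)
  v_pull : ∀ {m m' : ℕ} (τ : Chain n m) {b : Fin (n + 1)} (hb : b ∈ τ 0)
    (hi : ∀ j ∈ τ (Fin.last m), i ≤ j) {W : Opens X} (hW : W ≤ V ⊓ (τ (Fin.last m)).inf U)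
    (θ : Fin (m' + 1) →o Fin (m + 1)) (hb' : b ∈ τ.comp θ 0)
    (hi' : ∀ j ∈ τ.comp θ (Fin.last m'), i ≤ j)
    (hW' : W ≤ V ⊓ (τ.comp θ (Fin.last m')).inf U),
    v (τ.comp θ) hb' hi' hW' = (tensorMap (𝟙 _) θ).toAlgHom (v τ hb hi hW)
  v_cut : ∀ {m : ℕ} (τ : Chain n m) {j b : Fin (n + 1)} (hj : j ∈ τ 0) (hb : b ∈ τ 0)
    (hjb : j ≤ b) (hi : ∀ j ∈ τ (Fin.last m), i ≤ j) {W : Opens X}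
    (hW : W ≤ V ⊓ (τ (Fin.last m)).inf U) (hj' : j ∈ τ.filter (· ≤ j) 0)
    (hi' : ∀ l ∈ τ.filter (· ≤ j) (Fin.last m), i ≤ l)
    (hW' : W ≤ V ⊓ (τ.filter (· ≤ j) (Fin.last m)).inf U),
    v τ hb hi hW = (extend (C.T τ hj hb hjb W (hW.trans inf_le_right))).toAlgHom
      (v (τ.filter (· ≤ j)) hj' hi' hW')

namespace Family

variable {C} {p : ℤ} (φ : C.Family i V p)

theorem mem_subR : (fun x : Idx.{u} n i => φ.v x.τ x.hb x.hi le_rfl) ∈ (C.subR i V).S p := by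
  refine ⟨fun x => φ.mem x.τ x.hb x.hi le_rfl, ?_⟩
  rintro (⟨τ, θ, b, hb, hi, hb', hi', W, hW, hW'⟩ | ⟨τ, j, b, hj, hb, hjb, hi, hj', hi', W, hW, hW'⟩)
  · refine (φ.v_res (τ.comp θ) hb' hi' le_rfl hW').trans ((φ.v_pull τ hb hi hW θ hb' hi' hW').trans ?_)
    exact congrArg (tensorMap (𝟙 _) θ).toAlgHom (φ.v_res τ hb hi le_rfl hW).symm
  · refine (φ.v_res τ hb hi le_rfl hW).trans ((φ.v_cut τ hj hb hjb hi hW hj' hi' hW').trans ?_)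
    exact congrArg (extend (C.T τ hj hb hjb W (hW.trans inf_le_right))).toAlgHom
      (φ.v_res _ hj' hi' le_rfl hW').symm

/-- The section defined by a compatible family of values. -/
def toR : (C.R i V).carrier := (C.subR i V).elt _ φ.mem_subR

theorem toR_mem : φ.toR ∈ (C.R i V).deg p := (C.subR i V).elt_mem _ φ.mem_subR

theorem val_toR {m : ℕ} (τ : Chain n m) {b : Fin (n + 1)} (hb : b ∈ τ 0)
    (hi : ∀ j ∈ τ (Fin.last m), i ≤ j) {W : Opens X} (hW : W ≤ V ⊓ (τ (Fin.last m)).inf U) :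
    (C.val τ hb hi hW).toAlgHom φ.toR = φ.v τ hb hi hW :=
  φ.v_res τ hb hi le_rfl hW

end Family

/-- The morphism with given compatible values. -/
structure HomFamily (B : DGP0Alg k) (i : Fin (n + 1)) (V : Opens X) where
  v : ∀ {m : ℕ} (τ : Chain n m) {b : Fin (n + 1)} (_ : b ∈ τ 0)
    (_ : ∀ j ∈ τ (Fin.last m), i ≤ j) {W : Opens X} (_ : W ≤ V ⊓ (τ (Fin.last m)).inf U),
    B ⟶ tensorObj ((C.F b).obj (op W)) m
  v_res : ∀ {m : ℕ} (τ : Chain n m) {b : Fin (n + 1)} (hb : b ∈ τ 0)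
    (hi : ∀ j ∈ τ (Fin.last m), i ≤ j) {W W' : Opens X} (hW : W ≤ V ⊓ (τ (Fin.last m)).inf U)
    (h : W' ≤ W), v τ hb hi hW ≫ tensorMap (C.res b h) id = v τ hb hi (h.trans hW)
  v_pull : ∀ {m m' : ℕ} (τ : Chain n m) {b : Fin (n + 1)} (hb : b ∈ τ 0)
    (hi : ∀ j ∈ τ (Fin.last m), i ≤ j) {W : Opens X} (hW : W ≤ V ⊓ (τ (Fin.last m)).inf U)
    (θ : Fin (m' + 1) →o Fin (m + 1)) (hb' : b ∈ τ.comp θ 0)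
    (hi' : ∀ j ∈ τ.comp θ (Fin.last m'), i ≤ j)
    (hW' : W ≤ V ⊓ (τ.comp θ (Fin.last m')).inf U),
    v (τ.comp θ) hb' hi' hW' = v τ hb hi hW ≫ tensorMap (𝟙 _) θ
  v_cut : ∀ {m : ℕ} (τ : Chain n m) {j b : Fin (n + 1)} (hj : j ∈ τ 0) (hb : b ∈ τ 0)
    (hjb : j ≤ b) (hi : ∀ j ∈ τ (Fin.last m), i ≤ j) {W : Opens X}
    (hW : W ≤ V ⊓ (τ (Fin.last m)).inf U) (hj' : j ∈ τ.filter (· ≤ j) 0)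
    (hi' : ∀ l ∈ τ.filter (· ≤ j) (Fin.last m), i ≤ l)
    (hW' : W ≤ V ⊓ (τ.filter (· ≤ j) (Fin.last m)).inf U),
    v τ hb hi hW = v (τ.filter (· ≤ j)) hj' hi' hW' ≫
      extend (C.T τ hj hb hjb W (hW.trans inf_le_right))

namespace HomFamily

variable {C} {B : DGP0Alg k} (φ : C.HomFamily B i V)

/-- The values at an element of degree `p`. -/
def at_ {p : ℤ} (x : B.carrier) (hx : x ∈ B.deg p) : C.Family i V p where
  v τ _ hb hi _ hW := (φ.v τ hb hi hW).toAlgHom x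
  mem τ _ hb hi _ hW := (φ.v τ hb hi hW).map_deg hx
  v_res τ _ hb hi _ _ hW h :=
    congrArg (fun f : B ⟶ tensorObj _ _ => f.toAlgHom x) (φ.v_res τ hb hi hW h)
  v_pull τ _ hb hi _ hW θ hb' hi' hW' :=
    congrArg (fun f : B ⟶ tensorObj _ _ => f.toAlgHom x) (φ.v_pull τ hb hi hW θ hb' hi' hW')
  v_cut τ _ _ hj hb hjb hi _ hW hj' hi' hW' :=
    congrArg (fun f : B ⟶ tensorObj _ _ => f.toAlgHom x)
      (φ.v_cut τ hj hb hjb hi hW hj' hi' hW')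

/-- The morphism with given compatible values. -/
def toHom : B ⟶ C.R i V :=
  (C.subR i V).lift (fun x => φ.v x.τ x.hb x.hi le_rfl) fun _ _ hx => (φ.at_ _ hx).mem_subR

theorem toHom_val {m : ℕ} (τ : Chain n m) {b : Fin (n + 1)} (hb : b ∈ τ 0)
    (hi : ∀ j ∈ τ (Fin.last m), i ≤ j) {W : Opens X} (hW : W ≤ V ⊓ (τ (Fin.last m)).inf U) :
    φ.toHom ≫ C.val τ hb hi hW = φ.v τ hb hi hW :=
  φ.v_res τ hb hi le_rfl hW

end HomFamily

/-- The restriction morphisms. -/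
def resR {i j : Fin (n + 1)} (hij : i ≤ j) {V V' : Opens X} (h : V' ≤ V) : C.R i V ⟶ C.R j V' :=
  HomFamily.toHom (C := C)
    { v := fun τ _ hb hj _ hW => C.val τ hb (fun l hl => hij.trans (hj l hl))
        (hW.trans (inf_le_inf_right _ h))
      v_res := fun τ _ hb _ _ _ _ h' => C.val_res τ hb _ _ h'
      v_pull := fun τ _ hb _ _ _ θ hb' _ _ => C.val_pull τ hb _ _ θ hb' _ _
      v_cut := fun τ _ _ hj hb hjb _ _ _ hj' _ _ => C.val_cut τ hb _ _ hj hjb hj' _ _ }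

theorem resR_val {i j : Fin (n + 1)} (hij : i ≤ j) {V V' : Opens X} (h : V' ≤ V) {m : ℕ}
    (τ : Chain n m) {b : Fin (n + 1)} (hb : b ∈ τ 0)
    (hi : ∀ l ∈ τ (Fin.last m), j ≤ l) {W : Opens X} (hW : W ≤ V' ⊓ (τ (Fin.last m)).inf U) :
    C.resR hij h ≫ C.val τ hb hi hW = C.val τ hb (fun l hl => hij.trans (hi l hl))
      (hW.trans (inf_le_inf_right _ h)) := HomFamily.toHom_val ..

theorem resR_self (i : Fin (n + 1)) (V : Opens X) (hij : i ≤ i) (h : V ≤ V) :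
    C.resR hij h = 𝟙 (C.R i V) :=
  C.hom_ext_R fun τ _ hb hi _ hW => (C.resR_val hij h τ hb hi hW).trans (Category.id_comp _).symm

theorem resR_comp {i j l : Fin (n + 1)} (hij : i ≤ j) (hjl : j ≤ l) {V V' V'' : Opens X}
    (h : V' ≤ V) (h' : V'' ≤ V') :
    C.resR hij h ≫ C.resR hjl h' = C.resR (hij.trans hjl) (h'.trans h) :=
  C.hom_ext_R fun τ _ hb hi _ hW => by
    rw [Category.assoc, C.resR_val hjl h' τ hb hi hW, C.resR_val hij h, C.resR_val]

theorem le_inf_insert {m : ℕ} (τ : Chain n m) (hV : V ≤ U i) {W : Opens X}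
    (hW : W ≤ V ⊓ (τ (Fin.last m)).inf U) : W ≤ (τ.insert i (Fin.last m)).inf U := by
  change W ≤ (Insert.insert i (τ (Fin.last m))).inf U
  rw [Finset.inf_insert]
  exact le_inf ((hW.trans inf_le_left).trans hV) (hW.trans inf_le_right)

theorem le_of_mem {m : ℕ} (τ : Chain n m) {b : Fin (n + 1)} (hb : b ∈ τ 0)
    (hi : ∀ j ∈ τ (Fin.last m), i ≤ j) : i ≤ b := hi b (τ.monotone (Fin.zero_le _) hb)

/-- Since i ≤ j, adjoining i changes nothing between j and b unless i = j, and j already belongs to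
the chain. -/
theorem T_insert {m : ℕ} (τ τ' : Chain n m) (hτ : ∀ t, τ t ⊆ τ' t ∧ τ' t ⊆ Insert.insert i (τ t))
    {j b : Fin (n + 1)} (hj : j ∈ τ 0) (hb : b ∈ τ 0) (hjb : j ≤ b) (hij : i ≤ j) {W : Opens X}
    (hW : W ≤ (τ (Fin.last m)).inf U) (hj' : j ∈ τ' 0) (hb' : b ∈ τ' 0)
    (hW' : W ≤ (τ' (Fin.last m)).inf U) :
    C.T τ' hj' hb' hjb W hW' = C.T τ hj hb hjb W hW := by
  refine C.T_congr _ _ _ _ _ _ _ _ _ fun t => ?_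
  refine subset_antisymm ?_ (Finset.filter_subset_filter _ (hτ t).1)
  intro l hl
  rw [Finset.mem_filter] at hl ⊢
  refine ⟨?_, hl.2⟩
  rcases Finset.mem_insert.mp ((hτ t).2 hl.1) with rfl | h
  · obtain rfl : l = j := le_antisymm hij hl.2.1
    exact τ.monotone (Fin.zero_le _) hj
  · exact h

/-- The morphism from `F i` to its resolution. -/
def sec (hV : V ≤ U i) : (C.F i).obj (op V) ⟶ C.R i V :=
  HomFamily.toHom (C := C)
    { v := fun τ _ hb hi _ hW => C.res i (hW.trans inf_le_left) ≫
        C.T (τ.insert i) (Chain.mem_insert_self i _ _) (Chain.mem_insert i hb)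
          (le_of_mem τ hb hi) _ (le_inf_insert τ hV hW)
      v_res := fun τ _ hb hi _ _ hW h => by
        rw [Category.assoc, ← C.T_res _ _ _ _ _ h, ← Category.assoc, C.res_comp]
      v_pull := fun τ _ hb hi _ hW θ hb' hi' hW' => by
        rw [Category.assoc, ← C.T_pull (τ.insert i) θ]
        rfl
      v_cut := fun τ j b hj hb hjb hi W hW hj' hi' hW' => by
        -- The transition from i to b along τ ∪ {i} factors through j. Its second factor does not
        -- see i, as i ≤ j, and its first factor does not see the indices above j, which gives the
        -- truncated chain.
        rw [Category.assoc, C.T_comp (τ.insert i) (j := j) _ (Chain.mem_insert i hj) _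
          (le_of_mem τ hj hi) hjb]
        rw [C.T_insert (i := i) τ (τ.insert i)
          (fun t => ⟨Finset.subset_insert _ _, subset_rfl⟩) hj hb hjb (le_of_mem τ hj hi)
          (hW.trans inf_le_right)]
        rw [C.T_congr (τ.insert i) ((τ.filter (· ≤ j)).insert i) _ _ _ _
          (Chain.mem_insert_self i _ _) (Chain.mem_insert i hj') (le_inf_insert _ hV hW')]
        intro t
        ext l
        change l ∈ (Insert.insert i (τ t)).filter _ ↔
          l ∈ (Insert.insert i ((τ t).filter (· ≤ j))).filter _
        simp only [Finset.mem_filter, Finset.mem_insert]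
        tauto }

theorem sec_val (hV : V ≤ U i) {m : ℕ} (τ : Chain n m) {b : Fin (n + 1)} (hb : b ∈ τ 0)
    (hi : ∀ j ∈ τ (Fin.last m), i ≤ j) {W : Opens X} (hW : W ≤ V ⊓ (τ (Fin.last m)).inf U) :
    C.sec hV ≫ C.val τ hb hi hW = C.res i (hW.trans inf_le_left) ≫
        C.T (τ.insert i) (Chain.mem_insert_self i _ _) (Chain.mem_insert i hb)
          (le_of_mem τ hb hi) _ (le_inf_insert τ hV hW) := HomFamily.toHom_val ..

theorem sec_res (hV : V ≤ U i) {V' : Opens X} (h : V' ≤ V) :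
    C.sec hV ≫ C.resR le_rfl h = C.res i h ≫ C.sec (h.trans hV) :=
  C.hom_ext_R fun τ _ hb hi _ hW => by
    rw [Category.assoc, C.resR_val, C.sec_val, Category.assoc, C.sec_val, ← Category.assoc,
      C.res_comp]

theorem le_inf_single (hV : V ≤ U i) :
    V ≤ V ⊓ (Chain.single i (Fin.last 0)).inf U := by
  change V ≤ V ⊓ ({i} : Finset (Fin (n + 1))).inf U
  rw [Finset.inf_singleton]
  exact le_inf le_rfl hV

/-- The evaluation of a section at the chain `{i}`. -/
def ev (hV : V ≤ U i) : C.R i V ⟶ tensorObj ((C.F i).obj (op V)) 0 :=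
  C.val (Chain.single i) (Chain.mem_single i _)
    (Chain.le_of_mem_single i _) (le_inf_single hV)

theorem ev_res (hV : V ≤ U i) {V' : Opens X} (h : V' ≤ V) :
    C.resR le_rfl h ≫ C.ev (h.trans hV) = C.ev hV ≫ tensorMap (C.res i h) id := by
  rw [ev, ev, C.resR_val, C.val_res]

/-- At the chain {j} the section transported from i has as value its image along the pair {i, j}.
For i < j this is the data of the first gluing condition. -/
theorem sec_ev {j : Fin (n + 1)} (hij : i ≤ j) (hV : V ≤ U i) {V' : Opens X} (h : V' ≤ V)
    (hV' : V' ≤ U j) (hW) : C.sec hV ≫ C.resR hij h ≫ C.ev hV' = C.res i h ≫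
      C.T ((Chain.single j).insert i) (Chain.mem_insert_self i _ _)
        (Chain.mem_insert i (Chain.mem_single j _)) hij V' hW := by
  rw [ev, C.resR_val, C.sec_val]

end CoherentSystem

/-! ### Values on the simplices of a prism -/

namespace CoherentSystem

variable {k : Type u} [Field k] {n : ℕ} {X : TopCat.{u}} {U : Fin (n + 1) → Opens X}
  (C : CoherentSystem k U) {i : Fin (n + 1)} {V : Opens X}

section Prism

variable {m m' : ℕ} (τ : Chain n m) (l : Fin (m + 1)) {b : Fin (n + 1)}

theorem _root_.P0Glue.Chain.prism_apply (i : Fin (n + 1)) (t : Fin (m + 2)) :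
    τ.prism i l t =
      if t ≤ l.castSucc then τ (l.predAbove t) else Insert.insert i (τ (l.predAbove t)) := rfl

theorem _root_.P0Glue.Chain.step_apply (i : Fin (n + 1)) (l : ℕ) (t : Fin (m + 1)) :
    τ.step i l t = if t.val < l then τ t else Insert.insert i (τ t) := rfl

theorem _root_.P0Glue.Chain.prism_subset (i : Fin (n + 1)) (t : Fin (m + 2)) :
    τ (l.predAbove t) ⊆ τ.prism i l t ∧ τ.prism i l t ⊆ Insert.insert i (τ (l.predAbove t)) := by
  rw [Chain.prism_apply]
  split_ifs
  · exact ⟨subset_rfl, Finset.subset_insert _ _⟩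
  · exact ⟨Finset.subset_insert _ _, subset_rfl⟩

theorem _root_.P0Glue.Chain.step_subset (i : Fin (n + 1)) (l : ℕ) (t : Fin (m + 1)) :
    τ t ⊆ τ.step i l t ∧ τ.step i l t ⊆ Insert.insert i (τ t) := by
  rw [Chain.step_apply]
  split_ifs
  · exact ⟨subset_rfl, Finset.subset_insert _ _⟩
  · exact ⟨Finset.subset_insert _ _, subset_rfl⟩

variable {τ}

/-- Adjoining i does not shrink the open set attached to a chain, because V already lies in U i. It
is here that the comparison of τ with τ ∪ {i} is tied to V ⊆ U i. -/
theorem le_inf_of_subset {J J' : Finset (Fin (n + 1))} (hJ : J' ⊆ Insert.insert i J)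
    (hV : V ≤ U i) {W : Opens X} (hW : W ≤ V ⊓ J.inf U) : W ≤ V ⊓ J'.inf U := by
  refine le_inf (hW.trans inf_le_left) (le_trans ?_ (Finset.inf_mono hJ))
  rw [Finset.inf_insert]
  exact le_inf ((hW.trans inf_le_left).trans hV) (hW.trans inf_le_right)

theorem le_of_subset {J J' : Finset (Fin (n + 1))} (hJ : J' ⊆ Insert.insert i J)
    (hi : ∀ j ∈ J, i ≤ j) : ∀ j ∈ J', i ≤ j := fun j hj =>
  (Finset.mem_insert.mp (hJ hj)).elim (fun e => e.ge) (hi j)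

theorem mem_prism (hb : b ∈ τ 0) (t : Fin (m + 2)) : b ∈ τ.prism i l t :=
  (τ.prism_subset l i t).1 (τ.monotone (Fin.zero_le _) hb)

theorem prism_last_subset : τ.prism i l (Fin.last (m + 1)) ⊆ Insert.insert i (τ (Fin.last m)) :=
  (τ.prism_subset l i _).2.trans (Finset.insert_subset_insert i (τ.monotone (Fin.le_last _)))

/-- The value at a prism over a chain. -/
def prismVal (hV : V ≤ U i) (τ : Chain n m) (l : Fin (m + 1)) {b : Fin (n + 1)} (hb : b ∈ τ 0)
    (hi : ∀ j ∈ τ (Fin.last m), i ≤ j) {W : Opens X} (hW : W ≤ V ⊓ (τ (Fin.last m)).inf U) :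
    C.R i V ⟶ tensorObj ((C.F b).obj (op W)) (m + 1) :=
  C.val (τ.prism i l) (mem_prism l hb 0) (le_of_subset (prism_last_subset l) hi)
    (le_inf_of_subset (prism_last_subset l) hV hW)

/-- The value at a step between a chain and its image under `insert i`. -/
def stepVal (hV : V ≤ U i) (τ : Chain n m) (l : ℕ) {b : Fin (n + 1)} (hb : b ∈ τ 0)
    (hi : ∀ j ∈ τ (Fin.last m), i ≤ j) {W : Opens X} (hW : W ≤ V ⊓ (τ (Fin.last m)).inf U) :
    C.R i V ⟶ tensorObj ((C.F b).obj (op W)) m :=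
  C.val (τ.step i l) ((τ.step_subset i l 0).1 hb) (le_of_subset (τ.step_subset i l _).2 hi)
    (le_inf_of_subset (τ.step_subset i l _).2 hV hW)

variable (τ) (hV : V ≤ U i) (hb : b ∈ τ 0) (hi : ∀ j ∈ τ (Fin.last m), i ≤ j) {W : Opens X}
  (hW : W ≤ V ⊓ (τ (Fin.last m)).inf U)

theorem prismVal_res {W' : Opens X} (h : W' ≤ W) :
    C.prismVal hV τ l hb hi hW ≫ tensorMap (C.res b h) id =
      C.prismVal hV τ l hb hi (h.trans hW) := C.val_res ..

theorem prismVal_pull (θ : Fin (m' + 1) →o Fin (m + 1)) (p : Fin (m' + 1)) (hb' : b ∈ τ.comp θ 0)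
    (hi' : ∀ j ∈ τ.comp θ (Fin.last m'), i ≤ j)
    (hW' : W ≤ V ⊓ (τ.comp θ (Fin.last m')).inf U) :
    C.prismVal hV (τ.comp θ) p hb' hi' hW' =
      C.prismVal hV τ (θ p) hb hi hW ≫ tensorMap (𝟙 _) (prismMap θ p) := by
  have e := Chain.prism_comp_prismHom i τ θ p
  have h1 : b ∈ (τ.prism i (θ p)).comp (prismHom θ p) 0 := by
    rw [e]; exact mem_prism p hb' 0
  have h2 : ∀ j ∈ (τ.prism i (θ p)).comp (prismHom θ p) (Fin.last (m' + 1)), i ≤ j := by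
    rw [e]; exact le_of_subset (prism_last_subset p) hi'
  have h3 : W ≤ V ⊓ ((τ.prism i (θ p)).comp (prismHom θ p) (Fin.last (m' + 1))).inf U := by
    rw [e]; exact le_inf_of_subset (prism_last_subset p) hV hW'
  refine Eq.trans ?_ (C.val_pull (τ.prism i (θ p)) (mem_prism _ hb 0)
    (le_of_subset (prism_last_subset _) hi) (le_inf_of_subset (prism_last_subset _) hV hW)
    (prismHom θ p) h1 h2 h3)
  exact C.val_congr _ _ _ _ _ (fun t => (e t).symm) _ _ _

/-- Truncation at j commutes with adjoining i because i ≤ j. The transition from j to b along the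
prism does not see i, so it is pulled back along the degeneracy from the transition along τ; this is
the form required by `tensorInt_extend`. -/
theorem prismVal_cut {j : Fin (n + 1)} (hj : j ∈ τ 0) (hjb : j ≤ b)
    (hj' : j ∈ τ.filter (· ≤ j) 0) (hi' : ∀ l ∈ τ.filter (· ≤ j) (Fin.last m), i ≤ l)
    (hW' : W ≤ V ⊓ (τ.filter (· ≤ j) (Fin.last m)).inf U) :
    C.prismVal hV τ l hb hi hW = C.prismVal hV (τ.filter (· ≤ j)) l hj' hi' hW' ≫
      extend (C.T τ hj hb hjb W (hW.trans inf_le_right) ≫ tensorMap (𝟙 _) l.predAbove) := by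
  have hij : i ≤ j := le_of_mem τ hj hi
  have e : ∀ t, (τ.prism i l).filter (· ≤ j) t = (τ.filter (· ≤ j)).prism i l t := by
    intro t
    change (τ.prism i l t).filter (· ≤ j) = (τ.filter (· ≤ j)).prism i l t
    rw [Chain.prism_apply, Chain.prism_apply]
    by_cases h : t ≤ l.castSucc
    · rw [if_pos h, if_pos h]
      rfl
    · rw [if_neg h, if_neg h, Finset.filter_insert, if_pos hij]
      rfl
  have h1 : j ∈ (τ.prism i l).filter (· ≤ j) 0 := by rw [e]; exact mem_prism l hj' 0
  have h2 : ∀ a ∈ (τ.prism i l).filter (· ≤ j) (Fin.last (m + 1)), i ≤ a := by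
    rw [e]; exact le_of_subset (prism_last_subset l) hi'
  have h3 : W ≤ V ⊓ ((τ.prism i l).filter (· ≤ j) (Fin.last (m + 1))).inf U := by
    rw [e]; exact le_inf_of_subset (prism_last_subset l) hV hW'
  refine (C.val_cut (τ.prism i l) (mem_prism l hb 0) (le_of_subset (prism_last_subset l) hi)
    (le_inf_of_subset (prism_last_subset l) hV hW) (mem_prism l hj 0) hjb h1 h2 h3).trans ?_
  have e1 := C.val_congr ((τ.prism i l).filter (· ≤ j)) ((τ.filter (· ≤ j)).prism i l) h1 h2 h3 e
    (mem_prism l hj' 0) (le_of_subset (prism_last_subset l) hi')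
    (le_inf_of_subset (prism_last_subset l) hV hW')
  let π : Fin (m + 2) →o Fin (m + 1) := ⟨l.predAbove, Fin.predAbove_right_monotone l⟩
  have hjπ : j ∈ τ.comp π 0 := τ.monotone (Fin.zero_le _) hj
  have hbπ : b ∈ τ.comp π 0 := τ.monotone (Fin.zero_le _) hb
  have hWπ : W ≤ (τ.comp π (Fin.last (m + 1))).inf U :=
    (hW.trans inf_le_right).trans (Finset.inf_mono (τ.monotone (Fin.le_last _)))
  have e2 := (C.T_insert (i := i) (τ.comp π) (τ.prism i l) (fun t => τ.prism_subset l i t) hjπ hbπ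
    hjb hij hWπ (mem_prism l hj 0) (mem_prism l hb 0)
    ((le_inf_of_subset (prism_last_subset l) hV hW).trans inf_le_right)).trans
    (C.T_pull τ π hj hb hjb (hW.trans inf_le_right) hjπ hbπ hWπ)
  exact congrArg₂ (fun x y => x ≫ extend y) e1 e2

theorem prismVal_face :
    C.prismVal hV τ l hb hi hW ≫ tensorMap (𝟙 _) l.castSucc.succAbove =
      C.stepVal hV τ l hb hi hW := by
  have e := τ.prism_face i l
  let δ : Fin (m + 1) →o Fin (m + 2) :=
    ⟨l.castSucc.succAbove, (Fin.strictMono_succAbove _).monotone⟩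
  have h1 : b ∈ (τ.prism i l).comp δ 0 := mem_prism (i := i) l hb (δ 0)
  have h2 : ∀ j ∈ (τ.prism i l).comp δ (Fin.last m), i ≤ j := fun j hj =>
    le_of_subset (prism_last_subset l) hi j ((τ.prism i l).monotone (Fin.le_last _) hj)
  have h3 : W ≤ V ⊓ ((τ.prism i l).comp δ (Fin.last m)).inf U :=
    (le_inf_of_subset (prism_last_subset l) hV hW).trans
      (inf_le_inf_left _ (Finset.inf_mono ((τ.prism i l).monotone (Fin.le_last _))))
  refine (C.val_pull (τ.prism i l) (mem_prism _ hb 0)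
    (le_of_subset (prism_last_subset _) hi) (le_inf_of_subset (prism_last_subset _) hV hW)
    δ h1 h2 h3).symm.trans ?_
  exact C.val_congr _ _ _ _ _ e _ _ _

theorem prismVal_face_succ :
    C.prismVal hV τ l hb hi hW ≫ tensorMap (𝟙 _) l.succ.succAbove =
      C.stepVal hV τ (l + 1) hb hi hW := by
  have e := τ.prism_face_succ i l
  let δ : Fin (m + 1) →o Fin (m + 2) :=
    ⟨l.succ.succAbove, (Fin.strictMono_succAbove _).monotone⟩
  have h1 : b ∈ (τ.prism i l).comp δ 0 := mem_prism (i := i) l hb (δ 0)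
  have h2 : ∀ j ∈ (τ.prism i l).comp δ (Fin.last m), i ≤ j := fun j hj =>
    le_of_subset (prism_last_subset l) hi j ((τ.prism i l).monotone (Fin.le_last _) hj)
  have h3 : W ≤ V ⊓ ((τ.prism i l).comp δ (Fin.last m)).inf U :=
    (le_inf_of_subset (prism_last_subset l) hV hW).trans
      (inf_le_inf_left _ (Finset.inf_mono ((τ.prism i l).monotone (Fin.le_last _))))
  refine (C.val_pull (τ.prism i l) (mem_prism _ hb 0)
    (le_of_subset (prism_last_subset _) hi) (le_inf_of_subset (prism_last_subset _) hV hW)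
    δ h1 h2 h3).symm.trans ?_
  exact C.val_congr _ _ _ _ _ e _ _ _

theorem stepVal_last : C.stepVal hV τ (m + 1) hb hi hW = C.val τ hb hi hW :=
  C.val_congr _ _ _ _ _ (fun t => if_pos t.2) _ _ _

/-- Step 0 is the chain τ ∪ {i}. Truncating it at i leaves the constant chain {i}, where the value
of r is by naturality the constant family given by its evaluation. The truncation equation therefore
expresses the value at τ ∪ {i} as the transport of that evaluation, which is the value of `sec`. -/
theorem stepVal_zero {r : (C.R i V).carrier} {a : ((C.F i).obj (op V)).carrier}
    (h : (C.ev hV).toAlgHom r = (unitHom _ 0).toAlgHom a) :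
    (C.stepVal hV τ 0 hb hi hW).toAlgHom r =
      (C.val τ hb hi hW).toAlgHom ((C.sec hV).toAlgHom a) := by
  let π : Fin (m + 1) →o Fin 1 := ⟨fun _ => 0, fun _ _ _ => le_rfl⟩
  have hWV : W ≤ V := hW.trans inf_le_left
  have e0 : ∀ t, τ.step i 0 t = τ.insert i t := fun t => by
    rw [Chain.step_apply, if_neg (Nat.not_lt_zero _)]
    rfl
  -- All indices of τ are ≥ i, so only i survives the truncation.
  have e1 : ∀ t, (τ.insert i).filter (· ≤ i) t = (Chain.single i).comp π t := by
    intro t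
    change (Insert.insert i (τ t)).filter _ = {i}
    ext j
    simp only [Finset.mem_filter, Finset.mem_insert, Finset.mem_singleton]
    constructor
    · rintro ⟨rfl | hj, hji⟩
      · rfl
      · exact le_antisymm hji (hi j (τ.monotone (Fin.le_last _) hj))
    · rintro rfl
      exact ⟨Or.inl rfl, le_rfl⟩
  have hins : ∀ j ∈ τ.insert i (Fin.last m), i ≤ j := le_of_subset subset_rfl hi
  have hWins : W ≤ V ⊓ (τ.insert i (Fin.last m)).inf U := le_inf_of_subset subset_rfl hV hW
  have h1 : i ∈ (τ.insert i).filter (· ≤ i) 0 := by rw [e1]; exact Chain.mem_single i 0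
  have h2 : ∀ a ∈ (τ.insert i).filter (· ≤ i) (Fin.last m), i ≤ a := by
    rw [e1]; exact Chain.le_of_mem_single i 0
  have hWs : W ≤ V ⊓ (Chain.single i (Fin.last 0)).inf U := hWV.trans (le_inf_single hV)
  have h3 : W ≤ V ⊓ ((τ.insert i).filter (· ≤ i) (Fin.last m)).inf U := by
    rw [e1]; exact hWs
  have hib := le_of_mem τ hb hi
  have s1 : C.stepVal hV τ 0 hb hi hW = C.val (τ.insert i) (Chain.mem_insert i hb) hins hWins :=
    C.val_congr _ _ _ _ _ e0 _ _ _
  have s2 := C.val_cut (τ.insert i) (Chain.mem_insert i hb) hins hWins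
    (Chain.mem_insert_self i τ 0) hib h1 h2 h3
  have s3 : C.val ((τ.insert i).filter (· ≤ i)) h1 h2 h3 =
      C.val ((Chain.single i).comp π) (Chain.mem_single i 0) (Chain.le_of_mem_single i 0) hWs :=
    C.val_congr _ _ _ _ _ e1 _ _ _
  have s4 := C.val_pull (Chain.single i) (Chain.mem_single i 0) (Chain.le_of_mem_single i 0) hWs π
    (Chain.mem_single i 0) (Chain.le_of_mem_single i 0) hWs
  have s5 := C.val_res (Chain.single i) (Chain.mem_single i 0) (Chain.le_of_mem_single i 0)
    (le_inf_single hV) hWV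
  have s6 : (C.val ((τ.insert i).filter (· ≤ i)) h1 h2 h3).toAlgHom r =
      (unitHom _ m).toAlgHom ((C.res i hWV).toAlgHom a) := by
    rw [s3, s4, ← s5]
    change (tensorMap (𝟙 _) π).toAlgHom ((tensorMap (C.res i hWV) id).toAlgHom
      ((C.ev hV).toAlgHom r)) = _
    rw [h]
    refine (congrArg (tensorMap (𝟙 _) π).toAlgHom (congrArg (fun f :
      (C.F i).obj (op V) ⟶ tensorObj ((C.F i).obj (op W)) 0 => f.toAlgHom a)
      (unitHom_tensorMap (C.res i hWV) id))).trans ?_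
    exact congrArg (fun f : (C.F i).obj (op W) ⟶ tensorObj ((C.F i).obj (op W)) m =>
      f.toAlgHom ((C.res i hWV).toAlgHom a))
      ((unitHom_tensorMap (𝟙 ((C.F i).obj (op W))) π).trans (Category.id_comp _))
  rw [s1, s2]
  refine (congrArg (extend (C.T (τ.insert i) (Chain.mem_insert_self i τ 0) (Chain.mem_insert i hb)
    hib W (hWins.trans inf_le_right))).toAlgHom s6).trans ?_
  refine (congrArg (fun f : (C.F i).obj (op W) ⟶ tensorObj ((C.F b).obj (op W)) m =>
    f.toAlgHom ((C.res i hWV).toAlgHom a)) (unitHom_extend _)).trans ?_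
  exact (congrArg (fun f : (C.F i).obj (op V) ⟶ tensorObj ((C.F b).obj (op W)) m =>
    f.toAlgHom a) (C.sec_val hV τ hb hi hW)).symm

end Prism

/-! ### The contracting homotopy -/

section Homotopy

variable [CharZero k]

/-- The values of the contracting homotopy. -/
def homotopyVal (hV : V ≤ U i) (r : (C.R i V).carrier) {m : ℕ} (τ : Chain n m) {b : Fin (n + 1)}
    (hb : b ∈ τ 0) (hi : ∀ j ∈ τ (Fin.last m), i ≤ j) {W : Opens X}
    (hW : W ≤ V ⊓ (τ (Fin.last m)).inf U) : TensorOmega ((C.F b).obj (op W)) m :=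
  ∑ l : Fin (m + 1), tensorInt ((C.F b).obj (op W)) l ((C.prismVal hV τ l hb hi hW).toAlgHom r)

section Val

variable (hV : V ≤ U i) (r : (C.R i V).carrier) {m m' : ℕ} (τ : Chain n m) {b : Fin (n + 1)}
    (hb : b ∈ τ 0) (hi : ∀ j ∈ τ (Fin.last m), i ≤ j) {W : Opens X}
    (hW : W ≤ V ⊓ (τ (Fin.last m)).inf U)

theorem homotopyVal_mem {p : ℤ} (hr : r ∈ (C.R i V).deg p) :
    C.homotopyVal hV r τ hb hi hW ∈ (tensorObj ((C.F b).obj (op W)) m).deg (p - 1) :=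
  sum_mem fun l _ => tensorInt_mem l ((C.prismVal hV τ l hb hi hW).map_deg hr)

theorem homotopyVal_res {W' : Opens X} (h : W' ≤ W) :
    (tensorMap (C.res b h) id).toAlgHom (C.homotopyVal hV r τ hb hi hW) =
      C.homotopyVal hV r τ hb hi (h.trans hW) := by
  refine (map_sum (tensorMap (C.res b h) id).toAlgHom _ _).trans ?_
  refine Finset.sum_congr rfl fun l _ => ?_
  refine (tensorMap_id_tensorInt (C.res b h) l _).trans ?_
  refine congrArg (tensorInt ((C.F b).obj (op W')) l) ?_
  exact congrArg (fun f : C.R i V ⟶ tensorObj ((C.F b).obj (op W')) (m + 1) => f.toAlgHom r)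
    (C.prismVal_res τ l hV hb hi hW h)

/-- The integral over a single simplex of the prism pulls back to the sum over the fibre of θ.
Summed over all l, these fibres exhaust the vertices exactly once, so only the total is natural. -/
theorem homotopyVal_pull (θ : Fin (m' + 1) →o Fin (m + 1)) (hb' : b ∈ τ.comp θ 0)
    (hi' : ∀ j ∈ τ.comp θ (Fin.last m'), i ≤ j)
    (hW' : W ≤ V ⊓ (τ.comp θ (Fin.last m')).inf U) :
    C.homotopyVal hV r (τ.comp θ) hb' hi' hW' =
      (tensorMap (𝟙 _) θ).toAlgHom (C.homotopyVal hV r τ hb hi hW) := by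
  have h1 : ∀ l : Fin (m + 1), (tensorMap (𝟙 _) θ).toAlgHom (tensorInt ((C.F b).obj (op W)) l
      ((C.prismVal hV τ l hb hi hW).toAlgHom r)) = ∑ q with θ q = l,
        tensorInt ((C.F b).obj (op W)) q ((C.prismVal hV (τ.comp θ) q hb' hi' hW').toAlgHom r) := by
    intro l
    refine (tensorMap_tensorInt (𝟙 _) θ θ.monotone l _).trans ?_
    refine Finset.sum_congr rfl fun q hq => ?_
    obtain rfl : θ q = l := (Finset.mem_filter.mp hq).2
    refine congrArg (tensorInt ((C.F b).obj (op W)) q) ?_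
    exact congrArg (fun f : C.R i V ⟶ tensorObj ((C.F b).obj (op W)) (m' + 1) => f.toAlgHom r)
      (C.prismVal_pull τ hV hb hi hW θ q hb' hi' hW').symm
  refine Eq.trans ?_ (map_sum (tensorMap (𝟙 _) θ).toAlgHom _ _).symm
  refine Eq.trans ?_ (Finset.sum_congr rfl fun l _ => (h1 l).symm)
  exact (Finset.sum_fiberwise _ _ _).symm

/-- The equation holds simplex by simplex of the prism, since integration is linear over the forms
on the base. -/
theorem homotopyVal_cut {j : Fin (n + 1)} (hj : j ∈ τ 0) (hjb : j ≤ b)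
    (hj' : j ∈ τ.filter (· ≤ j) 0) (hi' : ∀ l ∈ τ.filter (· ≤ j) (Fin.last m), i ≤ l)
    (hW' : W ≤ V ⊓ (τ.filter (· ≤ j) (Fin.last m)).inf U) :
    C.homotopyVal hV r τ hb hi hW = (extend (C.T τ hj hb hjb W (hW.trans inf_le_right))).toAlgHom
      (C.homotopyVal hV r (τ.filter (· ≤ j)) hj' hi' hW') := by
  refine Eq.trans ?_ (map_sum (extend (C.T τ hj hb hjb W (hW.trans inf_le_right))).toAlgHom _ _).symm
  refine Finset.sum_congr rfl fun l _ => ?_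
  refine Eq.trans ?_ (tensorInt_extend l (C.T τ hj hb hjb W (hW.trans inf_le_right)) _ rfl _)
  refine congrArg (tensorInt ((C.F b).obj (op W)) l) ?_
  exact congrArg (fun f : C.R i V ⟶ tensorObj ((C.F b).obj (op W)) (m + 1) => f.toAlgHom r)
    (C.prismVal_cut τ l hV hb hi hW hj hjb hj' hi' hW')

end Val

/-- The contracting homotopy. -/
def homotopyFamily (hV : V ≤ U i) {p : ℤ} (r : (C.R i V).carrier) (hr : r ∈ (C.R i V).deg p) :
    C.Family i V (p - 1) where
  v τ _ hb hi _ hW := C.homotopyVal hV r τ hb hi hW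
  mem τ _ hb hi _ hW := C.homotopyVal_mem hV r τ hb hi hW hr
  v_res τ _ hb hi _ _ hW h := C.homotopyVal_res hV r τ hb hi hW h
  v_pull τ _ hb hi _ hW θ hb' hi' hW' := C.homotopyVal_pull hV r τ hb hi hW θ hb' hi' hW'
  v_cut τ _ _ hj hb hjb hi _ hW hj' hi' hW' :=
    C.homotopyVal_cut hV r τ hb hi hW hj hjb hj' hi' hW'

/-- A closed section is cohomologous to the image of its evaluation. -/
theorem exists_homotopy (hV : V ≤ U i) {p : ℤ} {r : (C.R i V).carrier}
    (hr : r ∈ (C.R i V).deg p) (hd : (C.R i V).d r = 0) {a : ((C.F i).obj (op V)).carrier}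
    (h : (C.ev hV).toAlgHom r = (unitHom _ 0).toAlgHom a) :
    ∃ e ∈ (C.R i V).deg (p - 1), (C.sec hV).toAlgHom a = r + (C.R i V).d e := by
  refine ⟨(C.homotopyFamily hV r hr).toR, Family.toR_mem _, ?_⟩
  refine C.ext_R fun {m} τ b hb hi W hW => ?_
  rw [map_add, (C.val τ hb hi hW).map_d, Family.val_toR, ← C.stepVal_zero τ hV hb hi hW h]
  -- As r is closed, Stokes' formula on the l-th simplex of the prism leaves only its faces l and l
  -- + 1.
  have key : ∀ l : Fin (m + 1), (tensorObj ((C.F b).obj (op W)) m).d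
      (tensorInt ((C.F b).obj (op W)) l ((C.prismVal hV τ l hb hi hW).toAlgHom r)) =
      (C.stepVal hV τ l hb hi hW).toAlgHom r - (C.stepVal hV τ (l + 1) hb hi hW).toAlgHom r := by
    intro l
    have := tensorInt_stokes l ((C.prismVal hV τ l hb hi hW).toAlgHom r)
    have hz : TensorOmega.d ((C.F b).obj (op W)) (m + 1)
        ((C.prismVal hV τ l hb hi hW).toAlgHom r) = 0 := by
      refine ((C.prismVal hV τ l hb hi hW).map_d r).symm.trans ?_
      rw [hd, map_zero]
    rw [hz, map_zero, add_zero] at this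
    refine this.trans ?_
    rw [← C.prismVal_face τ l hV hb hi hW, ← C.prismVal_face_succ τ l hV hb hi hW]
    rfl
  -- The faces shared by consecutive simplices cancel, and only the two ends of the prism remain.
  have hs : (tensorObj ((C.F b).obj (op W)) m).d (C.homotopyVal hV r τ hb hi hW) =
      (C.stepVal hV τ 0 hb hi hW).toAlgHom r - (C.stepVal hV τ (m + 1) hb hi hW).toAlgHom r := by
    rw [homotopyVal]
    refine (map_sum (tensorObj ((C.F b).obj (op W)) m).d _ _).trans
      ((Finset.sum_congr rfl fun l _ => key l).trans ?_)
    rw [Fin.sum_univ_eq_sum_range (fun l => (C.stepVal hV τ l hb hi hW).toAlgHom r -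
      (C.stepVal hV τ (l + 1) hb hi hW).toAlgHom r) (m + 1)]
    exact Finset.sum_range_sub' (fun l => (C.stepVal hV τ l hb hi hW).toAlgHom r) (m + 1)
  change _ = _ + (tensorObj ((C.F b).obj (op W)) m).d (C.homotopyVal hV r τ hb hi hW)
  rw [hs, C.stepVal_last]
  exact (add_sub_cancel _ _).symm

end Homotopy

end CoherentSystem

/-! ### Stalks and the associated sheaf -/

namespace Sheafification

variable {k : Type u} [Field k] {X : TopCat.{u}} (P : (Opens X)ᵒᵖ ⥤ DGP0Alg k)

/-- The open neighbourhoods of `x`, ordered by reverse inclusion. -/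
abbrev Nhds (x : X) : Type u := {W : Opens X // x ∈ W}ᵒᵈ

instance (x : X) : Nonempty (Nhds x) := ⟨OrderDual.toDual ⟨⊤, trivial⟩⟩

instance (x : X) : IsDirectedOrder (Nhds x) where
  directed a b := ⟨OrderDual.toDual ⟨(OrderDual.ofDual a).1 ⊓ (OrderDual.ofDual b).1,
    (OrderDual.ofDual a).2, (OrderDual.ofDual b).2⟩,
    (inf_le_left : _ ⊓ (OrderDual.ofDual b).1 ≤ (OrderDual.ofDual a).1),
    (inf_le_right : (OrderDual.ofDual a).1 ⊓ _ ≤ (OrderDual.ofDual b).1)⟩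

/-- The restriction to a smaller open set. -/
abbrev restr {V W : Opens X} (h : W ≤ V) : P.obj (op V) ⟶ P.obj (op W) := P.map (homOfLE h).op

theorem restr_comp {V W Y : Opens X} (h : W ≤ V) (h' : Y ≤ W) (a : (P.obj (op V)).carrier) :
    (restr P h').toAlgHom ((restr P h).toAlgHom a) = (restr P (h'.trans h)).toAlgHom a := by
  have : restr P h ≫ restr P h' = restr P (h'.trans h) := by
    rw [← Functor.map_comp]
    rfl
  exact congrArg (fun f : P.obj (op V) ⟶ P.obj (op Y) => f.toAlgHom a) this

theorem restr_self {V : Opens X} (h : V ≤ V) (a : (P.obj (op V)).carrier) :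
    (restr P h).toAlgHom a = a :=
  congrArg (fun f : P.obj (op V) ⟶ P.obj (op V) => f.toAlgHom a) (P.map_id _)

/-- The sections over the neighbourhoods of a point. -/
abbrev system (x : X) (W : Nhds x) : DGP0Alg k := P.obj (op (OrderDual.ofDual W).1)

/-- The restriction maps between neighbourhoods of a point. -/
abbrev systemMap (x : X) (W W' : Nhds x) (h : W ≤ W') : system P x W ⟶ system P x W' :=
  restr P (V := (OrderDual.ofDual W).1) (W := (OrderDual.ofDual W').1) h

instance (x : X) : DirectedSystem (fun W => (system P x W).carrier)
    (fun W W' h => (systemMap P x W W' h).toAlgHom) where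
  map_self _ a := restr_self P _ a
  map_map {_ _ _} _ _ a := restr_comp P _ _ a

/-- The stalk of a presheaf of differential `P₀`-algebras. -/
abbrev stalk (x : X) : DGP0Alg k := Colim.toAlg (system P x) (systemMap P x)

/-- The germ at a point. -/
def germ {W : Opens X} (x : X) (hx : x ∈ W) : P.obj (op W) ⟶ stalk P x :=
  Colim.ofHom (system P x) (systemMap P x) (OrderDual.toDual ⟨W, hx⟩)

theorem germ_restr {V W : Opens X} (h : W ≤ V) (x : X) (hx : x ∈ W) (a : (P.obj (op V)).carrier) :
    (germ P x hx).toAlgHom ((restr P h).toAlgHom a) = (germ P x (h hx)).toAlgHom a :=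
  Colim.of_map (G := system P x) (f := systemMap P x) (i := OrderDual.toDual ⟨V, h hx⟩)
    (j := OrderDual.toDual ⟨W, hx⟩) h a

theorem exists_restr_eq_zero {V : Opens X} {x : X} (hx : x ∈ V) {a : (P.obj (op V)).carrier}
    (h : (germ P x hx).toAlgHom a = 0) :
    ∃ W, ∃ hW : W ≤ V, x ∈ W ∧ (restr P hW).toAlgHom a = 0 := by
  obtain ⟨j, hj, e⟩ := Colim.of_eq_zero (G := system P x) (f := systemMap P x)
    (i := OrderDual.toDual ⟨V, hx⟩) h
  exact ⟨(OrderDual.ofDual j).1, hj, (OrderDual.ofDual j).2, e⟩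

/-- A family of germs is locally given by homogeneous sections. -/
def IsLocal (V : Opens X) (p : ℤ) (s : ∀ x : V, (stalk P x.1).carrier) : Prop :=
  ∀ x : V, ∃ W, ∃ hW : W ≤ V, x.1 ∈ W ∧ ∃ a ∈ (P.obj (op W)).deg p, ∀ y (hy : y ∈ W),
    s ⟨y, hW hy⟩ = (germ P y hy).toAlgHom a

variable {P}

theorem IsLocal.exists₂ {V : Opens X} {p q : ℤ} {s t : ∀ x : V, (stalk P x.1).carrier}
    (hs : IsLocal P V p s) (ht : IsLocal P V q t) (x : V) : ∃ W, ∃ hW : W ≤ V, x.1 ∈ W ∧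
      ∃ a ∈ (P.obj (op W)).deg p, ∃ b ∈ (P.obj (op W)).deg q, ∀ y (hy : y ∈ W),
        s ⟨y, hW hy⟩ = (germ P y hy).toAlgHom a ∧ t ⟨y, hW hy⟩ = (germ P y hy).toAlgHom b := by
  obtain ⟨W, hW, hx, a, ha, h⟩ := hs x
  obtain ⟨W', hW', hx', b, hb, h'⟩ := ht x
  refine ⟨W ⊓ W', inf_le_left.trans hW, ⟨hx, hx'⟩, _, (restr P inf_le_left).map_deg ha, _,
    (restr P inf_le_right).map_deg hb, fun y hy => ⟨?_, ?_⟩⟩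
  · rw [germ_restr]; exact h y hy.1
  · rw [germ_restr]; exact h' y hy.2

variable (P)

/-- The families of germs which are locally given by sections. -/
def subSections (V : Opens X) : GradedSub fun x : V => stalk P x.1 where
  S p :=
    { carrier := {s | IsLocal P V p s}
      zero_mem' := fun x => ⟨V, le_rfl, x.2, 0, zero_mem _, fun y hy => (map_zero _).symm⟩
      add_mem' := fun hs ht x => by
        obtain ⟨W, hW, hx, a, ha, b, hb, h⟩ := IsLocal.exists₂ hs ht x
        refine ⟨W, hW, hx, a + b, add_mem ha hb, fun y hy => ?_⟩
        rw [map_add, ← (h y hy).1, ← (h y hy).2]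
        rfl
      smul_mem' := fun c s hs x => by
        obtain ⟨W, hW, hx, a, ha, h⟩ := hs x
        refine ⟨W, hW, hx, c • a, Submodule.smul_mem _ c ha, fun y hy => ?_⟩
        rw [map_smul, ← h y hy]
        rfl }
  mem_deg hs x := by
    obtain ⟨W, hW, hx, a, ha, h⟩ := hs x
    have := (germ P x.1 hx).map_deg ha
    rw [← h] at this
    exact this
  one_mem x := ⟨V, le_rfl, x.2, 1, SetLike.GradedOne.one_mem, fun y hy => (map_one _).symm⟩
  mul_mem hs ht x := by
    obtain ⟨W, hW, hx, a, ha, b, hb, h⟩ := IsLocal.exists₂ hs ht x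
    refine ⟨W, hW, hx, a * b, SetLike.GradedMul.mul_mem ha hb, fun y hy => ?_⟩
    rw [map_mul, ← (h y hy).1, ← (h y hy).2]
    rfl
  bracket_mem hs ht x := by
    obtain ⟨W, hW, hx, a, ha, b, hb, h⟩ := IsLocal.exists₂ hs ht x
    refine ⟨W, hW, hx, _, (P.obj (op W)).bracket_mem ha hb, fun y hy => ?_⟩
    rw [(germ P y hy).map_bracket, ← (h y hy).1, ← (h y hy).2]
  d_mem hs x := by
    obtain ⟨W, hW, hx, a, ha, h⟩ := hs x
    refine ⟨W, hW, hx, _, (P.obj (op W)).d_mem ha, fun y hy => ?_⟩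
    rw [(germ P y hy).map_d, ← h y hy]

/-- The sections of the associated sheaf. -/
def obj (V : Opens X) : DGP0Alg k := (subSections P V).toAlg

/-- The germ of a section of the associated sheaf. -/
def germAt {V : Opens X} (x : X) (hx : x ∈ V) : obj P V ⟶ stalk P x :=
  (subSections P V).proj ⟨x, hx⟩

variable {P}

theorem germAt_isLocal {V : Opens X} {p : ℤ} {b : (obj P V).carrier} (hb : b ∈ (obj P V).deg p) :
    IsLocal P V p fun x => (germAt P x.1 x.2).toAlgHom b := hb

theorem obj_ext {V : Opens X} {a b : (obj P V).carrier}
    (h : ∀ x (hx : x ∈ V), (germAt P x hx).toAlgHom a = (germAt P x hx).toAlgHom b) : a = b :=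
  (subSections P V).ext fun x => h x.1 x.2

theorem hom_ext {E : DGP0Alg k} {V : Opens X} {f g : E ⟶ obj P V}
    (h : ∀ x (hx : x ∈ V), f ≫ germAt P x hx = g ≫ germAt P x hx) : f = g :=
  (subSections P V).hom_ext fun x => h x.1 x.2

/-- The morphism to the sections of the associated sheaf with given germs. -/
def liftObj {E : DGP0Alg k} {V : Opens X} (f : ∀ x (_ : x ∈ V), E ⟶ stalk P x)
    (hf : ∀ p, ∀ e ∈ E.deg p, IsLocal P V p fun x => (f x.1 x.2).toAlgHom e) : E ⟶ obj P V :=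
  (subSections P V).lift (fun x => f x.1 x.2) hf

theorem liftObj_germAt {E : DGP0Alg k} {V : Opens X} (f : ∀ x (_ : x ∈ V), E ⟶ stalk P x)
    (hf : ∀ p, ∀ e ∈ E.deg p, IsLocal P V p fun x => (f x.1 x.2).toAlgHom e) (x : X)
    (hx : x ∈ V) : liftObj f hf ≫ germAt P x hx = f x hx := rfl

theorem IsLocal.restrict {V V' : Opens X} (h : V' ≤ V) {p : ℤ} {s : ∀ x : V, (stalk P x.1).carrier}
    (hs : IsLocal P V p s) : IsLocal P V' p fun x => s ⟨x.1, h x.2⟩ := fun x => by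
  obtain ⟨W, hW, hx, a, ha, e⟩ := hs ⟨x.1, h x.2⟩
  refine ⟨W ⊓ V', inf_le_right, ⟨hx, x.2⟩, _, (restr P inf_le_left).map_deg ha, fun y hy => ?_⟩
  rw [germ_restr]
  exact e y hy.1

/-- The restriction maps of the associated sheaf. -/
def map {V V' : Opens X} (h : V' ≤ V) : obj P V ⟶ obj P V' :=
  liftObj (fun x hx => germAt P x (h hx)) fun _ _ he => (germAt_isLocal he).restrict h

theorem map_germAt {V V' : Opens X} (h : V' ≤ V) (x : X) (hx : x ∈ V') :
    map h ≫ germAt P x hx = germAt P x (h hx) := rfl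

variable (P)

/-- The presheaf underlying the associated sheaf. -/
def presheaf : TopCat.Presheaf (DGP0Alg k) X where
  obj V := obj P V.unop
  map f := map (leOfHom f.unop)
  map_id _ := rfl
  map_comp _ _ := rfl

/-- The sheaf condition is tested on morphisms out of an arbitrary algebra E. Such morphisms are
determined by their germs, so they glue uniquely; the glued family of germs is locally given by
sections of the same degree because each piece is. -/
theorem isSheaf : (presheaf P).IsSheaf := by
  intro E
  rw [← isSheaf_iff_isSheaf_of_type]
  refine (TopCat.Presheaf.isSheaf_iff_isSheafUniqueGluing_types
    (presheaf P ⋙ coyoneda.obj (op E) : TopCat.Presheaf (Type u) X)).mpr ?_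
  intro ι U sf hsf
  have hsf' : ∀ i j x (hi : x ∈ U i) (hj : x ∈ U j),
      (sf i : E ⟶ obj P (U i)) ≫ germAt P x hi = (sf j : E ⟶ obj P (U j)) ≫ germAt P x hj :=
    fun i j x hi hj => congrArg (fun f : E ⟶ obj P (U i ⊓ U j) => f ≫ germAt P x ⟨hi, hj⟩) (hsf i j)
  have hex : ∀ x, x ∈ iSup U → ∃ i, x ∈ U i := fun x hx => Opens.mem_iSup.mp hx
  -- A member of the cover is chosen at each point. Compatibility makes the germ independent of the
  -- choice, so near a given point a single member may be used.
  choose c hc using hex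
  let g : ∀ i, E ⟶ obj P (U i) := sf
  have hg : ∀ i j x (hi : x ∈ U i) (hj : x ∈ U j),
    g i ≫ germAt P x hi = g j ≫ germAt P x hj := hsf'
  obtain ⟨s, hs⟩ : ∃ s : E ⟶ obj P (iSup U), ∀ x (hx : x ∈ iSup U),
      s ≫ germAt P x hx = g (c x hx) ≫ germAt P x (hc x hx) :=
    ⟨liftObj (fun x hx => g (c x hx) ≫ germAt P x (hc x hx)) (by
      intro p e he x
      obtain ⟨W, hW, hx, a, ha, h⟩ := germAt_isLocal ((g (c x.1 x.2)).map_deg he)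
        ⟨x.1, hc x.1 x.2⟩
      refine ⟨W, hW.trans (le_iSup U _), hx, a, ha, fun y hy => ?_⟩
      rw [← h y hy]
      exact congrArg (fun f : E ⟶ stalk P y => f.toAlgHom e) (hg _ _ y _ _)),
      fun x hx => liftObj_germAt _ _ x hx⟩
  refine ⟨s, ?_, ?_⟩
  · have key : ∀ i, s ≫ map (le_iSup U i) = g i := fun i => hom_ext fun x hx => by
      rw [Category.assoc, map_germAt, hs, hg]
    exact key
  · intro t ht
    have key : ∀ t' : E ⟶ obj P (iSup U), (∀ i, t' ≫ map (le_iSup U i) = g i) → t' = s :=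
      fun t' ht' => hom_ext fun x hx => by
        rw [hs, ← ht' (c x hx), Category.assoc, map_germAt]
    exact key t ht

/-- The associated sheaf. -/
def sheaf : TopCat.Sheaf (DGP0Alg k) X := ⟨presheaf P, isSheaf P⟩

/-- The morphism to the associated sheaf. -/
def unit (V : Opens X) : P.obj (op V) ⟶ obj P V :=
  liftObj (fun x hx => germ P x hx) fun _ e he x => ⟨V, le_rfl, x.2, e, he, fun _ _ => rfl⟩

theorem unit_map {V V' : Opens X} (h : V' ≤ V) : unit P V ≫ map h = restr P h ≫ unit P V' :=
  hom_ext fun x hx => DGP0Alg.hom_ext fun a => (germ_restr P h x hx a).symm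

theorem exists_local {V : Opens X} {p : ℤ} {b : (obj P V).carrier} (hb : b ∈ (obj P V).deg p)
    {x : X} (hx : x ∈ V) : ∃ W, ∃ hW : W ≤ V, x ∈ W ∧ ∃ a ∈ (P.obj (op W)).deg p,
      (map hW).toAlgHom b = (unit P W).toAlgHom a := by
  obtain ⟨W, hW, hxW, a, ha, h⟩ := germAt_isLocal hb ⟨x, hx⟩
  exact ⟨W, hW, hxW, a, ha, obj_ext fun y hy => h y hy⟩

theorem exists_local_zero {V : Opens X} {a : (P.obj (op V)).carrier}
    (ha : (unit P V).toAlgHom a = 0) {x : X} (hx : x ∈ V) :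
    ∃ W, ∃ hW : W ≤ V, x ∈ W ∧ (restr P hW).toAlgHom a = 0 :=
  exists_restr_eq_zero P hx
    ((congrArg (germAt P x hx).toAlgHom ha).trans (map_zero (germAt P x hx).toAlgHom))

end Sheafification

/-! ### Cohomology classes of closed elements -/

section CohomologyClasses

variable {k : Type u} [Field k] (A : DGP0Alg k) (p : ℤ)

/-- The closed elements of degree `p`. -/
def closedDeg : Submodule k A.carrier := A.deg p ⊓ LinearMap.ker A.d

theorem closed_comp_d : (ModuleCat.ofHom (Submodule.inclusion (inf_le_left : closedDeg A p ≤ A.deg p)) :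
    ModuleCat.of k (closedDeg A p) ⟶ ((complexFunctor k).obj A).X p) ≫
      ((complexFunctor k).obj A).d p (p + 1) = 0 := by
  have hA : ((complexFunctor k).obj A).d p (p + 1) = degD A p := CochainComplex.of_d _ (degD A) p
  rw [hA]
  refine ModuleCat.hom_ext (LinearMap.ext fun a => ?_)
  exact Subtype.ext a.2.2

/-- The map from closed elements to cycles. -/
def toCycles : ModuleCat.of k (closedDeg A p) ⟶ ((complexFunctor k).obj A).cycles p :=
  ((complexFunctor k).obj A).liftCycles _ (p + 1) (by simp) (closed_comp_d A p)

/-- The cohomology class of a closed element. -/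
def cohClass : closedDeg A p →ₗ[k] (cohomology k p).obj A :=
  (toCycles A p ≫ ((complexFunctor k).obj A).homologyπ p).hom

theorem toCycles_i (a : closedDeg A p) :
    ((complexFunctor k).obj A).iCycles p (toCycles A p a) = (⟨a.1, a.2.1⟩ : A.deg p) :=
  ConcreteCategory.congr_hom (((complexFunctor k).obj A).liftCycles_i _ (p + 1) (by simp)
    (closed_comp_d A p)) a

theorem iCycles_injective : Function.Injective (((complexFunctor k).obj A).iCycles p) :=
  (ModuleCat.mono_iff_injective _).mp inferInstance

theorem toCycles_surjective : Function.Surjective (toCycles A p) := by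
  intro z
  have hz : ((complexFunctor k).obj A).d p (p + 1) (((complexFunctor k).obj A).iCycles p z) = 0 :=
    ConcreteCategory.congr_hom (((complexFunctor k).obj A).iCycles_d p (p + 1)) z
  have hA : ((complexFunctor k).obj A).d p (p + 1) = degD A p := CochainComplex.of_d _ (degD A) p
  rw [hA] at hz
  let w : A.deg p := ((complexFunctor k).obj A).iCycles p z
  have hw : A.d w.1 = 0 := congrArg Subtype.val hz
  exact ⟨⟨w.1, w.2, hw⟩, iCycles_injective A p (toCycles_i A p _)⟩

theorem cohClass_surjective : Function.Surjective (cohClass A p) := by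
  have h1 : Function.Surjective (((complexFunctor k).obj A).homologyπ p) :=
    (ModuleCat.epi_iff_surjective _).mp inferInstance
  exact h1.comp (toCycles_surjective A p)

variable {A p}

/-- The homology is the cokernel of the map from the preceding term of the complex to the cycles, so
a class vanishes exactly when its cycle comes from that term. -/
theorem cohClass_eq_zero_iff (a : closedDeg A p) :
    cohClass A p a = 0 ↔ ∃ c ∈ A.deg (p - 1), A.d c = a.1 := by
  -- The differential of the complex is given explicitly only from degree q to q + 1, so the degree
  -- is written in this form.
  obtain ⟨q, rfl⟩ : ∃ q, p = q + 1 := ⟨p - 1, by ring⟩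
  rw [add_sub_cancel_right]
  let K := (complexFunctor k).obj A
  have hA : K.d q (q + 1) = degD A q := CochainComplex.of_d _ (degD A) q
  have hex : (ShortComplex.mk (K.toCycles q (q + 1)) (K.homologyπ (q + 1))
      (K.toCycles_comp_homologyπ q (q + 1))).Exact :=
    ShortComplex.exact_of_g_is_cokernel _ (K.homologyIsCokernel q (q + 1) (by simp))
  rw [ShortComplex.moduleCat_exact_iff] at hex
  have hi : ∀ c : A.deg q, K.iCycles (q + 1) (K.toCycles q (q + 1) c) =
      (⟨A.d c.1, A.d_mem c.2⟩ : A.deg (q + 1)) := by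
    intro c
    have := ConcreteCategory.congr_hom (K.toCycles_i q (q + 1)) c
    refine this.trans ?_
    rw [hA]
    rfl
  constructor
  · intro h
    obtain ⟨c, hc⟩ := hex (toCycles A (q + 1) a) h
    let c' : A.deg q := c
    refine ⟨c'.1, c'.2, ?_⟩
    have h1 := (hi c').symm.trans ((congrArg (K.iCycles (q + 1)) hc).trans (toCycles_i A (q + 1) a))
    exact congrArg Subtype.val h1
  · rintro ⟨c, hc, e⟩
    have h1 : K.toCycles q (q + 1) (⟨c, hc⟩ : A.deg q) = toCycles A (q + 1) a := by
      refine iCycles_injective A (q + 1) ((hi ⟨c, hc⟩).trans ?_)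
      refine Eq.trans ?_ (toCycles_i A (q + 1) a).symm
      exact Subtype.ext e
    have h2 := ConcreteCategory.congr_hom (K.toCycles_comp_homologyπ q (q + 1)) (⟨c, hc⟩ : A.deg q)
    change K.homologyπ (q + 1) (toCycles A (q + 1) a) = 0
    rw [← h1]
    exact h2

/-- The image of a closed element under a morphism. -/
def closedMap {A B : DGP0Alg k} (f : A ⟶ B) (p : ℤ) (a : closedDeg A p) : closedDeg B p :=
  ⟨f.toAlgHom a.1, f.map_deg a.2.1, show B.d (f.toAlgHom a.1) = 0 from
    (f.map_d a.1).symm.trans ((congrArg f.toAlgHom a.2.2).trans (map_zero _))⟩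

theorem map_cohClass {A B : DGP0Alg k} (f : A ⟶ B) (p : ℤ) (a : closedDeg A p) :
    (cohomology k p).map f (cohClass A p a) = cohClass B p (closedMap f p a) := by
  let φ := (complexFunctor k).map f
  have h1 : HomologicalComplex.cyclesMap φ p (toCycles A p a) =
      toCycles B p (closedMap f p a) := by
    refine iCycles_injective B p ?_
    refine Eq.trans ?_ (toCycles_i B p _).symm
    refine (ConcreteCategory.congr_hom (HomologicalComplex.cyclesMap_i φ p) _).trans ?_
    exact congrArg (φ.f p) (toCycles_i A p a)
  have h2 := ConcreteCategory.congr_hom (HomologicalComplex.homologyπ_naturality φ p)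
    (toCycles A p a)
  exact h2.trans (congrArg (((complexFunctor k).obj B).homologyπ p) h1)

end CohomologyClasses

/-! ### Quasi-isomorphisms in terms of closed and exact sections -/

section Criterion

variable {k : Type u} [Field k] {Y : TopCat.{u}} {F G : TopCat.Presheaf (DGP0Alg k) Y}

/-- Closed sections of the target locally are, up to exact ones, images of closed sections. -/
def LocallySurjectiveOnCohomology (φ : F ⟶ G) : Prop :=
  ∀ (p : ℤ) (V : Opens Y) (y : Y), y ∈ V → ∀ b ∈ (G.obj (op V)).deg p, (G.obj (op V)).d b = 0 →
    ∃ W, ∃ hW : W ≤ V, y ∈ W ∧ ∃ a ∈ (F.obj (op W)).deg p, (F.obj (op W)).d a = 0 ∧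
      ∃ c ∈ (G.obj (op W)).deg (p - 1), (G.map (homOfLE hW).op).toAlgHom b =
        (φ.app (op W)).toAlgHom a + (G.obj (op W)).d c

/-- Closed sections of the source with exact image locally are exact. -/
def LocallyInjectiveOnCohomology (φ : F ⟶ G) : Prop :=
  ∀ (p : ℤ) (V : Opens Y) (y : Y), y ∈ V → ∀ a ∈ (F.obj (op V)).deg p, (F.obj (op V)).d a = 0 →
    ∀ b ∈ (G.obj (op V)).deg (p - 1), (φ.app (op V)).toAlgHom a = (G.obj (op V)).d b →
    ∃ W, ∃ hW : W ≤ V, y ∈ W ∧ ∃ c ∈ (F.obj (op W)).deg (p - 1),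
      (F.map (homOfLE hW).op).toAlgHom a = (F.obj (op W)).d c

/-- A germ vanishes when the class vanishes on some neighbourhood, and there the class vanishes when
the restricted element is exact. -/
theorem germ_cohClass_eq_zero (F : TopCat.Presheaf (DGP0Alg k) Y) {p : ℤ} {V : Opens Y} {y : Y}
    (hy : y ∈ V) (a : closedDeg (F.obj (op V)) p) :
    TopCat.Presheaf.germ (F ⋙ cohomology k p) V y hy (cohClass _ p a) = 0 ↔
      ∃ W, ∃ hW : W ≤ V, y ∈ W ∧ ∃ c ∈ (F.obj (op W)).deg (p - 1),
        (F.map (homOfLE hW).op).toAlgHom a.1 = (F.obj (op W)).d c := by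
  constructor
  · intro h
    obtain ⟨W, hyW, iU, iV, e⟩ := TopCat.Presheaf.germ_eq (F ⋙ cohomology k p) y hy hy
      (cohClass _ p a) 0 (h.trans (map_zero _).symm)
    have e1 : (cohomology k p).map (F.map iU.op) (cohClass _ p a) = 0 := e.trans (map_zero _)
    rw [map_cohClass, cohClass_eq_zero_iff] at e1
    obtain ⟨c, hc, e2⟩ := e1
    exact ⟨W, leOfHom iU, hyW, c, hc, e2.symm⟩
  · rintro ⟨W, hW, hyW, c, hc, e⟩
    have e1 : (cohomology k p).map (F.map (homOfLE hW).op) (cohClass _ p a) = 0 := by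
      rw [map_cohClass, cohClass_eq_zero_iff]
      exact ⟨c, hc, e.symm⟩
    have e2 := TopCat.Presheaf.germ_res_apply (F ⋙ cohomology k p) (homOfLE hW) y hyW
      (cohClass _ p a)
    exact e2.symm.trans ((congrArg _ e1).trans (map_zero _))

theorem stalkMap_cohClass (φ : F ⟶ G) {p : ℤ} {V : Opens Y} {y : Y}
    (hy : y ∈ V) (a : closedDeg (F.obj (op V)) p) :
    (TopCat.Presheaf.stalkFunctor (ModuleCat.{u} k) y).map
      (Functor.whiskerRight φ (cohomology k p))
      (TopCat.Presheaf.germ (F ⋙ cohomology k p) V y hy (cohClass _ p a)) =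
    TopCat.Presheaf.germ (G ⋙ cohomology k p) V y hy
      (cohClass _ p (closedMap (φ.app (op V)) p a)) := by
  refine (TopCat.Presheaf.stalkFunctor_map_germ_apply V y hy
    (Functor.whiskerRight φ (cohomology k p)) (cohClass _ p a)).trans ?_
  exact congrArg _ (map_cohClass (φ.app (op V)) p a)

theorem exists_germ_cohClass (F : TopCat.Presheaf (DGP0Alg k) Y) {p : ℤ} {y : Y}
    (z : ((TopCat.Presheaf.stalkFunctor (ModuleCat.{u} k) y).obj (F ⋙ cohomology k p) : ModuleCat.{u} k)) : ∃ (V : Opens Y) (hy : y ∈ V)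
      (a : closedDeg (F.obj (op V)) p),
        TopCat.Presheaf.germ (F ⋙ cohomology k p) V y hy (cohClass _ p a) = z := by
  obtain ⟨V, hy, s, rfl⟩ := TopCat.Presheaf.exists_germ_eq
    (show TopCat.Presheaf (ModuleCat.{u} k) Y from F ⋙ cohomology k p) z
  obtain ⟨a, rfl⟩ := cohClass_surjective (F.obj (op V)) p s
  exact ⟨V, hy, a, rfl⟩

theorem germ_cohClass_res (F : TopCat.Presheaf (DGP0Alg k) Y) {p : ℤ} {V W : Opens Y} {y : Y}
    (hW : W ≤ V) (hy : y ∈ W) (a : closedDeg (F.obj (op V)) p) :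
    TopCat.Presheaf.germ (F ⋙ cohomology k p) W y hy
      (cohClass _ p (closedMap (F.map (homOfLE hW).op) p a)) =
    TopCat.Presheaf.germ (F ⋙ cohomology k p) V y (hW hy) (cohClass _ p a) :=
  (congrArg _ (map_cohClass (F.map (homOfLE hW).op) p a).symm).trans
    (TopCat.Presheaf.germ_res_apply (F ⋙ cohomology k p) (homOfLE hW) y hy (cohClass _ p a))

theorem map_map_apply (F : TopCat.Presheaf (DGP0Alg k) Y) {V V' W : Opens Y} (h : V' ≤ V)
    (h' : W ≤ V') (a : (F.obj (op V)).carrier) :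
    (F.map (homOfLE h').op).toAlgHom ((F.map (homOfLE h).op).toAlgHom a) =
      (F.map (homOfLE (h'.trans h)).op).toAlgHom a :=
  congrArg (fun f : F.obj (op V) ⟶ F.obj (op W) => f.toAlgHom a)
    (F.map_comp (homOfLE h).op (homOfLE h').op).symm

theorem app_map_apply (φ : F ⟶ G) {V V' : Opens Y} (h : V' ≤ V) (a : (F.obj (op V)).carrier) :
    (φ.app (op V')).toAlgHom ((F.map (homOfLE h).op).toAlgHom a) =
      (G.map (homOfLE h).op).toAlgHom ((φ.app (op V)).toAlgHom a) :=
  congrArg (fun f : F.obj (op V) ⟶ G.obj (op V') => f.toAlgHom a) (φ.naturality (homOfLE h).op)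

/-- Every element of a stalk of cohomology is the germ of the class of a closed section, and its
vanishing means exactness on a smaller neighbourhood. Bijectivity on stalks thus becomes the two
local conditions. -/
theorem isQuasiIso_iff (φ : F ⟶ G) : IsQuasiIso φ ↔
    LocallySurjectiveOnCohomology φ ∧ LocallyInjectiveOnCohomology φ := by
  constructor
  · intro h
    refine ⟨fun p V y hy b hb hdb => ?_, fun p V y hy a ha hda b hb e => ?_⟩
    · obtain ⟨z, hz⟩ := ((ConcreteCategory.isIso_iff_bijective _).mp (h p y)).2
        (TopCat.Presheaf.germ (G ⋙ cohomology k p) V y hy (cohClass _ p ⟨b, hb, hdb⟩))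
      obtain ⟨V', hy', a, rfl⟩ := exists_germ_cohClass F z
      have e1 := (stalkMap_cohClass φ hy' a).symm.trans hz
      have h1 : V ⊓ V' ≤ V := inf_le_left
      have h2 : V ⊓ V' ≤ V' := inf_le_right
      -- The classes of b and of the image of a have the same germ, so their difference is exact on
      -- a neighbourhood inside V ⊓ V'.
      have e2 : TopCat.Presheaf.germ (G ⋙ cohomology k p) (V ⊓ V') y ⟨hy, hy'⟩ (cohClass _ p
          (closedMap (G.map (homOfLE h1).op) p ⟨b, hb, hdb⟩ -
            closedMap (G.map (homOfLE h2).op) p (closedMap (φ.app (op V')) p a))) = 0 := by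
        rw [map_sub]
        refine (map_sub _ _ _).trans ?_
        rw [sub_eq_zero]
        exact (germ_cohClass_res G h1 ⟨hy, hy'⟩ _).trans
          (e1.symm.trans (germ_cohClass_res G h2 ⟨hy, hy'⟩ _).symm)
      obtain ⟨W, hW, hyW, c, hc, e3⟩ := (germ_cohClass_eq_zero G _ _).mp e2
      refine ⟨W, hW.trans h1, hyW, _, (closedMap (F.map (homOfLE (hW.trans h2)).op) p a).2.1,
        (closedMap (F.map (homOfLE (hW.trans h2)).op) p a).2.2, c, hc, ?_⟩
      have e4 : (G.map (homOfLE hW).op).toAlgHom ((G.map (homOfLE h1).op).toAlgHom b) -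
          (G.map (homOfLE hW).op).toAlgHom ((G.map (homOfLE h2).op).toAlgHom
            ((φ.app (op V')).toAlgHom a.1)) = (G.obj (op W)).d c := (map_sub _ _ _).symm.trans e3
      rw [map_map_apply, map_map_apply, ← app_map_apply] at e4
      exact (sub_eq_iff_eq_add'.mp e4)
    · refine (germ_cohClass_eq_zero F hy ⟨a, ha, hda⟩).mp ?_
      refine ((ConcreteCategory.isIso_iff_bijective _).mp (h p y)).1 ?_
      refine (stalkMap_cohClass φ hy ⟨a, ha, hda⟩).trans (Eq.trans ?_ (map_zero _).symm)
      have h0 : cohClass _ p (closedMap (φ.app (op V)) p ⟨a, ha, hda⟩) = 0 :=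
        (cohClass_eq_zero_iff _).mpr ⟨b, hb, e.symm⟩
      exact (congrArg _ h0).trans (map_zero _)
  · rintro ⟨hs, hi⟩ p y
    refine (ConcreteCategory.isIso_iff_bijective _).mpr ⟨?_, ?_⟩
    · refine (injective_iff_map_eq_zero _).mpr fun z hz => ?_
      obtain ⟨V, hy, a, rfl⟩ := exists_germ_cohClass F z
      obtain ⟨W, hW, hyW, c, hc, e⟩ := (germ_cohClass_eq_zero G hy _).mp
        ((stalkMap_cohClass φ hy a).symm.trans hz)
      obtain ⟨W', hW', hyW', c', hc', e'⟩ := hi p W y hyW _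
        (closedMap (F.map (homOfLE hW).op) p a).2.1 (closedMap (F.map (homOfLE hW).op) p a).2.2
        c hc ((app_map_apply φ hW a.1).trans e)
      exact (germ_cohClass_eq_zero F hy a).mpr
        ⟨W', hW'.trans hW, hyW', c', hc', (map_map_apply F hW hW' a.1).symm.trans e'⟩
    · intro z
      obtain ⟨V, hy, b, rfl⟩ := exists_germ_cohClass G z
      obtain ⟨W, hW, hyW, a, ha, hda, c, hc, e⟩ := hs p V y hy b.1 b.2.1 b.2.2
      refine ⟨TopCat.Presheaf.germ (F ⋙ cohomology k p) W y hyW (cohClass _ p ⟨a, ha, hda⟩), ?_⟩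
      refine (stalkMap_cohClass φ hyW ⟨a, ha, hda⟩).trans
        (Eq.trans ?_ (germ_cohClass_res G hW hyW b))
      refine congrArg _ (Eq.symm (sub_eq_zero.mp ?_))
      rw [← map_sub, cohClass_eq_zero_iff]
      exact ⟨c, hc, (sub_eq_iff_eq_add'.mpr e).symm⟩

end Criterion

/-! ### The largest index of a member of the cover containing V -/

section TopIndex

variable {n : ℕ} {X : TopCat.{u}} (U : Fin (n + 1) → Opens X)

open Classical in
/-- The largest index `i` such that `V` is contained in `U i`. -/
def topIndex (V : Opens X) : Fin (n + 1) := (Finset.univ.filter fun i => V ≤ U i).sup id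

variable {U} {V V' : Opens X} {i : Fin (n + 1)}

theorem le_topIndex (h : V ≤ U i) : i ≤ topIndex U V := by
  classical
  exact Finset.le_sup (f := id) (Finset.mem_filter.mpr ⟨Finset.mem_univ i, h⟩)

/-- The maximum of a nonempty finite set is attained. The hypothesis matters because the supremum of
the empty set is 0 by convention, and then V need not lie in U 0. -/
theorem topIndex_spec (h : V ≤ U i) : V ≤ U (topIndex U V) := by
  classical
  obtain ⟨j, hj, e⟩ := Finset.exists_mem_eq_sup (Finset.univ.filter fun i => V ≤ U i)
    ⟨i, Finset.mem_filter.mpr ⟨Finset.mem_univ i, h⟩⟩ id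
  have e' : topIndex U V = j := by
    rw [← show id j = j from rfl, ← e]
    unfold topIndex
    congr!
  rw [e']
  exact (Finset.mem_filter.mp hj).2

theorem topIndex_mono (h : V' ≤ V) : topIndex U V ≤ topIndex U V' := by
  classical
  refine Finset.sup_le fun j hj => ?_
  exact le_topIndex (h.trans (Finset.mem_filter.mp hj).2)

end TopIndex

/-! ### Locally bijective morphisms of presheaves -/

section LocallyBijective

variable {k : Type u} [Field k] {X : TopCat.{u}}

/-- A morphism of presheaves which is locally bijective on sections. -/
structure IsLocallyBijective {P G : TopCat.Presheaf (DGP0Alg k) X} (η : P ⟶ G) : Prop where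
  surj : ∀ {V : Opens X} {p : ℤ} {b : (G.obj (op V)).carrier} (_ : b ∈ (G.obj (op V)).deg p)
    {x : X} (_ : x ∈ V), ∃ W, ∃ hW : W ≤ V, x ∈ W ∧ ∃ a ∈ (P.obj (op W)).deg p,
      (G.map (homOfLE hW).op).toAlgHom b = (η.app (op W)).toAlgHom a
  inj : ∀ {V : Opens X} {a : (P.obj (op V)).carrier} (_ : (η.app (op V)).toAlgHom a = 0)
    {x : X} (_ : x ∈ V), ∃ W, ∃ hW : W ≤ V, x ∈ W ∧ (P.map (homOfLE hW).op).toAlgHom a = 0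

theorem exists_isLocallyBijective (P : TopCat.Presheaf (DGP0Alg k) X) :
    ∃ (B : TopCat.Sheaf (DGP0Alg k) X) (η : P ⟶ B.presheaf), IsLocallyBijective η :=
  ⟨Sheafification.sheaf P,
    { app := fun V => Sheafification.unit P V.unop
      naturality := fun _ _ f => (Sheafification.unit_map P (leOfHom f.unop)).symm },
    ⟨fun hb _ hx => Sheafification.exists_local P hb hx,
      fun ha _ hx => Sheafification.exists_local_zero P ha hx⟩⟩

end LocallyBijective

/-! ### The glued presheaf and its cohomology -/

namespace CoherentSystem

variable {k : Type u} [Field k] {n : ℕ} {X : TopCat.{u}} {U : Fin (n + 1) → Opens X}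
  (C : CoherentSystem k U)

/-- The presheaf on `X` whose sections over `V` are those of the resolution of `F i`, for the
largest `i` with `V ≤ U i`. -/
def glued : TopCat.Presheaf (DGP0Alg k) X where
  -- For V contained in no member of the cover the index is 0 by convention; the comparisons concern
  -- only V inside some U i. When V shrinks the index grows, and restriction forgets the chains with
  -- smaller indices.
  obj V := C.R (topIndex U V.unop) V.unop
  map f := C.resR (topIndex_mono (leOfHom f.unop)) (leOfHom f.unop)
  map_id _ := C.resR_self _ _ _ _
  map_comp _ _ := (C.resR_comp _ _ _ _).symm

variable {i j : Fin (n + 1)} {V V' : Opens X}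

/-- The morphism from the sections of `F i` to those of the glued presheaf. -/
def comparison (hV : V ≤ U i) : (C.F i).obj (op V) ⟶ C.glued.obj (op V) :=
  C.sec hV ≫ C.resR (le_topIndex hV) le_rfl

theorem res_comparison (hV : V ≤ U i) (h : V' ≤ V) :
    C.res i h ≫ C.comparison (h.trans hV) =
      C.comparison hV ≫ C.glued.map (homOfLE h).op := by
  refine (Category.assoc _ _ _).symm.trans ?_
  rw [← C.sec_res hV h]
  refine (Category.assoc _ _ _).trans (Eq.trans ?_ (Category.assoc _ _ _).symm)
  refine congrArg (fun f => C.sec hV ≫ f) ?_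
  exact (C.resR_comp _ _ _ _).trans
    (C.resR_comp (le_topIndex hV) (topIndex_mono h) le_rfl h).symm

variable {G : TopCat.Presheaf (DGP0Alg k) X} (η : C.glued ⟶ G)

/-- The morphism from the sections of `F i` to those of the sheaf associated with the glued
presheaf. -/
def toSheaf (hV : V ≤ U i) : (C.F i).obj (op V) ⟶ G.obj (op V) :=
  C.comparison hV ≫ η.app (op V)

theorem res_toSheaf (hV : V ≤ U i) (h : V' ≤ V) :
    C.res i h ≫ C.toSheaf η (h.trans hV) = C.toSheaf η hV ≫ G.map (homOfLE h).op := by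
  refine (Category.assoc _ _ _).symm.trans ?_
  rw [C.res_comparison hV h]
  refine (Category.assoc _ _ _).trans (Eq.trans ?_ (Category.assoc _ _ _).symm)
  exact congrArg (fun f => C.comparison hV ≫ f) (η.naturality (homOfLE h).op)

theorem le_inf_pair (hi : V ≤ U i) (hj : V ≤ U j) :
    V ≤ ((Chain.single j).insert i (Fin.last 0)).inf U := by
  change V ≤ (Insert.insert i {j} : Finset (Fin (n + 1))).inf U
  rw [Finset.inf_insert, Finset.inf_singleton]
  exact le_inf hi hj

/-- The morphism `F i ⟶ F j` of a coherent system. -/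
def link (hij : i ≤ j) (hi : V ≤ U i) (hj : V ≤ U j) :
    (C.F i).obj (op V) ⟶ tensorObj ((C.F j).obj (op V)) 0 :=
  C.T ((Chain.single j).insert i) (Chain.mem_insert_self i _ _)
    (Chain.mem_insert i (Chain.mem_single j _)) hij V (le_inf_pair hi hj)

/-- This ties the resolution to the hypothesis: the composite is a quasi-isomorphism by assumption,
and evaluation at j is controlled by the homotopy, so the comparison from `F i` to the resolution at
j is controlled too. -/
theorem sec_ev_eq_link (hij : i ≤ j) (hi : V ≤ U i) (hj : V ≤ U j) :
    C.sec hi ≫ C.resR hij le_rfl ≫ C.ev hj = C.link hij hi hj := by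
  rw [C.sec_ev hij hi le_rfl hj (le_inf_pair hi hj), C.res_self]
  exact Category.id_comp _

/-- The morphisms `F i ⟶ F j` of the coherent system are quasi-isomorphisms. -/
structure IsQuasiIso : Prop where
  surj : ∀ {i j : Fin (n + 1)} (hij : i ≤ j) {V : Opens X} (hi : V ≤ U i) (hj : V ≤ U j) (p : ℤ)
    {x : X} (_ : x ∈ V), ∀ b ∈ (tensorObj ((C.F j).obj (op V)) 0).deg p,
    (tensorObj ((C.F j).obj (op V)) 0).d b = 0 → ∃ W, ∃ hW : W ≤ V, x ∈ W ∧
      ∃ a ∈ ((C.F i).obj (op W)).deg p, ((C.F i).obj (op W)).d a = 0 ∧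
        ∃ c ∈ (tensorObj ((C.F j).obj (op W)) 0).deg (p - 1),
          (tensorMap (C.res j hW) id).toAlgHom b =
            (C.link hij (hW.trans hi) (hW.trans hj)).toAlgHom a +
              (tensorObj ((C.F j).obj (op W)) 0).d c
  inj : ∀ {i j : Fin (n + 1)} (hij : i ≤ j) {V : Opens X} (hi : V ≤ U i) (hj : V ≤ U j) (p : ℤ)
    {x : X} (_ : x ∈ V), ∀ a ∈ ((C.F i).obj (op V)).deg p, ((C.F i).obj (op V)).d a = 0 →
    ∀ b ∈ (tensorObj ((C.F j).obj (op V)) 0).deg (p - 1),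
      (C.link hij hi hj).toAlgHom a = (tensorObj ((C.F j).obj (op V)) 0).d b →
      ∃ W, ∃ hW : W ≤ V, x ∈ W ∧ ∃ c ∈ ((C.F i).obj (op W)).deg (p - 1),
        (C.res i hW).toAlgHom a = ((C.F i).obj (op W)).d c

variable {C} {η}

/-- A closed section is lifted locally to the resolution at the top index j and evaluated at j. The
hypothesis on i ≤ j writes this evaluation as the image of a closed element of `F i` plus an exact
term, and the homotopy carries the relation back to the resolution. -/
theorem toSheaf_surjective [CharZero k] (hC : C.IsQuasiIso) (hη : IsLocallyBijective η) (hV : V ≤ U i) (p : ℤ) {x : X}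
    (hx : x ∈ V) (b : (G.obj (op V)).carrier)
    (hb : b ∈ (G.obj (op V)).deg p)
    (hdb : (G.obj (op V)).d b = 0) : ∃ W, ∃ hW : W ≤ V, x ∈ W ∧
      ∃ a ∈ ((C.F i).obj (op W)).deg p, ((C.F i).obj (op W)).d a = 0 ∧
        ∃ c ∈ (G.obj (op W)).deg (p - 1),
          (G.map (homOfLE hW).op).toAlgHom b = (C.toSheaf η (hW.trans hV)).toAlgHom a +
            (G.obj (op W)).d c := by
  obtain ⟨W₁, h₁, hx₁, r₁, hr₁, e₁⟩ := hη.surj hb hx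
  -- The lift r₁ need not be closed, but its differential dies under η, hence on a smaller open set.
  have hd₁ : (η.app (op W₁)).toAlgHom ((C.glued.obj (op W₁)).d r₁) = 0 := by
    rw [(η.app (op W₁)).map_d, ← e₁, ← (G.map (homOfLE h₁).op).map_d, hdb,
      map_zero]
  obtain ⟨W₂, h₂, hx₂, e₂⟩ := hη.inj hd₁ hx₁
  let r₂ : (C.R (topIndex U W₂) W₂).carrier := (C.glued.map (homOfLE h₂).op).toAlgHom r₁
  have hr₂ : r₂ ∈ (C.R (topIndex U W₂) W₂).deg p := (C.glued.map (homOfLE h₂).op).map_deg hr₁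
  have hd₂ : (C.R (topIndex U W₂) W₂).d r₂ = 0 :=
    ((C.glued.map (homOfLE h₂).op).map_d r₁).symm.trans e₂
  have hi₂ : W₂ ≤ U i := (h₂.trans h₁).trans hV
  have hij := le_topIndex hi₂
  have hj₂ := topIndex_spec hi₂
  obtain ⟨W, h, hx₃, a, ha, hda, c, hc, e⟩ := hC.surj hij hi₂ hj₂ p hx₂ ((C.ev hj₂).toAlgHom r₂)
    ((C.ev hj₂).map_deg hr₂)
    (((C.ev hj₂).map_d r₂).symm.trans ((congrArg _ hd₂).trans (map_zero _)))
  have hi := h.trans hi₂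
  have hj := h.trans hj₂
  obtain ⟨c₀, rfl⟩ := unitHom_surjective _ c
  have hc₀ := unitHom_mem hc
  let s : (C.R (topIndex U W₂) W).carrier := (C.sec hi ≫ C.resR hij le_rfl).toAlgHom a
  let r₃ : (C.R (topIndex U W₂) W).carrier := (C.resR le_rfl h).toAlgHom r₂
  have hds : (C.R (topIndex U W₂) W).d s = 0 :=
    ((C.sec hi ≫ C.resR hij le_rfl).map_d a).symm.trans ((congrArg _ hda).trans (map_zero _))
  have hdr₃ : (C.R (topIndex U W₂) W).d r₃ = 0 :=
    ((C.resR le_rfl h).map_d r₂).symm.trans ((congrArg _ hd₂).trans (map_zero _))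
  -- r₃ - s is closed and its evaluation is the differential of c₀. Applied to this difference, the
  -- homotopy makes `sec (d c₀)` equal to r₃ - s up to an exact term, so r₃ - s is itself exact.
  have hev : (C.ev hj).toAlgHom (r₃ - s) = (unitHom _ 0).toAlgHom (((C.F _).obj (op W)).d c₀) := by
    have e₃ : (C.ev hj).toAlgHom r₃ = (tensorMap (C.res _ h) id).toAlgHom ((C.ev hj₂).toAlgHom r₂) :=
      congrArg (fun f : C.R (topIndex U W₂) W₂ ⟶ tensorObj ((C.F _).obj (op W)) 0 =>
        f.toAlgHom r₂) (C.ev_res hj₂ h)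
    have e₄ : (C.ev hj).toAlgHom s = (C.link hij hi hj).toAlgHom a :=
      congrArg (fun f : (C.F i).obj (op W) ⟶ tensorObj ((C.F _).obj (op W)) 0 =>
        f.toAlgHom a) (C.sec_ev_eq_link hij hi hj)
    rw [map_sub, e₃, e₄, e, (unitHom _ 0).map_d]
    exact add_sub_cancel_left _ _
  obtain ⟨w, hw, e₅⟩ := C.exists_homotopy hj (sub_mem ((C.resR le_rfl h).map_deg hr₂)
    ((C.sec hi ≫ C.resR hij le_rfl).map_deg ha)) (by rw [map_sub, hds, hdr₃, sub_zero]) hev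
  have e₆ : r₃ = s + (C.R (topIndex U W₂) W).d ((C.sec hj).toAlgHom c₀ - w) := by
    rw [map_sub, ← (C.sec hj).map_d, e₅]
    abel
  -- The argument was made over W in the resolution for the top index of W₂; the top index of W may
  -- be larger, and q passes to it.
  let q : C.R (topIndex U W₂) W ⟶ C.glued.obj (op W) := C.resR (topIndex_mono h) le_rfl
  have e₇ : q.toAlgHom r₃ = (C.glued.map (homOfLE h).op).toAlgHom r₂ :=
    congrArg (fun f : C.R (topIndex U W₂) W₂ ⟶ C.glued.obj (op W) => f.toAlgHom r₂)
      (C.resR_comp le_rfl (topIndex_mono h) h le_rfl)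
  have e₈ : q.toAlgHom s = (C.comparison hi).toAlgHom a :=
    congrArg (fun f : (C.F i).obj (op W) ⟶ C.glued.obj (op W) => f.toAlgHom a)
      ((Category.assoc _ _ _).trans (congrArg (fun f => C.sec hi ≫ f)
        (C.resR_comp hij (topIndex_mono h) le_rfl le_rfl)))
  refine ⟨W, (h.trans h₂).trans h₁, hx₃, a, ha, hda, (η.app (op W)).toAlgHom
    (q.toAlgHom ((C.sec hj).toAlgHom c₀ - w)), (η.app (op W)).map_deg
      (q.map_deg (sub_mem ((C.sec hj).map_deg hc₀) hw)), ?_⟩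
  have e₉ : (G.map (homOfLE (h.trans h₂)).op).toAlgHom ((G.map (homOfLE h₁).op).toAlgHom b) =
      (η.app (op W)).toAlgHom
        ((C.glued.map (homOfLE (h.trans h₂)).op).toAlgHom r₁) := by
    rw [e₁]
    exact congrArg (fun f : C.glued.obj (op W₁) ⟶ G.obj (op W) => f.toAlgHom r₁)
      (η.naturality (homOfLE (h.trans h₂)).op).symm
  refine (map_map_apply G h₁ (h.trans h₂) b).symm.trans (e₉.trans ?_)
  rw [← map_map_apply C.glued h₂ h]
  refine (congrArg (η.app (op W)).toAlgHom (e₇.symm.trans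
    ((congrArg q.toAlgHom e₆).trans (map_add _ _ _)))).trans ?_
  rw [map_add, e₈, q.map_d, (η.app (op W)).map_d]
  rfl

/-- If the image of a is locally exact in the resolution at the top index j, evaluating at j makes
its image in `F j` exact, since evaluation is a morphism. Injectivity for the pair i ≤ j concludes
without any homotopy. -/
theorem toSheaf_injective (hC : C.IsQuasiIso) (hη : IsLocallyBijective η) (hV : V ≤ U i) (p : ℤ) {x : X}
    (hx : x ∈ V) (a : ((C.F i).obj (op V)).carrier) (ha : a ∈ ((C.F i).obj (op V)).deg p)
    (hda : ((C.F i).obj (op V)).d a = 0) (b : (G.obj (op V)).carrier)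
    (hb : b ∈ (G.obj (op V)).deg (p - 1))
    (e : (C.toSheaf η hV).toAlgHom a = (G.obj (op V)).d b) :
    ∃ W, ∃ hW : W ≤ V, x ∈ W ∧ ∃ c ∈ ((C.F i).obj (op W)).deg (p - 1),
        (C.res i hW).toAlgHom a = ((C.F i).obj (op W)).d c := by
  obtain ⟨W₁, h₁, hx₁, r₁, hr₁, e₁⟩ := hη.surj hb hx
  have hi₁ : W₁ ≤ U i := h₁.trans hV
  have e₂ : (η.app (op W₁)).toAlgHom
      ((C.comparison hi₁).toAlgHom ((C.res i h₁).toAlgHom a) -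
        (C.glued.obj (op W₁)).d r₁) = 0 := by
    have e₃ : (η.app (op W₁)).toAlgHom
        ((C.comparison hi₁).toAlgHom ((C.res i h₁).toAlgHom a)) =
        (G.map (homOfLE h₁).op).toAlgHom ((C.toSheaf η hV).toAlgHom a) :=
      congrArg (fun f : (C.F i).obj (op V) ⟶ G.obj (op W₁) => f.toAlgHom a)
        (C.res_toSheaf η hV h₁)
    rw [map_sub, e₃, e, (η.app (op W₁)).map_d, ← e₁,
      (G.map (homOfLE h₁).op).map_d, sub_self]
  obtain ⟨W₂, h₂, hx₂, e₃⟩ := hη.inj e₂ hx₁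
  have hi₂ : W₂ ≤ U i := h₂.trans hi₁
  have hij := le_topIndex hi₂
  have hj₂ := topIndex_spec hi₂
  let r₂ : (C.R (topIndex U W₂) W₂).carrier := (C.glued.map (homOfLE h₂).op).toAlgHom r₁
  have hr₂ : r₂ ∈ (C.R (topIndex U W₂) W₂).deg (p - 1) :=
    (C.glued.map (homOfLE h₂).op).map_deg hr₁
  have e₄ : (C.comparison hi₂).toAlgHom ((C.res i (h₂.trans h₁)).toAlgHom a) =
      (C.R (topIndex U W₂) W₂).d r₂ := by
    rw [map_sub, sub_eq_zero] at e₃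
    refine Eq.trans ?_ (e₃.trans ((C.glued.map (homOfLE h₂).op).map_d r₁))
    rw [← C.res_comp i h₁ h₂]
    exact congrArg (fun f : (C.F i).obj (op W₁) ⟶ C.glued.obj (op W₂) =>
      f.toAlgHom ((C.res i h₁).toAlgHom a)) (C.res_comparison hi₁ h₂)
  have e₅ : (C.link hij hi₂ hj₂).toAlgHom ((C.res i (h₂.trans h₁)).toAlgHom a) =
      (tensorObj ((C.F _).obj (op W₂)) 0).d ((C.ev hj₂).toAlgHom r₂) := by
    rw [← C.sec_ev_eq_link, ← (C.ev hj₂).map_d, ← e₄]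
    rfl
  obtain ⟨W, h, hxW, c, hc, e₆⟩ := hC.inj hij hi₂ hj₂ p hx₂ _
    ((C.res i (h₂.trans h₁)).map_deg ha) (((C.res i (h₂.trans h₁)).map_d a).symm.trans
      ((congrArg _ hda).trans (map_zero _))) _ ((C.ev hj₂).map_deg hr₂) e₅
  refine ⟨W, h.trans (h₂.trans h₁), hxW, c, hc, Eq.trans ?_ e₆⟩
  exact congrArg (fun f : (C.F i).obj (op V) ⟶ (C.F i).obj (op W) => f.toAlgHom a)
    (C.res_comp i (h₂.trans h₁) h).symm

end CoherentSystem

/-! ### The quasi-isomorphisms over the members of the cover -/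

namespace GluingData

variable {k : Type u} [Field k] {n : ℕ} {X : TopCat.{u}} {U : Fin (n + 1) → Opens X}
  (D : GluingData k U)

theorem isEnds_pair {i j : Fin (n + 1)} (h : i < j) :
    IsEnds (Insert.insert i {j} : Finset (Fin (n + 1))) i j where
  isLeast := ⟨by simp, fun l hl => by
    simp only [Finset.coe_insert, Finset.coe_singleton, Set.mem_insert_iff,
      Set.mem_singleton_iff] at hl
    rcases hl with rfl | rfl
    · exact le_rfl
    · exact h.le⟩
  isGreatest := ⟨by simp, fun l hl => by
    simp only [Finset.coe_insert, Finset.coe_singleton, Set.mem_insert_iff,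
      Set.mem_singleton_iff] at hl
    rcases hl with rfl | rfl
    · exact h.le
    · exact le_rfl⟩
  lt := h

theorem insert_single_subset {i j : Fin (n + 1)} (t : Fin 1) :
    (Chain.single j).insert i t ⊆ (Insert.insert i {j} : Finset (Fin (n + 1))) ∧
      i ∈ (Chain.single j).insert i t ∧ j ∈ (Chain.single j).insert i t :=
  ⟨subset_rfl, Chain.mem_insert_self i _ _, Chain.mem_insert i (Chain.mem_single j _)⟩

theorem link_self {i : Fin (n + 1)} {V : Opens X} (hi hi' : V ≤ U i) :
    D.system.link le_rfl hi hi' = unitHom _ 0 :=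
  D.system.T_self _ (Chain.mem_insert_self i _ _) _

theorem link_of_lt {i j : Fin (n + 1)} (h : i < j) {V : Opens X} (hi : V ≤ U i) (hj : V ≤ U j)
    (hV : V ≤ (Insert.insert i {j} : Finset (Fin (n + 1))).inf U) :
    D.system.link h.le hi hj =
      D.chainHom (isEnds_pair h) ((Chain.single j).insert i) insert_single_subset V hV := by
  refine D.transition_of_lt _ (Chain.mem_insert_self i _ _)
    (Chain.mem_insert i (Chain.mem_single j _)) h (CoherentSystem.le_inf_pair hi hj)
    (isEnds_pair h) _ insert_single_subset (fun t => ?_)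
    (Finset.filter_subset _ _) hV
  refine Finset.filter_true_of_mem fun l hl => ?_
  rcases Finset.mem_insert.mp hl with rfl | hl
  · exact ⟨le_rfl, h.le⟩
  · obtain rfl := Finset.mem_singleton.mp hl
    exact ⟨h.le, le_rfl⟩

theorem isQuasiIso_pair {i j : Fin (n + 1)} (h : i < j) :
    P0Glue.IsQuasiIso
      (F := sectionsPresheaf (D.A i) ((Insert.insert i {j} : Finset (Fin (n + 1))).inf U))
      (G := sectionsPresheaf (D.A j) ((Insert.insert i {j} : Finset (Fin (n + 1))).inf U) ⋙
        tensorFunctor k 0)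
      (Functor.whiskerLeft (OpensIn.ofOpens _).op ((D.K (isEnds_pair h)).app (op ⦋0⦌)
        (cubeHom.{u} _ i j ((Chain.single j).insert i)
          insert_single_subset).monotone.functor)) :=
  D.quasiIso (isEnds_pair h) (Finset.card_pair h.ne) _

/-- For i = j the link is the identification of an algebra with its tensor product with Ω(Δ⁰). For i
< j it is the first gluing condition, which the criterion turns into statements about sections. -/
theorem system_isQuasiIso : D.system.IsQuasiIso where
  surj {i j} hij V hi hj p x hx b hb hdb := by
    rcases hij.eq_or_lt with rfl | h
    · obtain ⟨a, rfl⟩ := unitHom_surjective _ b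
      refine ⟨V, le_rfl, hx, a, unitHom_mem hb, unitHom_injective _ ?_, 0, zero_mem _, ?_⟩
      · exact ((unitHom _ 0).map_d a).trans (hdb.trans (map_zero _).symm)
      · rw [D.link_self, D.system.res_self, tensorMap_id, map_zero, add_zero]
        rfl
    · let I : Finset (Fin (n + 1)) := Insert.insert i {j}
      have hV : V ≤ I.inf U := CoherentSystem.le_inf_pair hi hj
      obtain ⟨hs, -⟩ := (isQuasiIso_iff _).mp (D.isQuasiIso_pair h)
      let V₀ : Opens ((Opens.toTopCat X).obj (I.inf U)) := (Opens.map (I.inf U).inclusion').obj V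
      -- The criterion speaks of the subspace U_I. The image V₁ of the preimage of V has the same
      -- points as V, and restriction to it turns b into a section over an open subset of that
      -- subspace.
      let V₁ : Opens X := (I.inf U).isOpenEmbedding.functor.obj V₀
      have h₁ : V₁ ≤ V := by
        rintro _ ⟨y, hy, rfl⟩
        exact hy
      let b₁ := (tensorMap (D.system.res j h₁) id).toAlgHom b
      obtain ⟨W, hW, hxW, a, ha, hda, c, hc, e⟩ := hs p V₀ ⟨x, hV hx⟩ hx b₁
        ((tensorMap (D.system.res j h₁) id).map_deg hb)
        (((tensorMap (D.system.res j h₁) id).map_d b).symm.trans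
          ((congrArg _ hdb).trans (map_zero _)))
      let W₁ : Opens X := (I.inf U).isOpenEmbedding.functor.obj W
      have h₂ : W₁ ≤ V₁ := leOfHom ((I.inf U).isOpenEmbedding.functor.map (homOfLE hW))
      refine ⟨W₁, h₂.trans h₁, ⟨_, hxW, rfl⟩, a, ha, hda, c, hc, ?_⟩
      rw [D.link_of_lt h _ _ ((h₂.trans h₁).trans hV)]
      refine Eq.trans ?_ e
      refine Eq.trans ?_ (congrArg (fun f : tensorObj ((D.system.F j).obj (op V)) 0 ⟶
        tensorObj ((D.system.F j).obj (op W₁)) 0 => f.toAlgHom b)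
          (tensorMap_comp (D.system.res j h₁) (D.system.res j h₂) id id))
      rw [D.system.res_comp]
      rfl
  inj {i j} hij V hi hj p x hx a ha hda b hb e := by
    rcases hij.eq_or_lt with rfl | h
    · obtain ⟨b, rfl⟩ := unitHom_surjective _ b
      refine ⟨V, le_rfl, hx, b, unitHom_mem hb, unitHom_injective _ ?_⟩
      rw [D.link_self] at e
      rw [D.system.res_self, (unitHom _ 0).map_d, ← e]
      rfl
    · let I : Finset (Fin (n + 1)) := Insert.insert i {j}
      have hV : V ≤ I.inf U := CoherentSystem.le_inf_pair hi hj
      obtain ⟨-, hs⟩ := (isQuasiIso_iff _).mp (D.isQuasiIso_pair h)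
      let V₀ : Opens ((Opens.toTopCat X).obj (I.inf U)) := (Opens.map (I.inf U).inclusion').obj V
      let V₁ : Opens X := (I.inf U).isOpenEmbedding.functor.obj V₀
      have h₁ : V₁ ≤ V := by
        rintro _ ⟨y, hy, rfl⟩
        exact hy
      have e₁ : (D.chainHom (isEnds_pair h) ((Chain.single j).insert i) insert_single_subset V₁
          (h₁.trans hV)).toAlgHom ((D.system.res i h₁).toAlgHom a) =
          (tensorObj ((D.system.F j).obj (op V₁)) 0).d
            ((tensorMap (D.system.res j h₁) id).toAlgHom b) := by
        rw [← (tensorMap (D.system.res j h₁) id).map_d, ← e, D.link_of_lt h hi hj hV]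
        exact congrArg (fun f : (D.system.F i).obj (op V) ⟶
          tensorObj ((D.system.F j).obj (op V₁)) 0 => f.toAlgHom a)
          (D.chainHom_res (isEnds_pair h) ((Chain.single j).insert i) insert_single_subset hV h₁)
      obtain ⟨W, hW, hxW, c, hc, e₂⟩ := hs p V₀ ⟨x, hV hx⟩ hx ((D.system.res i h₁).toAlgHom a)
        ((D.system.res i h₁).map_deg ha)
        (((D.system.res i h₁).map_d a).symm.trans ((congrArg _ hda).trans (map_zero _)))
        _ ((tensorMap (D.system.res j h₁) id).map_deg hb) e₁
      let W₁ : Opens X := (I.inf U).isOpenEmbedding.functor.obj W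
      have h₂ : W₁ ≤ V₁ := leOfHom ((I.inf U).isOpenEmbedding.functor.map (homOfLE hW))
      refine ⟨W₁, h₂.trans h₁, ⟨_, hxW, rfl⟩, c, hc, Eq.trans ?_ e₂⟩
      exact congrArg (fun f : (D.system.F i).obj (op V) ⟶ (D.system.F i).obj (op W₁) =>
        f.toAlgHom a) (D.system.res_comp i h₁ h₂).symm

variable (i : Fin (n + 1))

theorem functor_obj_le (V : Opens ((Opens.toTopCat X).obj (U i))) :
    (U i).isOpenEmbedding.functor.obj V ≤ U i := by
  rintro _ ⟨y, -, rfl⟩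
  exact y.2

theorem map_functor_obj_le (V : Opens ((Opens.toTopCat X).obj (U i))) :
    (Opens.map (U i).inclusion').obj ((U i).isOpenEmbedding.functor.obj V) ≤ V := by
  rintro y ⟨z, hz, e⟩
  obtain rfl : z = y := Subtype.ext e
  exact hz

/-- The identification of the sections of `A i` over `V` with those of its direct image. -/
def toDirect (V : Opens ((Opens.toTopCat X).obj (U i))) : (D.A i).presheaf.obj (op V) ⟶
    (D.system.F i).obj (op ((U i).isOpenEmbedding.functor.obj V)) :=
  (D.A i).presheaf.map (homOfLE (map_functor_obj_le i V)).op

theorem map_toDirect {V V' : Opens ((Opens.toTopCat X).obj (U i))} (f : V' ⟶ V)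
    (h : (U i).isOpenEmbedding.functor.obj V' ≤ (U i).isOpenEmbedding.functor.obj V) :
    (D.A i).presheaf.map f.op ≫ D.toDirect i V' = D.toDirect i V ≫ D.system.res i h :=
  ((D.A i).presheaf.map_comp f.op (homOfLE (map_functor_obj_le i V')).op).symm.trans
    ((D.A i).presheaf.map_comp (homOfLE (map_functor_obj_le i V)).op
      ((Opens.map (U i).inclusion').map (homOfLE h)).op)

theorem preimage_le {V : Opens ((Opens.toTopCat X).obj (U i))} {W : Opens X}
    (hW : W ≤ (U i).isOpenEmbedding.functor.obj V) : (Opens.map (U i).inclusion').obj W ≤ V :=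
  (leOfHom ((Opens.map (U i).inclusion').map (homOfLE hW))).trans (map_functor_obj_le i V)

variable {G : TopCat.Presheaf (DGP0Alg k) X} (η : D.system.glued ⟶ G)

/-- The morphism from `A i` to the restriction of a presheaf under the glued presheaf. -/
def toGlued : (D.A i).presheaf ⟶ (U i).isOpenEmbedding.functor.op ⋙ G where
  app V := D.toDirect i V.unop ≫ D.system.toSheaf η (functor_obj_le i V.unop)
  naturality V V' f := by
    have h := leOfHom ((U i).isOpenEmbedding.functor.map f.unop)
    have e : ((D.A i).presheaf.map f ≫ D.toDirect i V'.unop) ≫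
        D.system.toSheaf η (functor_obj_le i V'.unop) =
        (D.toDirect i V.unop ≫ D.system.toSheaf η (functor_obj_le i V.unop)) ≫
          G.map (homOfLE h).op := by
      rw [Category.assoc (D.toDirect i V.unop), ← D.system.res_toSheaf η _ h, ← Category.assoc]
      exact congrArg (fun g => g ≫ D.system.toSheaf η (functor_obj_le i V'.unop))
        (D.map_toDirect i f.unop h)
    exact (Category.assoc _ _ _).symm.trans e

variable {η}

theorem toGlued_locallySurjective [CharZero k] (hη : IsLocallyBijective η) :
    LocallySurjectiveOnCohomology (D.toGlued i η) := by
  intro p V y hy b hb hdb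
  obtain ⟨W, hW, hyW, a, ha, hda, c, hc, e⟩ := CoherentSystem.toSheaf_surjective
    D.system_isQuasiIso hη (functor_obj_le i V) p (x := y.1) ⟨y, hy, rfl⟩ b hb hdb
  -- The neighbourhood W was found in X, while the criterion asks for an open subset of the subspace
  -- U i. Its preimage is used, and everything is restricted along this inclusion.
  have hW' : (U i).isOpenEmbedding.functor.obj ((Opens.map (U i).inclusion').obj W) ≤ W := by
    rintro _ ⟨y, hy, rfl⟩
    exact hy
  refine ⟨(Opens.map (U i).inclusion').obj W, preimage_le i hW, hyW, a, ha, hda,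
    (G.map (homOfLE hW').op).toAlgHom c, (G.map (homOfLE hW').op).map_deg hc, ?_⟩
  have e₁ := congrArg (G.map (homOfLE hW').op).toAlgHom e
  rw [map_add, (G.map (homOfLE hW').op).map_d, map_map_apply G hW hW'] at e₁
  refine e₁.trans (congrArg (fun z => z + _) ?_)
  exact congrArg (fun f : (D.system.F i).obj (op W) ⟶ G.obj _ =>
      f.toAlgHom a) (D.system.res_toSheaf η (hW.trans (functor_obj_le i V)) hW').symm

theorem toGlued_locallyInjective (hη : IsLocallyBijective η) :
    LocallyInjectiveOnCohomology (D.toGlued i η) := by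
  intro p V y hy a ha hda b hb e
  obtain ⟨W, hW, hyW, c, hc, e₁⟩ := CoherentSystem.toSheaf_injective
    D.system_isQuasiIso hη (functor_obj_le i V) p (x := y.1) ⟨y, hy, rfl⟩
    ((D.toDirect i V).toAlgHom a) ((D.toDirect i V).map_deg ha)
    (((D.toDirect i V).map_d a).symm.trans ((congrArg _ hda).trans (map_zero _))) b hb e
  refine ⟨(Opens.map (U i).inclusion').obj W, preimage_le i hW, hyW, c, hc, Eq.trans ?_ e₁⟩
  exact (map_map_apply (D.A i).presheaf (map_functor_obj_le i V)
    (leOfHom ((Opens.map (U i).inclusion').map (homOfLE hW))) a).symm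

theorem toGlued_isQuasiIso [CharZero k] (hη : IsLocallyBijective η) :
    IsQuasiIso (D.toGlued i η) :=
  (isQuasiIso_iff _).mpr ⟨D.toGlued_locallySurjective i hη, D.toGlued_locallyInjective i hη⟩

end GluingData

end

end P0Glue

theorem mainTheorem9 (k : Type u) [Field k] [CharZero k] (X : TopCat.{u}) [NoetherianSpace X]
    (n : ℕ) (U : Fin (n + 1) → Opens X) (hU : ⨆ i, U i = ⊤) (D : P0Glue.GluingData k U) :
    ∃ A : TopCat.Sheaf (P0Glue.DGP0Alg k) X,
      ∀ i, P0Glue.QuasiIsomorphic (P0Glue.restrictSheaf A (U i)) (D.A i) := by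
  obtain ⟨B, η, hη⟩ := P0Glue.exists_isLocallyBijective D.system.glued
  -- The zigzag is a single arrow, which runs from `D.A i` to the restriction of B.
  exact ⟨B, fun i => Relation.EqvGen.symm _ _ (Relation.EqvGen.rel _ _
    ⟨D.toGlued i η, D.toGlued_isQuasiIso i hη⟩)⟩
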